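/- All logarithms are to base 2. Let $n_1,n_2$ be positive integers with $n_1$ even and $n_2\le n_1/2$, and put $t=n_1/2$, $N=t\,2^{n_2}$. Represent the field $\mathbb F=\mathrm{GF}(2^{t})$ as $\mathbb F_2[X]/(P)$ with $P$ irreducible of degree $t$, and identify an element of $\mathbb F$ with the string of the $t$ coefficients of its representative of degree $<t$. Fix an injective map $y\mapsto\alpha_y$ from $\{0,1\}^{n_2}$ to $\mathbb F$. For $p'\ge 1$ and $x\in\{0,1\}^{n_1}$ let $\beta_x,\nu_x\in\mathbb F$ be given by the first and the last $t$ bits of $x$, and let $G(x)\in\{0,1\}^{N}$ be the string with $2^{n_2}$ blocks of $t$ bits whose block $y\in\{0,1\}^{n_2}$ is $$G(x)_y=\nu_x\sum_{i=0}^{p'-1}(\alpha_y\beta_x)^i\in\mathbb F .$$ For $m\le t$ let $\mathrm{Ext}(x,y)\in\{0,1\}^m$ be the first $m$ bits of block $y$ of $G(x)$. Notions. $\mathrm{SD}[X,Y]=\frac12\sum_z|\Pr(X=z)-\Pr(Y=z)|$; $U_m$ is uniform on $\{0,1\}^m$; $\mathrm H_\infty(X)=-\log\max_x\Pr(X=x)$.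 $G:\{0,1\}^{r}\to\{0,1\}^N$ is a $(p',\zeta)$-biased generator (where $1\le p'\le N$, $\zeta\ge0$) if for uniform $X$ and every non-empty set $\tau$ of at most $p'$ output positions, $2\,\mathrm{SD}[\bigoplus_{i\in\tau}G(X)_i,U_1]\le\zeta$. $\mathrm{Ext}$ is an $(n_1,k_1,n_2,k_2,m,\epsilon)$ two-source extractor if $\mathrm{SD}[\mathrm{Ext}(X,Y),U_m]\le\epsilon$ for all independent $X$ on $\{0,1\}^{n_1}$ and $Y$ on $\{0,1\}^{n_2}$ with $\mathrm H_\infty(X)\ge k_1$, $\mathrm H_\infty(Y)\ge k_2$; it is strong in either input if moreover $\mathrm{SD}[\mathrm{Ext}(X,Y)\circ X,\,U_m\circ X]\le\epsilon$ and $\mathrm{SD}[\mathrm{Ext}(X,Y)\circ Y,\,U_m\circ Y]\le\epsilon$ for all such $X,Y$, with $U_m$ independent of them. Lemma (efficient Raz's extractor construction). Let $k_1,k_2,m,l,p$ be positive integers and $\gamma>0$ such that $m\le n_1/2$, $l\le n_2+\log(n_1/2)$, $p$ is even, $p\le 2^l/m$ and $$\gamma\ \ge\ 2^{(n_1-k_1)/p}\left[(2\zeta)^{1/p}+p\,2^{-k_2/2}\right],\qquad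 \zeta=2^{\,l-n_1/2}.$$ Take $p'=2^l$. Then: (i) $G:\{0,1\}^{n_1}\to\{0,1\}^N$ is a $(p',2\zeta)$-biased generator. (ii) $\mathrm{Ext}$ is an $(n_1,k_1,n_2,k_2,m,2^{m/2}\gamma)$ two-source extractor, and a strong (in either input) $(n_1,k_1',n_2,k_2',m,\gamma\,2^{m/2+1})$ two-source extractor, where $k_i'=k_i+m/2+2+\log(1/\gamma)$ for $i=1,2$. (iii) Let $\alpha_y$ be the field element whose coefficients are the bits of $y$ padded with zeros. Then $\mathrm{Ext}(x,y)$ can be computed in time $O(n_1\log (n_1)\log (p'))$ on a word RAM with words of $\Theta(\log n_1)$ bits. Precisely, there are one program and constants $c,C$ such that, for all parameters $n_1,n_2,m,l,P$ as above, every word length $w$ with $2^w\ge n_1^c$, and all $x,y$, the program, given $n_1,n_2,l,m$, the coefficients of $P$, and the bits of $x$ and $y$, halts with output $\mathrm{Ext}(x,y)$ after at most $C\,n_1\log (n_1)\log (p')$ steps, each step being an operation on $w$-bit words. -/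

import Mathlib

/-! ### Bit strings, distributions, statistical distance, min-entropy -/

/-- Bit strings of length `n`; bits live in `ZMod 2`, so that XOR is addition. -/
abbrev Bits (n : ℕ) : Type := Fin n → ZMod 2

/-- Statistical distance of two distributions on a finite set. -/
noncomputable def statDist {α : Type*} [Fintype α] (p q : PMF α) : ℝ :=
  1 / 2 * ∑ a, |(p a).toReal - (q a).toReal|

/-- Min-entropy (base 2 logarithm). -/
noncomputable def minEntropy {α : Type*} [Fintype α] (p : PMF α) : ℝ :=
  -Real.logb 2 (⨆ a, (p a).toReal)

/-- The joint distribution of independent random variables with laws `p` and `q`. -/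
noncomputable def indepJoint {α β : Type*} (p : PMF α) (q : PMF β) : PMF (α × β) :=
  p.bind fun a => q.map fun b => (a, b)

/-! ### Small-bias distributions and generators -/

/-- The random bit vector with law `Z`, with bits indexed by the finite set `ι`, is `ζ`-biased
for linear tests of size `p'`. -/
def IsBiased {ι : Type*} [Fintype ι] [DecidableEq ι] (p' : ℕ) (ζ : ℝ)
    (Z : PMF (ι → ZMod 2)) : Prop :=
  0 < p' ∧ p' ≤ Fintype.card ι ∧ 0 ≤ ζ ∧
    ∀ τ : Finset ι, τ.Nonempty → τ.card ≤ p' →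
      2 * statDist (Z.map fun z => ∑ i ∈ τ, z i) (PMF.uniformOfFintype (ZMod 2)) ≤ ζ

/-- `G`, run on a uniformly random seed of `r` bits, is a `(p', ζ)`-biased generator. -/
def IsBiasedGenerator {ι : Type*} [Fintype ι] [DecidableEq ι] {r : ℕ} (p' : ℕ) (ζ : ℝ)
    (G : Bits r → ι → ZMod 2) : Prop :=
  IsBiased p' ζ ((PMF.uniformOfFintype (Bits r)).map G)

/-! ### Two-source extractors -/

/-- `(n₁, k₁, n₂, k₂, m, ε)` two-source extractors. -/
def IsTwoSourceExtractor {n₁ n₂ m : ℕ} (k₁ k₂ ε : ℝ)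
    (Ext : Bits n₁ → Bits n₂ → Bits m) : Prop :=
  ∀ (X : PMF (Bits n₁)) (Y : PMF (Bits n₂)), k₁ ≤ minEntropy X → k₂ ≤ minEntropy Y →
    statDist ((indepJoint X Y).map fun s => Ext s.1 s.2)
      (PMF.uniformOfFintype (Bits m)) ≤ ε

/-- The extractor is strong in the first input. -/
def IsStrongInFirst {n₁ n₂ m : ℕ} (k₁ k₂ ε : ℝ)
    (Ext : Bits n₁ → Bits n₂ → Bits m) : Prop :=
  ∀ (X : PMF (Bits n₁)) (Y : PMF (Bits n₂)), k₁ ≤ minEntropy X → k₂ ≤ minEntropy Y →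
    statDist ((indepJoint X Y).map fun s => (Ext s.1 s.2, s.1))
      (indepJoint (PMF.uniformOfFintype (Bits m)) X) ≤ ε

/-- The extractor is strong in the second input. -/
def IsStrongInSecond {n₁ n₂ m : ℕ} (k₁ k₂ ε : ℝ)
    (Ext : Bits n₁ → Bits n₂ → Bits m) : Prop :=
  ∀ (X : PMF (Bits n₁)) (Y : PMF (Bits n₂)), k₁ ≤ minEntropy X → k₂ ≤ minEntropy Y →
    statDist ((indepJoint X Y).map fun s => (Ext s.1 s.2, s.2))
      (indepJoint (PMF.uniformOfFintype (Bits m)) Y) ≤ ε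

/-- Two-source extractors that are strong in either input. -/
def IsStrongTwoSourceExtractor {n₁ n₂ m : ℕ} (k₁ k₂ ε : ℝ)
    (Ext : Bits n₁ → Bits n₂ → Bits m) : Prop :=
  IsTwoSourceExtractor k₁ k₂ ε Ext ∧ IsStrongInFirst k₁ k₂ ε Ext ∧ IsStrongInSecond k₁ k₂ ε Ext

/-! ### The generator

The field with `2 ^ t` elements is `𝔽₂[X] / (P)` for an irreducible `P` of degree `t`, and a field
element is identified with the string of the `t` coefficients of its representative of
degree `< t`. -/

/-- One field element of the output of the generator:
`G(β, ν)_α = ν * ∑_{i < p'} (α β) ^ i`. -/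
def mekaGenerator {F : Type*} [CommSemiring F] (p' : ℕ) (α β ν : F) : F :=
  ν * ∑ i ∈ Finset.range p', (α * β) ^ i

/-- The element of `𝔽₂[X] / (P)` whose coefficients are the given bits (padded with zeros). -/
noncomputable def ofBits (P : Polynomial (ZMod 2)) {s : ℕ} (b : Bits s) : AdjoinRoot P :=
  AdjoinRoot.mk P (∑ i : Fin s, Polynomial.C (b i) * Polynomial.X ^ (i : ℕ))

/-- The first `s` coefficients of the reduced representative of an element of `𝔽₂[X] / (P)`. -/
noncomputable def toBits {P : Polynomial (ZMod 2)} (hP : P.Monic) (s : ℕ) (z : AdjoinRoot P) :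
    Bits s :=
  fun i => (AdjoinRoot.modByMonicHom hP z).coeff (i : ℕ)

/-- The first `n₁ / 2` bits of a string of length `n₁`. -/
def firstHalf {n₁ : ℕ} (x : Bits n₁) : Bits (n₁ / 2) :=
  fun i => x ⟨i, by omega⟩

/-- The next `n₁ / 2` bits of a string of length `n₁`. -/
def secondHalf {n₁ : ℕ} (x : Bits n₁) : Bits (n₁ / 2) :=
  fun i => x ⟨n₁ / 2 + i, by omega⟩

/-- The generator as a map from `n₁` bits to `(n₁ / 2) * 2 ^ n₂` bits: `2 ^ n₂` blocks, labelled
by `y : Bits n₂`, of `n₁ / 2` bits each. The map `a` assigns to each label `y` the field element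
`α` of its block, and the two halves of the seed are `β` and `ν`. -/
noncomputable def bitGenerator {P : Polynomial (ZMod 2)} (hP : P.Monic) {n₁ n₂ : ℕ}
    (a : Bits n₂ → AdjoinRoot P) (p' : ℕ) (x : Bits n₁) :
    Bits n₂ × Fin (n₁ / 2) → ZMod 2 :=
  fun j => toBits hP (n₁ / 2)
    (mekaGenerator p' (a j.1) (ofBits P (firstHalf x)) (ofBits P (secondHalf x))) j.2

/-- The extractor: the first `m` bits of block `y` of the output of the generator on seed `x`. -/
noncomputable def razExtractor {P : Polynomial (ZMod 2)} (hP : P.Monic) {n₁ n₂ m : ℕ}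
    (a : Bits n₂ → AdjoinRoot P) (p' : ℕ) (hm : m ≤ n₁ / 2) (x : Bits n₁) (y : Bits n₂) :
    Bits m :=
  fun i => bitGenerator hP a p' x (y, Fin.castLE hm i)

/-! ### A word RAM with a step count

A program has registers and arrays of cells (both named by numbers, so a given program uses
finitely many of them). Registers and cells hold words of `w` bits, that is, numbers below `2 ^ w`.
Each evaluated node of an expression and each executed statement costs one step. -/

/-- The binary word instructions. -/
inductive WordOp where
  | add | sub | mul | div | mod | and | or | xor | shl | shr | lt | eq

/-- The result of a binary instruction before truncation to word length; subtraction is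
truncated at `0`, and comparisons return `1` or `0`. -/
def WordOp.apply : WordOp → ℕ → ℕ → ℕ
  | .add, a, b => a + b
  | .sub, a, b => a - b
  | .mul, a, b => a * b
  | .div, a, b => a / b
  | .mod, a, b => a % b
  | .and, a, b => a &&& b
  | .or, a, b => a ||| b
  | .xor, a, b => a ^^^ b
  | .shl, a, b => a <<< b
  | .shr, a, b => a >>> b
  | .lt, a, b => if a < b then 1 else 0
  | .eq, a, b => if a = b then 1 else 0

/-- Expressions: constants, registers, array cells (with computed address), instructions. -/
inductive WordExpr where
  | const (v : ℕ)
  | reg (r : ℕ)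
  | cell (arr : ℕ) (i : WordExpr)
  | op (o : WordOp) (e₁ e₂ : WordExpr)

/-- Programs. -/
inductive Program where
  | skip
  | setReg (r : ℕ) (e : WordExpr)
  | setCell (arr : ℕ) (i e : WordExpr)
  | seq (c₁ c₂ : Program)
  | ifNonzero (e : WordExpr) (c₁ c₂ : Program)
  | whileNonzero (e : WordExpr) (c : Program)

/-- The contents of the registers and of the arrays. -/
structure RamState where
  reg : ℕ → ℕ
  mem : ℕ → ℕ → ℕ

/-- The value of an expression on a machine with words of `w` bits. -/
def WordExpr.eval (w : ℕ) (s : RamState) : WordExpr → ℕ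
  | .const v => v % 2 ^ w
  | .reg r => s.reg r
  | .cell arr i => s.mem arr (i.eval w s)
  | .op o e₁ e₂ => o.apply (e₁.eval w s) (e₂.eval w s) % 2 ^ w

/-- The number of steps needed to evaluate an expression. -/
def WordExpr.cost : WordExpr → ℕ
  | .const _ => 1
  | .reg _ => 1
  | .cell _ i => i.cost + 1
  | .op _ e₁ e₂ => e₁.cost + e₂.cost + 1

/-- `Exec w c s T s'`: on a machine with words of `w` bits, program `c` started in state `s` halts
after exactly `T` steps in state `s'`. -/
inductive Exec (w : ℕ) : Program → RamState → ℕ → RamState → Prop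
  | skip (s : RamState) : Exec w .skip s 1 s
  | setReg (s : RamState) (r : ℕ) (e : WordExpr) :
      Exec w (.setReg r e) s (e.cost + 1)
        { reg := Function.update s.reg r (e.eval w s), mem := s.mem }
  | setCell (s : RamState) (arr : ℕ) (i e : WordExpr) :
      Exec w (.setCell arr i e) s (i.cost + e.cost + 1)
        { reg := s.reg
          mem := Function.update s.mem arr
            (Function.update (s.mem arr) (i.eval w s) (e.eval w s)) }
  | seq {c₁ c₂ : Program} {s₁ s₂ s₃ : RamState} {T₁ T₂ : ℕ} :
      Exec w c₁ s₁ T₁ s₂ → Exec w c₂ s₂ T₂ s₃ → Exec w (.seq c₁ c₂) s₁ (T₁ + T₂ + 1) s₃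
  | ifTrue {e : WordExpr} {c₁ c₂ : Program} {s s' : RamState} {T : ℕ} :
      e.eval w s ≠ 0 → Exec w c₁ s T s' → Exec w (.ifNonzero e c₁ c₂) s (e.cost + T + 1) s'
  | ifFalse {e : WordExpr} {c₁ c₂ : Program} {s s' : RamState} {T : ℕ} :
      e.eval w s = 0 → Exec w c₂ s T s' → Exec w (.ifNonzero e c₁ c₂) s (e.cost + T + 1) s'
  | whileDone {e : WordExpr} {c : Program} {s : RamState} :
      e.eval w s = 0 → Exec w (.whileNonzero e c) s (e.cost + 1) s
  | whileStep {e : WordExpr} {c : Program} {s₁ s₂ s₃ : RamState} {T₁ T₂ : ℕ} :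
      e.eval w s₁ ≠ 0 → Exec w c s₁ T₁ s₂ → Exec w (.whileNonzero e c) s₂ T₂ s₃ →
        Exec w (.whileNonzero e c) s₁ (e.cost + T₁ + T₂ + 1) s₃

/-- A bit string stored one bit per cell, followed by zeros. -/
def bitArray {n : ℕ} (b : Bits n) : ℕ → ℕ :=
  fun i => if h : i < n then (b ⟨i, h⟩).val else 0

/-- The initial state: the numbers `n₁, n₂, l, m` are in registers `0, 1, 2, 3`, and the
coefficients of `P`, the bits of `x` and the bits of `y` are in arrays `0, 1, 2`. Everything else
is zero. -/
def inputState (P : Polynomial (ZMod 2)) {n₁ n₂ : ℕ} (l m : ℕ) (x : Bits n₁) (y : Bits n₂) :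
    RamState where
  reg
    | 0 => n₁
    | 1 => n₂
    | 2 => l
    | 3 => m
    | _ => 0
  mem
    | 0 => fun i => (P.coeff i).val
    | 1 => bitArray x
    | 2 => bitArray y
    | _ => fun _ => 0

/-- Program `c`, on a machine with words of `w` bits started in state `s`, halts within `B` steps
with the string `out` in the first cells of array `3`. -/
def ComputesWithin (w : ℕ) (c : Program) (s : RamState) (B : ℝ) {m : ℕ} (out : Bits m) : Prop :=
  ∃ (T : ℕ) (s' : RamState), Exec w c s T s' ∧ (T : ℝ) ≤ B ∧
    ∀ i : Fin m, s'.mem 3 (i : ℕ) = (out i).val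

/-! ### Signs, finite distributions -/

/-! Bias. On each block a linear test is a functional `z ↦ Tr (c_y z)`. Exchanging sums, a test that
meets the set `S` of blocks has the value `Tr (ν q(β))`, where `q` has the coefficients `∑_{y ∈ S}
c_y α_y ^ j` for `j < p'`. If `S` has at most `p'` elements, a Vandermonde argument gives `q ≠ 0`
(`exists_polynomial_of_functionals`). If `q(β) ≠ 0`, the signs cancel in the sum over `ν`, and fewer
than `p'` values of `β` are roots. So the bias is at most `p' / 2 ^ t = ζ`
(`abs_sum_bitSign_bitGenerator_le`). Only the number of blocks matters: a test on all `m` output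
bits of a block costs no more than a test on one bit.

Extraction. Fix a non-empty test `τ` of the output and let `A(x)` be the average over `Y` of its
sign. Expand `∑_x A(x) ^ p` over `p`-tuples of values of `Y`. Signs of equal entries cancel in
pairs. A tuple with a value of odd multiplicity leaves a non-empty linear test, which the small bias
controls; the other tuples have total weight at most `p ^ p 2 ^ (-k₂ p / 2)`
(`sum_pow_signed_sum_le`). A source of entropy `k₁` loses a factor `2 ^ (n₁ - k₁)` against the
uniform one, and Jensen's inequality gives a second moment at most `γ ^ 2` (`SecondMomentBound`).
Parseval's identity for the Walsh transform bounds the squared `L¹` distance from uniform by the sum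
of the squared biases, so the distance averaged over `X` is at most `2 ^ (m/2) γ`. The average
stands outside the absolute values, so this also gives strength in the first input. For the second
input, the `y` with bias above `γ` for some test have small weight: otherwise `Y`, conditioned on
them, would be a source of entropy `k₂` violating the bound. This is what the additional entropy
pays for.

Running time. In characteristic 2, `∑_{i < 2 ^ l} z ^ i = ∏_{j < l} (1 + z) ^ (2 ^ j)`
(`sum_pow_eq_prod`), so `O(l)` field multiplications suffice. Each consists of three products of
polynomials over `𝔽₂`: the product itself and two for the reduction modulo `P` by means of an
approximate inverse of `P`, which Newton's iteration computes once (`Runs.fieldMulP`,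
`Runs.newtonP`). Polynomials are lifted to 0/1 integer coefficients and multiplied by a fast Fourier
transform in fixed-point complex arithmetic (`Runs.mulP`). With the precision `D = n ^ 20`, where
`n` bounds the transform length, the final error is below half the spacing of the integers to be
recovered, while all numbers fit in `O(log n)` bits. The twiddle factors come from half-angle
formulas and integer square roots (`Runs.tableP`). -/

/-- The sign `(-1) ^ b` of a bit. -/
noncomputable def bitSign (b : ZMod 2) : ℝ := if b = 0 then 1 else -1

@[simp] lemma bitSign_zero : bitSign 0 = 1 := by simp [bitSign]

@[simp] lemma bitSign_one : bitSign 1 = -1 := by simp [bitSign]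

lemma ZMod.two_eq_zero_or_one (b : ZMod 2) : b = 0 ∨ b = 1 := by
  revert b; decide

lemma bitSign_add (a b : ZMod 2) : bitSign (a + b) = bitSign a * bitSign b := by
  have h : (1 + 1 : ZMod 2) = 0 := by decide
  rcases ZMod.two_eq_zero_or_one a with rfl | rfl <;>
    rcases ZMod.two_eq_zero_or_one b with rfl | rfl <;> simp [h]

lemma bitSign_mul_self (a : ZMod 2) : bitSign a * bitSign a = 1 := by
  rcases ZMod.two_eq_zero_or_one a with rfl | rfl <;> simp

lemma abs_bitSign (a : ZMod 2) : |bitSign a| = 1 := by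
  rcases ZMod.two_eq_zero_or_one a with rfl | rfl <;> simp

lemma bitSign_sum {ι : Type*} (s : Finset ι) (f : ι → ZMod 2) :
    bitSign (∑ i ∈ s, f i) = ∏ i ∈ s, bitSign (f i) := by
  classical
  induction s using Finset.induction_on with
  | empty => simp
  | insert a s ha ih => rw [Finset.sum_insert ha, Finset.prod_insert ha, bitSign_add, ih]

lemma PMF.sum_toReal {α : Type*} [Fintype α] (p : PMF α) : ∑ a, (p a).toReal = 1 := by
  have h := p.tsum_coe
  rw [tsum_fintype] at h
  rw [← ENNReal.toReal_sum (fun a _ => p.apply_ne_top a), h, ENNReal.toReal_one]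

lemma PMF.sum_map_toReal_mul {α β : Type*} [Fintype α] [Fintype β] (p : PMF α) (g : α → β)
    (f : β → ℝ) : ∑ b, (p.map g b).toReal * f b = ∑ a, (p a).toReal * f (g a) := by
  classical
  have h : ∀ b, (p.map g b).toReal = ∑ a, if b = g a then (p a).toReal else 0 := by
    intro b
    rw [PMF.map_apply, tsum_fintype, ENNReal.toReal_sum]
    · refine Finset.sum_congr rfl fun a _ => ?_
      split_ifs <;> simp
    · intro a _
      split_ifs
      · exact p.apply_ne_top a
      · simp
  simp_rw [h, Finset.sum_mul]
  rw [Finset.sum_comm]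
  refine Finset.sum_congr rfl fun a _ => ?_
  simp

lemma PMF.map_toReal {α β : Type*} [Fintype α] [Fintype β] [DecidableEq β] (p : PMF α)
    (g : α → β) (b : β) :
    (p.map g b).toReal = ∑ a, (p a).toReal * if g a = b then 1 else 0 := by
  rw [← PMF.sum_map_toReal_mul p g (fun c => if c = b then (1 : ℝ) else 0)]
  simp

lemma PMF.uniformOfFintype_toReal {α : Type*} [Fintype α] [Nonempty α] (a : α) :
    (PMF.uniformOfFintype α a).toReal = (Fintype.card α : ℝ)⁻¹ := by
  simp

/-- The two probabilities sum to 1, hence deviate from `1/2` by the same amount. This turns biases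
into character sums. -/
lemma two_mul_statDist_bit (p : PMF (ZMod 2)) :
    2 * statDist p (PMF.uniformOfFintype (ZMod 2)) = |∑ b, (p b).toReal * bitSign b| := by
  have hs := p.sum_toReal
  have e : ∀ f : ZMod 2 → ℝ, ∑ b, f b = f 0 + f 1 := fun f => Fin.sum_univ_two f
  rw [e] at hs
  unfold statDist
  rw [e, e]
  simp only [PMF.uniformOfFintype_toReal, ZMod.card, bitSign_zero, bitSign_one]
  have h1 : (p 1).toReal = 1 - (p 0).toReal := by linarith
  rw [h1]
  have h2 : (1 - (p 0).toReal - ((2 : ℕ) : ℝ)⁻¹) = -((p 0).toReal - ((2 : ℕ) : ℝ)⁻¹) := by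
    push_cast; ring
  rw [h2, abs_neg]
  have h3 : (p 0).toReal * 1 + (1 - (p 0).toReal) * -1
      = 2 * ((p 0).toReal - ((2 : ℕ) : ℝ)⁻¹) := by push_cast; ring
  rw [h3, abs_mul, abs_two]
  ring

lemma two_mul_statDist_map_uniform {α : Type*} [Fintype α] [Nonempty α] (g : α → ZMod 2) :
    2 * statDist ((PMF.uniformOfFintype α).map g) (PMF.uniformOfFintype (ZMod 2))
      = |∑ a, bitSign (g a)| / Fintype.card α := by
  rw [two_mul_statDist_bit, PMF.sum_map_toReal_mul]
  simp only [PMF.uniformOfFintype_toReal]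
  rw [← Finset.mul_sum, abs_mul, abs_of_nonneg (by positivity)]
  ring

/-- The sum of the signs of an additive function that takes the value `1` vanishes. -/
lemma sum_bitSign_eq_zero {G : Type*} [AddGroup G] [Fintype G] (L : G → ZMod 2)
    (hL : ∀ a b, L (a + b) = L a + L b) {a : G} (ha : L a ≠ 0) : ∑ b, bitSign (L b) = 0 := by
  have h1 : L a = 1 := (ZMod.two_eq_zero_or_one _).resolve_left ha
  -- Translation by `a` flips every sign, so the sum equals its own negative.
  have h : ∑ b, bitSign (L b) = ∑ b, bitSign (L (a + b)) :=
    (Equiv.sum_comp (Equiv.addLeft a) fun b => bitSign (L b)).symm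
  simp only [hL, bitSign_add, h1, bitSign_one, neg_mul, one_mul, Finset.sum_neg_distrib] at h
  linarith

/-! ### Bits as elements of the field -/

section Field

open Polynomial

variable {P : (ZMod 2)[X]}

lemma ofBits_add (P : (ZMod 2)[X]) {s : ℕ} (b c : Bits s) :
    ofBits P (b + c) = ofBits P b + ofBits P c := by
  unfold ofBits
  rw [← map_add, ← Finset.sum_add_distrib]
  simp [add_mul]

lemma coeff_sum_bits {s : ℕ} (b : Bits s) (n : ℕ) :
    (∑ i : Fin s, C (b i) * X ^ (i : ℕ)).coeff n = if h : n < s then b ⟨n, h⟩ else 0 := by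
  rw [finsetSum_coeff]
  simp only [coeff_C_mul, coeff_X_pow]
  split_ifs with h
  · rw [Finset.sum_eq_single (⟨n, h⟩ : Fin s)]
    · simp
    · intro i _ hi
      have : n ≠ i := fun e => hi (Fin.ext e.symm)
      simp [this]
    · simp
  · refine Finset.sum_eq_zero fun i _ => ?_
    have : n ≠ i := by omega
    simp [this]

lemma degree_sum_bits_lt {s : ℕ} (b : Bits s) :
    (∑ i : Fin s, C (b i) * X ^ (i : ℕ)).degree < (s : WithBot ℕ) := by
  rw [degree_lt_iff_coeff_zero]
  intro n hn
  rw [coeff_sum_bits, dif_neg (by omega)]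

lemma toBits_ofBits (hP : P.Monic) {s : ℕ} (hs : s ≤ P.natDegree) (b : Bits s) :
    toBits hP s (ofBits P b) = b := by
  ext i
  have hd : (∑ i : Fin s, C (b i) * X ^ (i : ℕ)).degree < P.degree := by
    refine (degree_sum_bits_lt b).trans_le ?_
    rw [degree_eq_natDegree hP.ne_zero]
    exact_mod_cast hs
  unfold toBits ofBits
  rw [AdjoinRoot.modByMonicHom_mk, (modByMonic_eq_self_iff hP).2 hd, coeff_sum_bits, dif_pos i.2]

lemma ofBits_toBits (hP : P.Monic) (z : AdjoinRoot P) :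
    ofBits P (toBits hP P.natDegree z) = z := by
  obtain ⟨f, rfl⟩ := AdjoinRoot.mk_surjective z
  conv_rhs => rw [← AdjoinRoot.mk_leftInverse hP (AdjoinRoot.mk P f)]
  rw [AdjoinRoot.modByMonicHom_mk]
  unfold ofBits
  congr 1
  ext n
  rw [coeff_sum_bits]
  unfold toBits
  split_ifs with h
  · rw [AdjoinRoot.modByMonicHom_mk]
  -- The degree bound on remainders excludes `P = 1`, for which every remainder is zero.
  · by_cases h1 : P = 1
    · subst h1; simp
    rw [coeff_eq_zero_of_natDegree_lt]
    exact (natDegree_modByMonic_lt _ hP h1).trans_le (not_lt.1 h)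

lemma ofBits_injective (hP : P.Monic) {s : ℕ} (hs : s ≤ P.natDegree) :
    Function.Injective (ofBits P : Bits s → AdjoinRoot P) := fun b c h => by
  rw [← toBits_ofBits hP hs b, h, toBits_ofBits hP hs c]

end Field

/-! ### Small bias of the generator -/

section SmallBias

open Polynomial

/-- Every linear functional on a finite field is `z ↦ Tr (c * z)` for some `c`. -/
lemma exists_trace_repr {K F : Type*} [Field K] [Field F] [Algebra K F] [FiniteDimensional K F]
    [Algebra.IsSeparable K F] (L : F →ₗ[K] K) : ∃ c, ∀ z, L z = Algebra.trace K F (c * z) := by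
  refine ⟨((Algebra.traceForm K F).toDual (traceForm_nondegenerate K F)).symm L, fun z => ?_⟩
  have := LinearMap.BilinForm.apply_toDual_symm_apply
    (hB := traceForm_nondegenerate K F) L z
  rw [← this]
  rfl

/-- Non-degeneracy of the trace form; it supplies a `ν` that detects a `β` at which the polynomial
does not vanish. -/
lemma exists_trace_ne_zero (K : Type*) {F : Type*} [Field K] [Field F] [Algebra K F]
    [FiniteDimensional K F] [Algebra.IsSeparable K F] {c : F} (hc : c ≠ 0) :
    ∃ ν, Algebra.trace K F (ν * c) ≠ 0 := by
  by_contra! h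
  refine hc ((traceForm_nondegenerate K F).1 c fun ν => ?_)
  rw [Algebra.traceForm_apply, mul_comm]
  exact h ν

/-- If the distinct nodes `α y`, `y ∈ S`, carry non-zero functionals, then the seeds `β` for which
the combined functional of the generator vanishes are roots of a non-zero polynomial of
degree `< p'`. -/
lemma exists_polynomial_of_functionals {K F ι : Type*} [Field K] [Field F] [Algebra K F]
    [FiniteDimensional K F] [Algebra.IsSeparable K F] (α : ι → F) (hα : Function.Injective α)
    (L : ι → F →ₗ[K] K) (S : Finset ι) (hS : ∀ y ∈ S, L y ≠ 0) (hne : S.Nonempty) {p' : ℕ}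
    (hp : S.card ≤ p') :
    ∃ q : F[X], q ≠ 0 ∧ q.natDegree < p' ∧
      ∀ β, (∀ ν, ∑ y ∈ S, L y (mekaGenerator p' (α y) β ν) = 0) → q.IsRoot β := by
  classical
  choose c hc using fun y => exists_trace_repr (L y)
  have hc0 : ∀ y ∈ S, c y ≠ 0 := by
    intro y hy h
    refine hS y hy (LinearMap.ext fun z => ?_)
    rw [hc, h, zero_mul, map_zero, LinearMap.zero_apply]
  have hp0 : 0 < p' := hne.card_pos.trans_le hp
  -- With `c y` representing `L y`, exchanging the sums over `y` and `j` turns the combined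
  -- functional into the trace of `ν` times this polynomial at `β`.
  have hcoeff : ∀ j < p', (∑ j ∈ Finset.range p', C (∑ y ∈ S, c y * α y ^ j) * X ^ j).coeff j
      = ∑ y ∈ S, c y * α y ^ j := by
    intro j hj
    rw [finsetSum_coeff]
    simp only [coeff_C_mul, coeff_X_pow, mul_ite, mul_one, mul_zero, Finset.sum_ite_eq,
      Finset.mem_range, hj, if_true]
  refine ⟨∑ j ∈ Finset.range p', C (∑ y ∈ S, c y * α y ^ j) * X ^ j, ?_, ?_, ?_⟩
  · intro h0
    have hz : ∀ j < p', ∑ y ∈ S, c y * α y ^ j = 0 := by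
      intro j hj
      rw [← hcoeff j hj, h0, coeff_zero]
    -- If all coefficients vanish, the weights `c y` at the nodes `α y` annihilate the monomials of
    -- degree below `p'`, hence all polynomials of such degree.
    have hR : ∀ R : F[X], R.natDegree < p' → ∑ y ∈ S, c y * R.eval (α y) = 0 := by
      intro R hR
      simp_rw [eval_eq_sum_range' hR, Finset.mul_sum]
      rw [Finset.sum_comm]
      refine Finset.sum_eq_zero fun j hj => ?_
      have := hz j (Finset.mem_range.1 hj)
      calc ∑ y ∈ S, c y * (R.coeff j * α y ^ j) = R.coeff j * ∑ y ∈ S, c y * α y ^ j := by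
            rw [Finset.mul_sum]; exact Finset.sum_congr rfl fun _ _ => by ring
        _ = 0 := by rw [this, mul_zero]
    obtain ⟨y₀, hy₀⟩ := hne
    -- Vanishing at all nodes but that of `y₀`, this polynomial has degree `S.card - 1 < p'` and
    -- isolates `c y₀`.
    have h1 := hR (∏ y ∈ S.erase y₀, (X - C (α y))) (by
      rw [natDegree_prod_of_monic _ _ fun y _ => monic_X_sub_C _]
      simp only [natDegree_X_sub_C, Finset.sum_const, smul_eq_mul, mul_one]
      have := Finset.card_erase_lt_of_mem hy₀
      omega)
    rw [Finset.sum_eq_single y₀] at h1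
    · rw [eval_prod] at h1
      refine (mul_ne_zero (hc0 y₀ hy₀) (Finset.prod_ne_zero_iff.2 fun y hy => ?_)) h1
      rw [eval_sub, eval_X, eval_C, sub_ne_zero]
      exact fun h => (Finset.ne_of_mem_erase hy) (hα h).symm
    · intro y hy hne
      rw [eval_prod, Finset.prod_eq_zero (Finset.mem_erase.2 ⟨hne, hy⟩) (by simp), mul_zero]
    · exact fun h => absurd hy₀ h
  · refine lt_of_le_of_lt (natDegree_sum_le_of_forall_le (n := p' - 1) _ _ fun j hj => ?_)
      (by omega)
    refine (natDegree_C_mul_X_pow_le _ _).trans ?_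
    have := Finset.mem_range.1 hj
    omega
  · intro β hβ
    by_contra h
    obtain ⟨ν, hν⟩ := exists_trace_ne_zero K h
    refine hν ?_
    rw [← hβ ν]
    simp_rw [hc, ← map_sum]
    congr 1
    simp only [eval_finsetSum, eval_mul, eval_C, eval_pow, eval_X, Finset.sum_mul, Finset.mul_sum,
      mekaGenerator, mul_pow]
    rw [Finset.sum_comm]
    refine Finset.sum_congr rfl fun y _ => Finset.sum_congr rfl fun j _ => by ring

/-- A string of even length is the pair of its halves. -/
def halvesEquiv {n₁ : ℕ} (h : Even n₁) : Bits n₁ ≃ Bits (n₁ / 2) × Bits (n₁ / 2) where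
  toFun x := (firstHalf x, secondHalf x)
  invFun b i := if hi : (i : ℕ) < n₁ / 2 then b.1 ⟨i, hi⟩ else
    b.2 ⟨i - n₁ / 2, by obtain ⟨k, hk⟩ := h; omega⟩
  left_inv x := by
    ext i
    simp only [firstHalf, secondHalf]
    split_ifs with hi
    · rfl
    · congr 1
      ext
      simp only
      omega
  right_inv b := by
    ext i
    · simp [firstHalf]
    · simp [secondHalf]

lemma firstHalf_halvesEquiv_symm {n₁ : ℕ} (h : Even n₁) (b : Bits (n₁ / 2) × Bits (n₁ / 2)) :
    firstHalf ((halvesEquiv h).symm b) = b.1 :=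
  congrArg Prod.fst ((halvesEquiv h).apply_symm_apply b)

lemma secondHalf_halvesEquiv_symm {n₁ : ℕ} (h : Even n₁) (b : Bits (n₁ / 2) × Bits (n₁ / 2)) :
    secondHalf ((halvesEquiv h).symm b) = b.2 :=
  congrArg Prod.snd ((halvesEquiv h).apply_symm_apply b)

/-- The linear test of a block: the sum of the coefficients at the positions in `S`. -/
noncomputable def coeffSum {P : (ZMod 2)[X]} (hP : P.Monic) {t : ℕ} (S : Finset (Fin t)) :
    AdjoinRoot P →ₗ[ZMod 2] ZMod 2 :=
  ∑ i ∈ S, (lcoeff (ZMod 2) (i : ℕ)) ∘ₗ (AdjoinRoot.modByMonicHom hP)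

lemma coeffSum_apply {P : (ZMod 2)[X]} (hP : P.Monic) {t : ℕ} (S : Finset (Fin t))
    (z : AdjoinRoot P) : coeffSum hP S z = ∑ i ∈ S, toBits hP t z i := by
  simp [coeffSum, toBits, LinearMap.sum_apply]

lemma coeffSum_ne_zero {P : (ZMod 2)[X]} (hP : P.Monic) {t : ℕ} (ht : t ≤ P.natDegree)
    {S : Finset (Fin t)} (hS : S.Nonempty) : coeffSum hP S ≠ 0 := by
  classical
  obtain ⟨i, hi⟩ := hS
  intro h
  have := congrArg (fun L => L (ofBits P (Pi.single i 1 : Bits t))) h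
  simp only [LinearMap.zero_apply, coeffSum_apply, toBits_ofBits hP ht] at this
  rw [Finset.sum_eq_single i] at this
  · simp at this
  · intro j _ hj
    simp [hj]
  · exact fun h => absurd hi h

/-- The bias of a linear test that meets at most `p'` blocks. -/
lemma abs_sum_bitSign_bitGenerator_le {P : (ZMod 2)[X]} (hP : P.Monic) (hirr : Irreducible P)
    {n₁ n₂ : ℕ} (heven : Even n₁) (hdeg : P.natDegree = n₁ / 2) (a : Bits n₂ → AdjoinRoot P)
    (ha : Function.Injective a) {p' : ℕ} (τ : Finset (Bits n₂ × Fin (n₁ / 2))) (hτ : τ.Nonempty)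
    (hcard : (τ.image Prod.fst).card ≤ p') :
    |∑ x : Bits n₁, bitSign (∑ j ∈ τ, bitGenerator hP a p' x j)|
      ≤ p' * (2 : ℝ) ^ (n₁ / 2) := by
  classical
  have : Fact (Irreducible P) := ⟨hirr⟩
  have : FiniteDimensional (ZMod 2) (AdjoinRoot P) := (AdjoinRoot.powerBasis hP.ne_zero).finite
  -- Each block that is met contains a tested position, so its functional is not zero.
  have hfib : ∀ y ∈ τ.image Prod.fst, (Finset.univ.filter fun i => (y, i) ∈ τ).Nonempty := by
    intro y hy
    obtain ⟨j, hj, rfl⟩ := Finset.mem_image.1 hy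
    exact ⟨j.2, by simpa using hj⟩
  obtain ⟨q, hq0, hqd, hq⟩ := exists_polynomial_of_functionals (K := ZMod 2) a ha
    (fun y => coeffSum hP (Finset.univ.filter fun i : Fin (n₁ / 2) => (y, i) ∈ τ)) (τ.image Prod.fst)
    (fun y hy => coeffSum_ne_zero hP hdeg.ge (hfib y hy)) (hτ.image _) hcard
  have hsum : ∀ x : Bits n₁, ∑ j ∈ τ, bitGenerator hP a p' x j
      = ∑ y ∈ τ.image Prod.fst, coeffSum hP (Finset.univ.filter fun i : Fin (n₁ / 2) => (y, i) ∈ τ)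
        (mekaGenerator p' (a y) (ofBits P (firstHalf x)) (ofBits P (secondHalf x))) := by
    intro x
    simp_rw [coeffSum_apply]
    rw [← Finset.sum_fiberwise_of_maps_to (g := Prod.fst) (t := τ.image Prod.fst)
      fun j hj => Finset.mem_image_of_mem _ hj]
    refine Finset.sum_congr rfl fun y _ => ?_
    refine Finset.sum_bij' (fun j _ => j.2) (fun i _ => (y, i)) ?_ ?_ ?_ ?_ ?_
    · rintro ⟨y', i⟩ hj
      simp only [Finset.mem_filter] at hj
      obtain ⟨hj, rfl⟩ := hj
      simpa using hj
    · intro i hi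
      simpa using hi
    · rintro ⟨y', i⟩ hj
      simp only [Finset.mem_filter] at hj
      obtain ⟨hj, rfl⟩ := hj
      rfl
    · intro i _
      rfl
    · rintro ⟨y', i⟩ hj
      simp only [Finset.mem_filter] at hj
      obtain ⟨hj, rfl⟩ := hj
      rfl
  set G : Bits (n₁ / 2) → Bits (n₁ / 2) → ZMod 2 := fun b c => ∑ y ∈ τ.image Prod.fst,
    coeffSum hP (Finset.univ.filter fun i : Fin (n₁ / 2) => (y, i) ∈ τ)
        (mekaGenerator p' (a y) (ofBits P b) (ofBits P c)) with hG
  have hsplit : ∑ x : Bits n₁, bitSign (∑ j ∈ τ, bitGenerator hP a p' x j)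
      = ∑ b, ∑ c, bitSign (G b c) := by
    rw [← Fintype.sum_prod_type' (f := fun b c => bitSign (G b c)),
      ← Equiv.sum_comp (halvesEquiv heven).symm]
    refine Finset.sum_congr rfl fun b _ => ?_
    rw [hsum, firstHalf_halvesEquiv_symm, secondHalf_halvesEquiv_symm]
  have hadd : ∀ b c d, G b (c + d) = G b c + G b d := by
    intro b c d
    simp only [hG, ← Finset.sum_add_distrib, mekaGenerator, ofBits_add, add_mul, map_add]
  -- If `β` is not a root, the test is an additive function of `ν` that is not identically zero, and
  -- its signs cancel.
  have hzero : ∀ b, ¬ q.IsRoot (ofBits P b) → ∑ c, bitSign (G b c) = 0 := by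
    intro b hb
    by_contra hne
    refine hb (hq _ fun ν => ?_)
    by_contra hν
    refine hne (sum_bitSign_eq_zero (G b) (hadd b) (a := toBits hP (n₁ / 2) ν) ?_)
    have : ofBits P (toBits hP (n₁ / 2) ν) = ν := by
      have := ofBits_toBits hP ν
      rwa [hdeg] at this
    simp only [hG, this]
    exact hν
  have hle : ∀ b, |∑ c, bitSign (G b c)| ≤ 2 ^ (n₁ / 2) := by
    intro b
    refine (Finset.abs_sum_le_sum_abs _ _).trans ?_
    simp [abs_bitSign]
  rw [hsplit]
  -- The remaining `β` are roots of `q`, whose degree is below `p'`; for them the trivial bound `2 ^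
  -- (n₁ / 2)` on the inner sum is enough.
  have hcount : (Finset.univ.filter fun b : Bits (n₁ / 2) => q.IsRoot (ofBits P b)).card ≤ p' := by
    have h1 : (Finset.univ.filter fun b : Bits (n₁ / 2) => q.IsRoot (ofBits P b)).card
        ≤ q.roots.toFinset.card := by
      refine Finset.card_le_card_of_injOn (ofBits P) ?_ (ofBits_injective hP hdeg.ge).injOn
      intro b hb
      simpa [hq0] using hb
    have h2 := q.roots.toFinset_card_le
    have h3 := q.card_roots'
    omega
  calc |∑ b, ∑ c, bitSign (G b c)| ≤ ∑ b, |∑ c, bitSign (G b c)| :=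
        Finset.abs_sum_le_sum_abs _ _
    _ = ∑ b ∈ Finset.univ.filter fun b : Bits (n₁ / 2) => q.IsRoot (ofBits P b),
          |∑ c, bitSign (G b c)| := by
        refine (Finset.sum_subset (Finset.subset_univ _) fun b _ hb => ?_).symm
        rw [hzero b (by simpa using hb), abs_zero]
    _ ≤ ∑ b ∈ Finset.univ.filter fun b : Bits (n₁ / 2) => q.IsRoot (ofBits P b), 2 ^ (n₁ / 2) :=
        Finset.sum_le_sum fun b _ => hle b
    _ ≤ p' * (2 : ℝ) ^ (n₁ / 2) := by
        rw [Finset.sum_const, nsmul_eq_mul]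
        gcongr

lemma isBiasedGenerator_bitGenerator {P : (ZMod 2)[X]} (hP : P.Monic) (hirr : Irreducible P)
    {n₁ n₂ : ℕ} (heven : Even n₁) (hdeg : P.natDegree = n₁ / 2) (a : Bits n₂ → AdjoinRoot P)
    (ha : Function.Injective a) {p' : ℕ} (hp0 : 0 < p') (hp : p' ≤ 2 ^ n₂ * (n₁ / 2)) {ζ : ℝ}
    (hζ : p' ≤ ζ * (2 : ℝ) ^ (n₁ / 2)) :
    IsBiasedGenerator p' ζ
      (bitGenerator hP a p' : Bits n₁ → Bits n₂ × Fin (n₁ / 2) → ZMod 2) := by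
  have hζ0 : 0 ≤ ζ := by
    by_contra h
    have : ζ * (2 : ℝ) ^ (n₁ / 2) < 0 := mul_neg_of_neg_of_pos (not_le.1 h) (by positivity)
    have : (0 : ℝ) ≤ p' := Nat.cast_nonneg _
    linarith
  refine ⟨hp0, by simpa using hp, hζ0, fun τ hτ hcard => ?_⟩
  rw [PMF.map_comp, two_mul_statDist_map_uniform]
  have hc : (Fintype.card (Bits n₁) : ℝ) = 2 ^ (n₁ / 2) * 2 ^ (n₁ / 2) := by
    obtain ⟨k, rfl⟩ := heven
    have : (k + k) / 2 = k := by omega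
    simp [this, pow_add]
  rw [div_le_iff₀ (by rw [hc]; positivity), hc]
  -- A test of at most `p'` positions meets at most `p'` blocks.
  refine (abs_sum_bitSign_bitGenerator_le hP hirr heven hdeg a ha τ hτ
    (Finset.card_image_le.trans hcard)).trans ?_
  rw [← mul_assoc]
  gcongr

end SmallBias

/-! ### Moments of signed sums under small bias -/

section Moment

open Finset

variable {Y : Type*}

/-- A tuple in which every value appears an even number of times is constant on the classes of an
idempotent map with at most half as many fixed points as there are positions. -/
lemma exists_idempotent_of_even_fibers {p : ℕ} [DecidableEq Y] (hp : 0 < p) (y : Fin p → Y)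
    (hy : ∀ v, Even (univ.filter fun i => y i = v).card) :
    ∃ f : Fin p → Fin p, (∀ i, f (f i) = f i) ∧ (∀ i, y (f i) = y i) ∧
      2 * (univ.filter fun i => f i = i).card ≤ p := by
  have : Nonempty (Fin p) := ⟨⟨0, hp⟩⟩
  have h1 : ∀ i, y (Function.invFun y (y i)) = y i := fun i => Function.invFun_eq ⟨i, rfl⟩
  -- Every position is sent to a chosen representative of its fibre. The fixed points correspond to
  -- the values of `y`, each of which is taken at least twice.
  refine ⟨fun i => Function.invFun y (y i), fun i => by simp only [h1], h1, ?_⟩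
  have h2 : (univ.filter fun i => Function.invFun y (y i) = i).card ≤ (univ.image y).card := by
    refine card_le_card_of_injOn y (fun i _ => by simp) ?_
    intro i hi j hj hij
    simp only [coe_filter, mem_univ, true_and, Set.mem_ofPred_eq] at hi hj
    rw [← hi, ← hj, hij]
  have h3 : p = ∑ v ∈ univ.image y, (univ.filter fun i => y i = v).card := by
    conv_lhs => rw [← Fintype.card_fin p, ← card_univ]
    exact card_eq_sum_card_fiberwise fun i _ => by simp
  have h4 : ∑ v ∈ univ.image y, 2 ≤ ∑ v ∈ univ.image y, (univ.filter fun i => y i = v).card := by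
    refine sum_le_sum fun v hv => ?_
    obtain ⟨i, -, rfl⟩ := mem_image.1 hv
    have h5 : 0 < (univ.filter fun j => y j = y i).card := card_pos.2 ⟨i, by simp⟩
    obtain ⟨k, hk⟩ := hy (y i)
    omega
  rw [sum_const, smul_eq_mul] at h4
  change 2 * (univ.filter fun i => Function.invFun y (y i) = i).card ≤ p
  omega

variable [Fintype Y] [DecidableEq Y]

/-- The weight of the tuples that are constant on the classes of an idempotent map. -/
lemma sum_prod_comp_idempotent_le {h : ℕ} (f : Fin (2 * h) → Fin (2 * h))
    (hf : ∀ i, f (f i) = f i) (hfix : 2 * (univ.filter fun i => f i = i).card ≤ 2 * h)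
    (q : Y → ℝ) (hq0 : ∀ v, 0 ≤ q v) (hq1 : ∑ v, q v = 1) {K : ℝ} (hK : ∀ v, q v ≤ K)
    (hK1 : K ≤ 1) (hK0 : 0 ≤ K) :
    ∑ y ∈ univ.filter fun y : Fin (2 * h) → Y => ∀ i, y (f i) = y i, ∏ i, q (y i) ≤ K ^ h := by
  -- A tuple constant on the classes is determined by its entries on the fixed points `A`. Each of
  -- the other positions, at least `h` in number, contributes a factor at most `K`.
  set A := univ.filter fun i => f i = i with hA
  have hcompl : h ≤ Aᶜ.card := by
    rw [card_compl, Fintype.card_fin]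
    omega
  have hprod : ∀ y : Fin (2 * h) → Y, ∏ i, q (y i) ≤ (∏ i : A, q (y i)) * K ^ h := by
    intro y
    rw [← prod_mul_prod_compl A, prod_coe_sort A fun i => q (y i)]
    refine mul_le_mul_of_nonneg_left ?_ (prod_nonneg fun i _ => hq0 _)
    calc ∏ i ∈ Aᶜ, q (y i) ≤ ∏ i ∈ Aᶜ, K := prod_le_prod (fun i _ => hq0 _) fun i _ => hK _
      _ = K ^ Aᶜ.card := by rw [prod_const]
      _ ≤ K ^ h := pow_le_pow_of_le_one hK0 hK1 hcompl
  refine (sum_le_sum fun y _ => hprod y).trans ?_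
  rw [← sum_mul]
  refine mul_le_of_le_one_left (by positivity) ?_
  -- Restriction to `A` loses nothing, so the sum is at most the sum over all functions on `A`,
  -- which factors as a power of `∑ v, q v = 1`.
  have hinj : Set.InjOn (fun (y : Fin (2 * h) → Y) (i : A) => y i)
      (univ.filter fun y : Fin (2 * h) → Y => ∀ i, y (f i) = y i) := by
    intro y hy y' hy' e
    simp only [coe_filter, mem_univ, true_and, Set.mem_ofPred_eq] at hy hy'
    ext i
    rw [← hy i, ← hy' i]
    exact congrFun e ⟨f i, by simp [hA, hf]⟩
  rw [← sum_image (g := fun (y : Fin (2 * h) → Y) (i : A) => y i)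
    (f := fun z : A → Y => ∏ i, q (z i)) hinj]
  refine (sum_le_sum_of_subset_of_nonneg (subset_univ _) fun z _ _ =>
    prod_nonneg fun i _ => hq0 _).trans ?_
  have := Fintype.prod_sum fun (_ : A) (v : Y) => q v
  rw [← this, hq1]
  simp

/-- Equal entries are grouped and their signs cancel in pairs; what is left is a linear test on the
values of odd multiplicity. -/
lemma prod_comp_eq_prod_odd {p : ℕ} (y : Fin p → Y) (s : Y → ℝ) (hs : ∀ v, s v * s v = 1) :
    ∏ i, s (y i) = ∏ v ∈ univ.filter fun v => ¬ Even (univ.filter fun i => y i = v).card, s v := by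
  have hpow : ∀ v n, s v ^ n = if Even n then 1 else s v := by
    intro v n
    split_ifs with h
    · obtain ⟨k, rfl⟩ := h
      rw [pow_add, ← mul_pow, hs, one_pow]
    · obtain ⟨k, rfl⟩ := Nat.not_even_iff_odd.1 h
      rw [pow_succ, pow_mul, pow_two, hs, one_pow, one_mul]
  rw [← prod_fiberwise univ y, prod_filter]
  refine prod_congr rfl fun v _ => ?_
  rw [prod_congr rfl (g := fun _ => s v) fun i hi => by rw [(mem_filter.1 hi).2], prod_const, hpow]
  split_ifs <;> simp_all

/-- Moments of a random signed sum whose sign vectors have small bias. -/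
theorem sum_pow_signed_sum_le {X : Type*} [Fintype X] (s : X → Y → ℝ)
    (hs : ∀ x v, s x v * s x v = 1) (q : Y → ℝ) (hq0 : ∀ v, 0 ≤ q v) (hq1 : ∑ v, q v = 1) {K : ℝ}
    (hK : ∀ v, q v ≤ K) (hK1 : K ≤ 1) (hK0 : 0 ≤ K) {h : ℕ} (hh : 0 < h) {B : ℝ} (hB0 : 0 ≤ B)
    (hB : ∀ S : Finset Y, S.Nonempty → S.card ≤ 2 * h → |∑ x, ∏ v ∈ S, s x v| ≤ B) :
    ∑ x, (∑ v, q v * s x v) ^ (2 * h)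
      ≤ B + Fintype.card X * (((2 * h : ℕ) : ℝ) ^ (2 * h) * K ^ h) := by
  set E : Finset (Fin (2 * h) → Y) :=
    univ.filter fun y => ∀ v, Even (univ.filter fun i => y i = v).card with hE
  have hexp : ∑ x, (∑ v, q v * s x v) ^ (2 * h)
      = ∑ y : Fin (2 * h) → Y, (∏ i, q (y i)) * ∑ x, ∏ i, s x (y i) := by
    simp_rw [Fintype.sum_pow, prod_mul_distrib, mul_sum]
    rw [sum_comm]
  -- For a tuple in `E` the signs cancel completely and the sum is the number of `x`. For any other
  -- tuple the values of odd multiplicity form a non-empty set of at most `2 * h` elements, to which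
  -- `hB` applies.
  have hterm : ∀ y : Fin (2 * h) → Y, ∑ x, ∏ i, s x (y i)
      ≤ B + if y ∈ E then (Fintype.card X : ℝ) else 0 := by
    intro y
    simp_rw [prod_comp_eq_prod_odd y (s _) (hs _)]
    split_ifs with hy
    · have h0 : (univ.filter fun v => ¬ Even (univ.filter fun i => y i = v).card) = ∅ := by
        rw [filter_eq_empty_iff]
        intro v _
        rw [not_not]
        exact (mem_filter.1 hy).2 v
      rw [h0]
      simp [hB0]
    · rw [add_zero]
      refine (le_abs_self _).trans (hB _ ?_ ?_)
      · by_contra h0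
        rw [not_nonempty_iff_eq_empty, filter_eq_empty_iff] at h0
        exact hy (mem_filter.2 ⟨mem_univ _, fun v => not_not.1 (h0 (mem_univ v))⟩)
      · calc _ ≤ (univ.image y).card := by
              refine card_le_card fun v hv => ?_
              have := (mem_filter.1 hv).2
              obtain ⟨i, hi⟩ : (univ.filter fun i => y i = v).Nonempty := by
                by_contra h0
                rw [not_nonempty_iff_eq_empty] at h0
                simp [h0] at this
              exact mem_image.2 ⟨i, mem_univ _, (mem_filter.1 hi).2⟩
          _ ≤ 2 * h := card_image_le.trans (by simp)
  have hq : ∑ y : Fin (2 * h) → Y, ∏ i, q (y i) = 1 := by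
    rw [← Fintype.sum_pow, hq1, one_pow]
  -- A union bound over the idempotent maps, of which there are at most `(2 * h) ^ (2 * h)`.
  have hEsum : ∑ y ∈ E, ∏ i, q (y i) ≤ ((2 * h : ℕ) : ℝ) ^ (2 * h) * K ^ h := by
    set I : Finset (Fin (2 * h) → Fin (2 * h)) := univ.filter fun f =>
      (∀ i, f (f i) = f i) ∧ 2 * (univ.filter fun i => f i = i).card ≤ 2 * h
    have hsub : E ⊆ I.biUnion fun f => univ.filter fun y : Fin (2 * h) → Y => ∀ i, y (f i) = y i := by
      intro y hy
      obtain ⟨f, h1, h2, h3⟩ := exists_idempotent_of_even_fibers (by omega) y (mem_filter.1 hy).2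
      exact mem_biUnion.2 ⟨f, mem_filter.2 ⟨mem_univ _, h1, h3⟩, mem_filter.2 ⟨mem_univ _, h2⟩⟩
    have hnn : ∀ y : Fin (2 * h) → Y, 0 ≤ ∏ i, q (y i) := fun y => prod_nonneg fun i _ => hq0 _
    calc ∑ y ∈ E, ∏ i, q (y i) ≤ ∑ y ∈ I.biUnion fun f =>
            univ.filter fun y : Fin (2 * h) → Y => ∀ i, y (f i) = y i, ∏ i, q (y i) :=
          sum_le_sum_of_subset_of_nonneg hsub fun y _ _ => hnn y
      _ ≤ ∑ f ∈ I, ∑ y ∈ univ.filter fun y : Fin (2 * h) → Y => ∀ i, y (f i) = y i,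
            ∏ i, q (y i) := by
          clear_value I
          clear hsub
          induction I using Finset.induction_on with
          | empty => simp
          | insert f I hf ih =>
            rw [sum_insert hf, biUnion_insert]
            refine le_trans ?_ (add_le_add_right ih _)
            rw [← sum_union_inter]
            exact le_add_of_nonneg_right (sum_nonneg fun y _ => hnn y)
      _ ≤ ∑ f ∈ I, K ^ h := sum_le_sum fun f hf =>
          sum_prod_comp_idempotent_le f (mem_filter.1 hf).2.1 (mem_filter.1 hf).2.2 q hq0 hq1 hK
            hK1 hK0
      _ ≤ ((2 * h : ℕ) : ℝ) ^ (2 * h) * K ^ h := by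
          rw [sum_const, nsmul_eq_mul]
          refine mul_le_mul_of_nonneg_right ?_ (by positivity)
          have : I.card ≤ (2 * h) ^ (2 * h) := (card_le_univ _).trans (by simp)
          exact_mod_cast this
  rw [hexp]
  calc ∑ y : Fin (2 * h) → Y, (∏ i, q (y i)) * ∑ x, ∏ i, s x (y i)
      ≤ ∑ y : Fin (2 * h) → Y, (∏ i, q (y i)) * (B + if y ∈ E then (Fintype.card X : ℝ) else 0) :=
        sum_le_sum fun y _ => mul_le_mul_of_nonneg_left (hterm y) (prod_nonneg fun i _ => hq0 _)
    _ = B + Fintype.card X * ∑ y ∈ E, ∏ i, q (y i) := by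
        simp_rw [mul_add, sum_add_distrib, ← sum_mul, hq, one_mul, mul_ite, mul_zero]
        rw [← sum_filter, mul_comm (Fintype.card X : ℝ), sum_mul, filter_mem_eq_inter, univ_inter]
    _ ≤ _ := by gcongr

/-- If a weighted moment of even order is at most that power of `γ`, then the second moment is at
most `γ ^ 2`. -/
lemma sum_mul_sq_le_of_sum_mul_pow_le {X : Type*} [Fintype X] (f A : X → ℝ) (hf0 : ∀ x, 0 ≤ f x)
    (hf1 : ∑ x, f x = 1) {h : ℕ} (hh : 0 < h) {γ : ℝ} (hγ : ∑ x, f x * A x ^ (2 * h) ≤ γ ^ (2 * h)) :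
    ∑ x, f x * A x ^ 2 ≤ γ ^ 2 := by
  have h1 := Real.pow_arith_mean_le_arith_mean_pow univ f (fun x => A x ^ 2) (fun x _ => hf0 x) hf1
    (fun x _ => sq_nonneg _) h
  simp_rw [← pow_mul] at h1
  have h2 := h1.trans hγ
  rw [pow_mul] at h2
  exact (pow_le_pow_iff_left₀ (sum_nonneg fun x _ => mul_nonneg (hf0 x) (sq_nonneg _))
    (sq_nonneg _) hh.ne').1 h2

lemma sum_mul_le_of_sum_mul_sq_le {X : Type*} [Fintype X] (f A : X → ℝ) (hf0 : ∀ x, 0 ≤ f x)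
    (hf1 : ∑ x, f x = 1) {γ : ℝ} (hγ0 : 0 ≤ γ) (hγ : ∑ x, f x * A x ^ 2 ≤ γ ^ 2) :
    ∑ x, f x * |A x| ≤ γ := by
  have h1 := Real.pow_arith_mean_le_arith_mean_pow univ f (fun x => |A x|) (fun x _ => hf0 x) hf1
    (fun x _ => abs_nonneg _) 2
  simp_rw [sq_abs] at h1
  exact (pow_le_pow_iff_left₀ (sum_nonneg fun x _ => mul_nonneg (hf0 x) (abs_nonneg _))
    hγ0 two_ne_zero).1 (h1.trans hγ)

end Moment

/-! ### The XOR lemma -/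

section Xor

open Finset

variable {m : ℕ}

/-- The sign of a linear test. -/
noncomputable def walsh (τ : Finset (Fin m)) (z : Bits m) : ℝ := ∏ i ∈ τ, bitSign (z i)

lemma walsh_eq_bitSign (τ : Finset (Fin m)) (z : Bits m) :
    walsh τ z = bitSign (∑ i ∈ τ, z i) := (bitSign_sum _ _).symm

lemma sum_walsh {τ : Finset (Fin m)} (hτ : τ.Nonempty) : ∑ z, walsh τ z = 0 := by
  obtain ⟨i, hi⟩ := hτ
  simp_rw [walsh_eq_bitSign]
  refine sum_bitSign_eq_zero (fun z : Bits m => ∑ i ∈ τ, z i)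
    (fun a b => by simp [sum_add_distrib]) (a := Pi.single i 1) ?_
  rw [sum_eq_single i]
  · simp
  · intro j _ hj
    simp [hj]
  · exact fun h => absurd hi h

/-- The sum over all tests factors into terms `1 + bitSign (z i) * bitSign (z' i)`, and one of them
is zero as soon as `z` and `z'` differ. -/
lemma sum_walsh_mul_walsh (z z' : Bits m) :
    ∑ τ, walsh τ z * walsh τ z' = if z = z' then 2 ^ m else 0 := by
  simp_rw [walsh, ← prod_mul_distrib]
  rw [← powerset_univ, ← prod_one_add]
  split_ifs with h
  · subst h
    simp_rw [bitSign_mul_self]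
    norm_num
  · obtain ⟨i, hi⟩ := Function.ne_iff.1 h
    refine prod_eq_zero (mem_univ i) ?_
    rcases ZMod.two_eq_zero_or_one (z i) with h1 | h1 <;>
      rcases ZMod.two_eq_zero_or_one (z' i) with h2 | h2 <;> simp_all

/-- Parseval's identity, from the orthogonality above. -/
lemma sum_sq_walsh_transform (g : Bits m → ℝ) :
    ∑ τ, (∑ z, g z * walsh τ z) ^ 2 = 2 ^ m * ∑ z, g z ^ 2 := by
  have : ∀ τ, (∑ z, g z * walsh τ z) ^ 2
      = ∑ z, ∑ z', g z * g z' * (walsh τ z * walsh τ z') := by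
    intro τ
    rw [sq, sum_mul_sum]
    exact sum_congr rfl fun z _ => sum_congr rfl fun z' _ => by ring
  simp_rw [this]
  rw [sum_comm]
  simp_rw [sum_comm (s := univ (α := Finset (Fin m))), ← mul_sum, sum_walsh_mul_walsh]
  simp only [mul_ite, mul_zero, sum_ite_eq, mem_univ, if_true, mul_sum]
  exact sum_congr rfl fun z _ => by ring

/-- The XOR lemma: the distance from uniform is bounded by the biases of the linear tests. -/
theorem sq_sum_abs_sub_uniform_le (D : Bits m → ℝ) (hD : ∑ z, D z = 1) :
    (∑ z, |D z - (2 ^ m)⁻¹|) ^ 2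
      ≤ ∑ τ ∈ univ.filter Finset.Nonempty, (∑ z, D z * walsh τ z) ^ 2 := by
  have h1 := sq_sum_le_card_mul_sum_sq (s := univ) (f := fun z => |D z - (2 ^ m)⁻¹|)
  simp_rw [sq_abs] at h1
  have hc : ((univ : Finset (Bits m)).card : ℝ) = 2 ^ m := by simp
  rw [hc, ← sum_sq_walsh_transform fun z => D z - (2 ^ m)⁻¹] at h1
  refine h1.trans ?_
  rw [sum_filter]
  refine sum_le_sum fun τ _ => ?_
  simp_rw [sub_mul, sum_sub_distrib]
  -- A non-empty test does not see the uniform distribution, and the empty test only sees the total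
  -- mass, which is the same on both sides.
  split_ifs with h
  · rw [← mul_sum, sum_walsh h, mul_zero, sub_zero]
  · rw [not_nonempty_iff_eq_empty] at h
    subst h
    simp [walsh, hD]

lemma sum_abs_sub_uniform_le_of_forall (D : Bits m → ℝ) (hD : ∑ z, D z = 1) {γ : ℝ} (hγ0 : 0 ≤ γ)
    (hγ : ∀ τ : Finset (Fin m), τ.Nonempty → |∑ z, D z * walsh τ z| ≤ γ) :
    ∑ z, |D z - (2 ^ m)⁻¹| ≤ Real.sqrt (2 ^ m) * γ := by
  rw [← Real.sqrt_sq hγ0, ← Real.sqrt_mul (by positivity)]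
  refine Real.le_sqrt_of_sq_le ((sq_sum_abs_sub_uniform_le D hD).trans ?_)
  calc _ ≤ ∑ τ ∈ univ.filter Finset.Nonempty, γ ^ 2 := sum_le_sum fun τ hτ =>
        sq_le_sq' (abs_le.1 (hγ τ (mem_filter.1 hτ).2)).1 (abs_le.1 (hγ τ (mem_filter.1 hτ).2)).2
    _ ≤ ∑ τ : Finset (Fin m), γ ^ 2 := sum_le_sum_of_subset_of_nonneg (filter_subset _ _)
        fun _ _ _ => sq_nonneg _
    _ = 2 ^ m * γ ^ 2 := by simp

end Xor

/-! ### From second moments to strong extractors -/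

section Extractor

open Finset

variable {n₁ n₂ m : ℕ}

lemma toReal_le_of_le_minEntropy {α : Type*} [Fintype α] {p : PMF α} {k : ℝ}
    (h : k ≤ minEntropy p) (a : α) : (p a).toReal ≤ (2 : ℝ) ^ (-k) := by
  have hbdd : BddAbove (Set.range fun a => (p a).toReal) := (Set.finite_range _).bddAbove
  refine (le_ciSup hbdd a).trans ?_
  obtain ⟨b, hb⟩ := p.support_nonempty
  have hpos : 0 < ⨆ a, (p a).toReal :=
    (ENNReal.toReal_pos ((p.mem_support_iff b).1 hb) (p.apply_ne_top b)).trans_le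
      (le_ciSup hbdd b)
  rw [← Real.logb_le_iff_le_rpow one_lt_two hpos]
  unfold minEntropy at h
  linarith

lemma statDist_le_one {α : Type*} [Fintype α] (p q : PMF α) : statDist p q ≤ 1 := by
  unfold statDist
  have : ∑ a, |(p a).toReal - (q a).toReal| ≤ ∑ a, ((p a).toReal + (q a).toReal) := by
    refine sum_le_sum fun a _ => (abs_sub _ _).trans ?_
    rw [abs_of_nonneg ENNReal.toReal_nonneg, abs_of_nonneg ENNReal.toReal_nonneg]
  rw [sum_add_distrib, p.sum_toReal, q.sum_toReal] at this
  linarith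

lemma indepJoint_toReal {α β : Type*} [Fintype α] [Fintype β] (p : PMF α) (q : PMF β) (s : α × β) :
    (indepJoint p q s).toReal = (p s.1).toReal * (q s.2).toReal := by
  classical
  obtain ⟨a, b⟩ := s
  unfold indepJoint
  rw [PMF.bind_apply, tsum_fintype, sum_eq_single a, ENNReal.toReal_mul, PMF.map_apply,
    tsum_fintype, sum_eq_single b]
  · simp
  · intro b' _ hb
    simp [hb.symm]
  · simp
  · intro a' _ ha
    rw [PMF.map_apply]
    simp [ha.symm]
  · simp

/-- The second moments of the biases of `Ext x Y` over `x` are at most `γ ^ 2`, for all weights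
bounded by `K₁` and `K₂`. -/
def SecondMomentBound (Ext : Bits n₁ → Bits n₂ → Bits m) (K₁ K₂ γ : ℝ) : Prop :=
  ∀ τ : Finset (Fin m), τ.Nonempty → ∀ (f : Bits n₁ → ℝ) (q : Bits n₂ → ℝ),
    (∀ x, 0 ≤ f x) → (∑ x, f x = 1) → (∀ x, f x ≤ K₁) →
    (∀ y, 0 ≤ q y) → (∑ y, q y = 1) → (∀ y, q y ≤ K₂) →
    ∑ x, f x * (∑ y, q y * walsh τ (Ext x y)) ^ 2 ≤ γ ^ 2

/-- The probability that `g` takes the value `z` under the weights `q`. -/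
noncomputable def weightAt {α : Type*} [Fintype α] (q : α → ℝ) (g : α → Bits m) (z : Bits m) : ℝ :=
  ∑ a, q a * if g a = z then 1 else 0

lemma sum_weightAt_mul {α : Type*} [Fintype α] (q : α → ℝ) (g : α → Bits m) (F : Bits m → ℝ) :
    ∑ z, weightAt q g z * F z = ∑ a, q a * F (g a) := by
  simp_rw [weightAt, sum_mul]
  rw [sum_comm]
  refine sum_congr rfl fun a _ => ?_
  simp

lemma sum_weightAt {α : Type*} [Fintype α] (q : α → ℝ) (g : α → Bits m) (hq : ∑ a, q a = 1) :
    ∑ z, weightAt q g z = 1 := by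
  have := sum_weightAt_mul q g fun _ => 1
  simpa [hq] using this

lemma sqrt_two_pow (m : ℕ) : Real.sqrt (2 ^ m) = (2 : ℝ) ^ ((m : ℝ) / 2) := by
  rw [Real.sqrt_eq_rpow, ← Real.rpow_natCast, ← Real.rpow_mul (by norm_num)]
  congr 1
  ring

/-- The XOR lemma is applied for each `x` separately, and only then are the squared biases averaged
over `x`. The sum over at most `2 ^ m` tests costs a factor `2 ^ m` in the second moment, hence `2 ^
(m / 2)` in the end. -/
lemma SecondMomentBound.sum_first_le {Ext : Bits n₁ → Bits n₂ → Bits m} {K₁ K₂ γ : ℝ}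
    (h : SecondMomentBound Ext K₁ K₂ γ) (hγ : 0 ≤ γ) (f : Bits n₁ → ℝ) (q : Bits n₂ → ℝ)
    (hf0 : ∀ x, 0 ≤ f x) (hf1 : ∑ x, f x = 1) (hf : ∀ x, f x ≤ K₁)
    (hq0 : ∀ y, 0 ≤ q y) (hq1 : ∑ y, q y = 1) (hq : ∀ y, q y ≤ K₂) :
    ∑ x, f x * ∑ z, |weightAt q (Ext x) z - (2 ^ m)⁻¹| ≤ (2 : ℝ) ^ ((m : ℝ) / 2) * γ := by
  have hnn : ∀ x, 0 ≤ ∑ z, |weightAt q (Ext x) z - (2 ^ m)⁻¹| := fun x =>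
    sum_nonneg fun z _ => abs_nonneg _
  have key : ∑ x, f x * (∑ z, |weightAt q (Ext x) z - (2 ^ m)⁻¹|) ^ 2
      ≤ ((2 : ℝ) ^ ((m : ℝ) / 2) * γ) ^ 2 := by
    calc _ ≤ ∑ x, f x * ∑ τ ∈ univ.filter Finset.Nonempty,
            (∑ z, weightAt q (Ext x) z * walsh τ z) ^ 2 := sum_le_sum fun x _ =>
          mul_le_mul_of_nonneg_left
            (sq_sum_abs_sub_uniform_le _ (sum_weightAt q (Ext x) hq1)) (hf0 x)
      _ = ∑ τ ∈ univ.filter Finset.Nonempty,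
            ∑ x, f x * (∑ y, q y * walsh τ (Ext x y)) ^ 2 := by
          simp_rw [mul_sum, sum_weightAt_mul]
          rw [sum_comm]
      _ ≤ ∑ τ ∈ univ.filter (Finset.Nonempty (α := Fin m)), γ ^ 2 := sum_le_sum fun τ hτ =>
          h τ (mem_filter.1 hτ).2 f q hf0 hf1 hf hq0 hq1 hq
      _ ≤ ∑ τ : Finset (Fin m), γ ^ 2 := sum_le_sum_of_subset_of_nonneg (filter_subset _ _)
          fun _ _ _ => sq_nonneg _
      _ = _ := by
          rw [mul_pow, ← sqrt_two_pow, Real.sq_sqrt (by positivity)]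
          simp
  have := sum_mul_le_of_sum_mul_sq_le f _ hf0 hf1 (by positivity) key
  simpa only [abs_of_nonneg (hnn _)] using this

/-- Half-lines of a signed bias carry little weight. -/
lemma sum_filter_le_of_bias {α : Type*} [Fintype α] (q b : α → ℝ) (hq0 : ∀ y, 0 ≤ q y) {γ K δ : ℝ}
    (hK : ∀ y, q y ≤ K * δ) (hδ : 0 < δ) (hbias : ∀ q' : α → ℝ, (∀ y, 0 ≤ q' y) → ∑ y, q' y = 1 →
      (∀ y, q' y ≤ K) → ∑ y, q' y * b y ≤ γ) :
    ∑ y ∈ univ.filter (fun y => γ < b y), q y ≤ δ := by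
  by_contra! hlt
  set Q := ∑ y ∈ univ.filter (fun y => γ < b y), q y with hQ
  have hQ0 : 0 < Q := hδ.trans hlt
  -- The law `q` conditioned on the half-line. If the half-line had weight above `δ`, its
  -- probabilities would be at most `K`, as `hbias` requires.
  set q' : α → ℝ := fun y => if γ < b y then q y / Q else 0 with hq'
  have h0 : ∀ y, 0 ≤ q' y := by
    intro y
    simp only [hq']
    split_ifs
    · exact div_nonneg (hq0 y) hQ0.le
    · exact le_rfl
  have h1 : ∑ y, q' y = 1 := by
    simp only [hq']
    rw [← sum_filter, ← sum_div, ← hQ, div_self hQ0.ne']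
  have hK0 : ∀ y : α, 0 ≤ K := fun y => by
    have := (hq0 y).trans (hK y)
    exact nonneg_of_mul_nonneg_left this hδ
  have h2 := hbias q' h0 h1 (by
    intro y
    simp only [hq']
    split_ifs
    · rw [div_le_iff₀ hQ0]
      exact (hK y).trans (mul_le_mul_of_nonneg_left hlt.le (hK0 y))
    · exact hK0 y)
  have h3 : ∑ y, q' y * (b y - γ) ≤ 0 := by
    simp_rw [mul_sub, sum_sub_distrib, ← sum_mul, h1]
    linarith
  have h4 : ∀ y ∈ univ, 0 ≤ q' y * (b y - γ) := by
    intro y _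
    simp only [hq']
    split_ifs with hy
    · exact mul_nonneg (div_nonneg (hq0 y) hQ0.le) (by linarith)
    · simp
  -- All terms are non-negative and their sum is at most zero, so they vanish; but `b y - γ > 0`
  -- wherever `q'` is positive, which leaves no mass for `q'`.
  have h5 := (sum_eq_zero_iff_of_nonneg h4).1 (le_antisymm h3 (sum_nonneg h4))
  have h6 : ∀ y, q' y = 0 := by
    intro y
    by_cases hy : γ < b y
    · exact (mul_eq_zero.1 (h5 y (mem_univ y))).resolve_right (by linarith)
    · simp [hq', hy]
  simp [h6] at h1

/-- Where all biases are at most `γ` the XOR lemma applies; at any other `y` the `L¹` distance is at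
most 2. For each of at most `2 ^ m` tests the exceptional `y` form two half-lines, each of weight at
most `δ`. -/
lemma SecondMomentBound.sum_second_le {Ext : Bits n₁ → Bits n₂ → Bits m} {K₁ K₂ γ δ : ℝ}
    (h : SecondMomentBound Ext K₁ K₂ γ) (hγ : 0 ≤ γ) (hδ : 0 < δ) (f : Bits n₁ → ℝ)
    (q : Bits n₂ → ℝ) (hf0 : ∀ x, 0 ≤ f x) (hf1 : ∑ x, f x = 1) (hf : ∀ x, f x ≤ K₁)
    (hq0 : ∀ y, 0 ≤ q y) (hq1 : ∑ y, q y = 1) (hq : ∀ y, q y ≤ K₂ * δ) :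
    ∑ y, q y * ∑ z, |weightAt f (fun x => Ext x y) z - (2 ^ m)⁻¹|
      ≤ (2 : ℝ) ^ ((m : ℝ) / 2) * γ + 2 * (2 ^ m * (2 * δ)) := by
  set b : Finset (Fin m) → Bits n₂ → ℝ := fun τ y => ∑ x, f x * walsh τ (Ext x y) with hb
  have hbias : ∀ τ : Finset (Fin m), τ.Nonempty → ∀ q' : Bits n₂ → ℝ, (∀ y, 0 ≤ q' y) →
      ∑ y, q' y = 1 → (∀ y, q' y ≤ K₂) → |∑ y, q' y * b τ y| ≤ γ := by
    intro τ hτ q' h0 h1 h2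
    have := sum_mul_le_of_sum_mul_sq_le f _ hf0 hf1 hγ (h τ hτ f q' hf0 hf1 hf h0 h1 h2)
    refine le_trans ?_ this
    have e : ∑ y, q' y * b τ y = ∑ x, f x * ∑ y, q' y * walsh τ (Ext x y) := by
      simp_rw [hb, mul_sum]
      rw [sum_comm]
      exact sum_congr rfl fun x _ => sum_congr rfl fun y _ => by ring
    rw [e]
    refine (abs_sum_le_sum_abs _ _).trans (sum_le_sum fun x _ => ?_)
    rw [abs_mul, abs_of_nonneg (hf0 x)]
  have hpos : ∀ τ : Finset (Fin m), τ.Nonempty →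
      ∑ y ∈ univ.filter (fun y => γ < b τ y), q y ≤ δ := fun τ hτ =>
    sum_filter_le_of_bias q (b τ) hq0 hq hδ fun q' h0 h1 h2 =>
      (le_abs_self _).trans (hbias τ hτ q' h0 h1 h2)
  have hneg : ∀ τ : Finset (Fin m), τ.Nonempty →
      ∑ y ∈ univ.filter (fun y => γ < -b τ y), q y ≤ δ := fun τ hτ =>
    sum_filter_le_of_bias q (fun y => -b τ y) hq0 hq hδ fun q' h0 h1 h2 => by
      simp only [mul_neg, sum_neg_distrib]
      exact (neg_le_abs _).trans (hbias τ hτ q' h0 h1 h2)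
  -- `bad y` counts the violated one-sided bounds, so it is at least 1 at an exceptional `y` and its
  -- mean is a sum of half-line weights.
  set bad : Bits n₂ → ℝ := fun y => ∑ τ ∈ univ.filter (Finset.Nonempty (α := Fin m)),
    ((if γ < b τ y then 1 else 0) + if γ < -b τ y then 1 else 0) with hbad
  have hbad0 : ∀ y, 0 ≤ bad y := fun y => sum_nonneg fun τ _ => by split_ifs <;> norm_num
  have hdist : ∀ y, ∑ z, |weightAt f (fun x => Ext x y) z - (2 ^ m)⁻¹|
      ≤ (2 : ℝ) ^ ((m : ℝ) / 2) * γ + 2 * bad y := by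
    intro y
    by_cases hy : ∀ τ : Finset (Fin m), τ.Nonempty → |b τ y| ≤ γ
    · have := sum_abs_sub_uniform_le_of_forall (weightAt f fun x => Ext x y)
        (sum_weightAt f _ hf1) hγ fun τ hτ => by
          rw [sum_weightAt_mul]
          exact hy τ hτ
      rw [sqrt_two_pow] at this
      linarith [hbad0 y]
    · push Not at hy
      obtain ⟨τ, hτ, hy⟩ := hy
      have h1 : (1 : ℝ) ≤ bad y := by
        refine le_trans ?_ (single_le_sum (f := fun τ => ((if γ < b τ y then (1 : ℝ) else 0)
          + if γ < -b τ y then 1 else 0)) (fun τ _ => by split_ifs <;> norm_num)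
          (mem_filter.2 ⟨mem_univ τ, hτ⟩))
        rcases lt_abs.1 hy with h | h
        · simp only [h, if_true]
          split_ifs <;> norm_num
        · simp only [h, if_true]
          split_ifs <;> norm_num
      have h2 : ∑ z, |weightAt f (fun x => Ext x y) z - (2 ^ m)⁻¹| ≤ 2 := by
        calc _ ≤ ∑ z, (weightAt f (fun x => Ext x y) z + (2 ^ m)⁻¹) := by
              refine sum_le_sum fun z _ => (abs_sub _ _).trans ?_
              rw [abs_of_nonneg, abs_of_nonneg (by positivity)]
              exact sum_nonneg fun x _ => mul_nonneg (hf0 x) (by split_ifs <;> norm_num)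
          _ = 2 := by
              rw [sum_add_distrib, sum_weightAt f _ hf1]
              simp
              norm_num
      have h3 : 0 ≤ (2 : ℝ) ^ ((m : ℝ) / 2) * γ := by positivity
      linarith
  calc _ ≤ ∑ y, q y * ((2 : ℝ) ^ ((m : ℝ) / 2) * γ + 2 * bad y) :=
        sum_le_sum fun y _ => mul_le_mul_of_nonneg_left (hdist y) (hq0 y)
    _ = (2 : ℝ) ^ ((m : ℝ) / 2) * γ + 2 * ∑ y, q y * bad y := by
        simp_rw [mul_add, sum_add_distrib, ← sum_mul, hq1, one_mul, mul_sum]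
        congr 1
        exact sum_congr rfl fun y _ => by ring
    _ ≤ _ := by
        gcongr
        simp_rw [hbad, mul_sum]
        rw [sum_comm]
        calc _ ≤ ∑ τ ∈ univ.filter (Finset.Nonempty (α := Fin m)), 2 * δ := by
              refine sum_le_sum fun τ hτ => ?_
              have h1 := hpos τ (mem_filter.1 hτ).2
              have h2 := hneg τ (mem_filter.1 hτ).2
              rw [sum_filter] at h1 h2
              simp_rw [mul_add, sum_add_distrib, mul_ite, mul_one, mul_zero]
              linarith
          _ ≤ ∑ τ : Finset (Fin m), 2 * δ := sum_le_sum_of_subset_of_nonneg (filter_subset _ _)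
              fun _ _ _ => by positivity
          _ = _ := by simp

/-- Both joint laws have the same marginal in `x`, so their distance is the average over `x` of the
distances for fixed `x`. The factor 2 in `hε` is the factor `1/2` in `statDist`. -/
lemma SecondMomentBound.isStrongInFirst {Ext : Bits n₁ → Bits n₂ → Bits m} {k₁ k₂ γ ε : ℝ}
    (h : SecondMomentBound Ext ((2 : ℝ) ^ (-k₁)) ((2 : ℝ) ^ (-k₂)) γ) (hγ : 0 ≤ γ)
    (hε : (2 : ℝ) ^ ((m : ℝ) / 2) * γ ≤ 2 * ε) : IsStrongInFirst k₁ k₂ ε Ext := by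
  intro X Y hX hY
  have := h.sum_first_le hγ (fun x => (X x).toReal) (fun y => (Y y).toReal)
    (fun _ => ENNReal.toReal_nonneg) X.sum_toReal (toReal_le_of_le_minEntropy hX)
    (fun _ => ENNReal.toReal_nonneg) Y.sum_toReal (toReal_le_of_le_minEntropy hY)
  unfold statDist
  have e : ∑ a, |((indepJoint X Y).map (fun s => (Ext s.1 s.2, s.1)) a).toReal
      - (indepJoint (PMF.uniformOfFintype (Bits m)) X a).toReal|
      = ∑ x, (X x).toReal * ∑ z, |weightAt (fun y => (Y y).toReal) (Ext x) z - (2 ^ m)⁻¹| := by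
    rw [Fintype.sum_prod_type_right]
    refine sum_congr rfl fun x _ => ?_
    rw [mul_sum]
    refine sum_congr rfl fun z _ => ?_
    rw [indepJoint_toReal, PMF.map_toReal, Fintype.sum_prod_type, sum_eq_single x]
    · rw [← abs_of_nonneg (ENNReal.toReal_nonneg (a := X x)), ← abs_mul,
        abs_of_nonneg (ENNReal.toReal_nonneg (a := X x)), mul_sub, weightAt, mul_sum]
      congr 2
      · refine sum_congr rfl fun y _ => ?_
        rw [indepJoint_toReal]
        simp
      · rw [PMF.uniformOfFintype_toReal, mul_comm]
        simp
    · intro x' _ hx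
      simp [hx]
    · simp
  rw [e]
  linarith

/-- Forgetting `x` can only decrease the distance, by the triangle inequality. -/
lemma SecondMomentBound.isTwoSourceExtractor {Ext : Bits n₁ → Bits n₂ → Bits m} {k₁ k₂ γ ε : ℝ}
    (h : SecondMomentBound Ext ((2 : ℝ) ^ (-k₁)) ((2 : ℝ) ^ (-k₂)) γ) (hγ : 0 ≤ γ)
    (hε : (2 : ℝ) ^ ((m : ℝ) / 2) * γ ≤ 2 * ε) : IsTwoSourceExtractor k₁ k₂ ε Ext := by
  intro X Y hX hY
  have := h.sum_first_le hγ (fun x => (X x).toReal) (fun y => (Y y).toReal)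
    (fun _ => ENNReal.toReal_nonneg) X.sum_toReal (toReal_le_of_le_minEntropy hX)
    (fun _ => ENNReal.toReal_nonneg) Y.sum_toReal (toReal_le_of_le_minEntropy hY)
  unfold statDist
  have e : ∑ z, |((indepJoint X Y).map (fun s => Ext s.1 s.2) z).toReal
      - (PMF.uniformOfFintype (Bits m) z).toReal|
      ≤ ∑ x, (X x).toReal * ∑ z, |weightAt (fun y => (Y y).toReal) (Ext x) z - (2 ^ m)⁻¹| := by
    simp_rw [mul_sum]
    rw [sum_comm]
    refine sum_le_sum fun z _ => ?_
    have e1 : ((indepJoint X Y).map (fun s => Ext s.1 s.2) z).toReal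
        - (PMF.uniformOfFintype (Bits m) z).toReal
        = ∑ x, (X x).toReal * (weightAt (fun y => (Y y).toReal) (Ext x) z - (2 ^ m)⁻¹) := by
      simp_rw [mul_sub, sum_sub_distrib, ← sum_mul, X.sum_toReal, one_mul]
      rw [PMF.map_toReal, Fintype.sum_prod_type]
      congr 1
      · refine sum_congr rfl fun x _ => ?_
        rw [weightAt, mul_sum]
        refine sum_congr rfl fun y _ => ?_
        rw [indepJoint_toReal]
        simp only
        ring
      · simp
    rw [e1]
    refine (abs_sum_le_sum_abs _ _).trans (sum_le_sum fun x _ => ?_)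
    rw [abs_mul, abs_of_nonneg ENNReal.toReal_nonneg]
  linarith

/-- By `hk` the entropy of `Y` exceeds `k₂` by `log (1/δ)`, so conditioning `Y` on an event of
probability above `δ` still leaves entropy `k₂`. -/
lemma SecondMomentBound.isStrongInSecond {Ext : Bits n₁ → Bits n₂ → Bits m} {k₁ k₂ k₂' γ ε δ : ℝ}
    (h : SecondMomentBound Ext ((2 : ℝ) ^ (-k₁)) ((2 : ℝ) ^ (-k₂)) γ) (hγ : 0 ≤ γ) (hδ : 0 < δ)
    (hk : (2 : ℝ) ^ (-k₂') = 2 ^ (-k₂) * δ)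
    (hε : (2 : ℝ) ^ ((m : ℝ) / 2) * γ + 2 * (2 ^ m * (2 * δ)) ≤ 2 * ε) :
    IsStrongInSecond k₁ k₂' ε Ext := by
  intro X Y hX hY
  have := h.sum_second_le hγ hδ (fun x => (X x).toReal) (fun y => (Y y).toReal)
    (fun _ => ENNReal.toReal_nonneg) X.sum_toReal (toReal_le_of_le_minEntropy hX)
    (fun _ => ENNReal.toReal_nonneg) Y.sum_toReal
    (fun y => (toReal_le_of_le_minEntropy hY y).trans hk.le)
  unfold statDist
  have e : ∑ a, |((indepJoint X Y).map (fun s => (Ext s.1 s.2, s.2)) a).toReal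
      - (indepJoint (PMF.uniformOfFintype (Bits m)) Y a).toReal|
      = ∑ y, (Y y).toReal * ∑ z, |weightAt (fun x => (X x).toReal) (fun x => Ext x y) z
        - (2 ^ m)⁻¹| := by
    rw [Fintype.sum_prod_type_right]
    refine sum_congr rfl fun y _ => ?_
    rw [mul_sum]
    refine sum_congr rfl fun z _ => ?_
    rw [indepJoint_toReal, PMF.map_toReal, Fintype.sum_prod_type_right, sum_eq_single y]
    · rw [← abs_of_nonneg (ENNReal.toReal_nonneg (a := Y y)), ← abs_mul,
        abs_of_nonneg (ENNReal.toReal_nonneg (a := Y y)), mul_sub, weightAt, mul_sum]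
      congr 2
      · refine sum_congr rfl fun x _ => ?_
        rw [indepJoint_toReal]
        simp only [Prod.mk.injEq, and_true]
        ring
      · rw [PMF.uniformOfFintype_toReal, mul_comm]
        simp
    · intro y' _ hy
      simp [hy]
    · simp
  rw [e]
  linarith

lemma SecondMomentBound.isStrongTwoSourceExtractor {Ext : Bits n₁ → Bits n₂ → Bits m}
    {k₁ k₂ γ : ℝ} (h : SecondMomentBound Ext ((2 : ℝ) ^ (-k₁)) ((2 : ℝ) ^ (-k₂)) γ) (hγ : 0 < γ) :
    IsStrongTwoSourceExtractor (k₁ + (m : ℝ) / 2 + 2 + Real.logb 2 (1 / γ))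
      (k₂ + (m : ℝ) / 2 + 2 + Real.logb 2 (1 / γ)) (γ * (2 : ℝ) ^ ((m : ℝ) / 2 + 1)) Ext := by
  have e1 : γ * (2 : ℝ) ^ ((m : ℝ) / 2 + 1) = 2 * ((2 : ℝ) ^ ((m : ℝ) / 2) * γ) := by
    rw [Real.rpow_add two_pos, Real.rpow_one]
    ring
  have hpos : 0 < (2 : ℝ) ^ ((m : ℝ) / 2) := by positivity
  have hone : 1 ≤ (2 : ℝ) ^ ((m : ℝ) / 2) := Real.one_le_rpow (by norm_num) (by positivity)
  -- Statistical distance never exceeds 1, so only small errors need an argument.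
  by_cases hbig : 1 ≤ γ * (2 : ℝ) ^ ((m : ℝ) / 2 + 1)
  · exact ⟨fun _ _ _ _ => (statDist_le_one _ _).trans hbig,
      fun _ _ _ _ => (statDist_le_one _ _).trans hbig,
      fun _ _ _ _ => (statDist_le_one _ _).trans hbig⟩
  -- This makes `log (1/γ)` non-negative, so the required entropies are at least `k₁` and `k₂`.
  have hγ1 : γ ≤ 1 := by
    by_contra h1
    push Not at h1 hbig
    rw [e1] at hbig
    nlinarith
  have hlog : 0 ≤ (m : ℝ) / 2 + 2 + Real.logb 2 (1 / γ) := by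
    have : 0 ≤ Real.logb 2 (1 / γ) := Real.logb_nonneg one_lt_two (by
      rw [le_div_iff₀ hγ]; linarith)
    positivity
  have hε : (2 : ℝ) ^ ((m : ℝ) / 2) * γ ≤ 2 * (γ * (2 : ℝ) ^ ((m : ℝ) / 2 + 1)) := by
    rw [e1]
    have : 0 < (2 : ℝ) ^ ((m : ℝ) / 2) * γ := by positivity
    linarith
  refine ⟨fun X Y hX hY => h.isTwoSourceExtractor hγ.le hε X Y (by linarith) (by linarith),
    fun X Y hX hY => h.isStrongInFirst hγ.le hε X Y (by linarith) (by linarith),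
    fun X Y hX hY => ?_⟩
  -- With this `δ` the exceptional `y` contribute as much as the error `2 ^ (m / 2) * γ` of the
  -- others, and `log (1/δ)` is `m / 2 + 2 + log (1/γ)`.
  set δ : ℝ := (2 : ℝ) ^ (-((m : ℝ) / 2)) / 4 * γ with hδ
  refine h.isStrongInSecond (δ := δ) hγ.le (by positivity) ?_ ?_ X Y (by linarith) hY
  · rw [show -(k₂ + (m : ℝ) / 2 + 2 + Real.logb 2 (1 / γ))
      = -k₂ + (-((m : ℝ) / 2) + (-2 + Real.logb 2 γ)) by
        rw [one_div, Real.logb_inv]; ring, Real.rpow_add two_pos, Real.rpow_add two_pos,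
      Real.rpow_add two_pos, Real.rpow_logb two_pos (by norm_num) hγ, hδ]
    rw [show (2 : ℝ) ^ (-2 : ℝ) = 1 / 4 by rw [Real.rpow_neg (by norm_num)]; norm_num]
    ring
  · have e2 : (2 : ℝ) ^ m * (2 : ℝ) ^ (-((m : ℝ) / 2)) = (2 : ℝ) ^ ((m : ℝ) / 2) := by
      rw [← Real.rpow_natCast, ← Real.rpow_add two_pos]
      congr 1
      ring
    have e3 : 2 * ((2 : ℝ) ^ m * (2 * δ)) = (2 : ℝ) ^ ((m : ℝ) / 2) * γ := by
      rw [hδ, ← e2]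
      ring
    rw [e3, e1]
    have : 0 < (2 : ℝ) ^ ((m : ℝ) / 2) * γ := by positivity
    linarith

/-- The extractor satisfies the second moment bound. -/
theorem secondMomentBound_razExtractor {P : Polynomial (ZMod 2)} (hP : P.Monic)
    (hirr : Irreducible P) (heven : Even n₁) (hdeg : P.natDegree = n₁ / 2)
    (a : Bits n₂ → AdjoinRoot P) (ha : Function.Injective a) {p' h : ℕ} (hh : 0 < h)
    (hm : m ≤ n₁ / 2) (hp : 2 * h ≤ p') {k₁ k₂ γ ζ : ℝ} (hk₂ : 0 ≤ k₂)
    (hζ : p' ≤ ζ * (2 : ℝ) ^ (n₁ / 2))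
    (hγ : (2 : ℝ) ^ ((n₁ : ℝ) - k₁) * (ζ + ((2 * h : ℕ) : ℝ) ^ (2 * h) * ((2 : ℝ) ^ (-k₂)) ^ h)
      ≤ γ ^ (2 * h)) :
    SecondMomentBound (razExtractor hP a p' hm) ((2 : ℝ) ^ (-k₁)) ((2 : ℝ) ^ (-k₂)) γ := by
  intro τ hτ f q hf0 hf1 hf hq0 hq1 hq
  refine sum_mul_sq_le_of_sum_mul_pow_le f _ hf0 hf1 hh (le_trans ?_ hγ)
  have hcard : (Fintype.card (Bits n₁) : ℝ) = 2 ^ (n₁ / 2) * 2 ^ (n₁ / 2) := by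
    obtain ⟨k, rfl⟩ := heven
    have : (k + k) / 2 = k := by omega
    simp [this, pow_add]
  have hcard' : (Fintype.card (Bits n₁) : ℝ) = (2 : ℝ) ^ (n₁ : ℝ) := by
    rw [Real.rpow_natCast]
    simp
  have key := sum_pow_signed_sum_le
    (fun (x : Bits n₁) (y : Bits n₂) => walsh τ (razExtractor hP a p' hm x y))
    (fun x y => by rw [walsh_eq_bitSign, bitSign_mul_self]) q hq0 hq1 hq
    (Real.rpow_le_one_of_one_le_of_nonpos one_le_two (by linarith)) (by positivity) hh
    (B := p' * (2 : ℝ) ^ (n₁ / 2)) (by positivity) (by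
      intro S hS hSc
      have h1 : ∀ x : Bits n₁, ∏ y ∈ S, walsh τ (razExtractor hP a p' hm x y)
          = bitSign (∑ j ∈ S ×ˢ τ.map (Fin.castLEEmb hm), bitGenerator hP a p' x j) := by
        intro x
        simp_rw [walsh_eq_bitSign]
        rw [← bitSign_sum, sum_product]
        congr 1
        refine sum_congr rfl fun y _ => ?_
        rw [sum_map]
        rfl
      simp_rw [h1]
      -- The test consists of the positions `τ` in each block of `S`. It meets only `S.card` blocks,
      -- so no factor `m` is lost.
      refine abs_sum_bitSign_bitGenerator_le hP hirr heven hdeg a ha _ ?_ ?_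
      · exact hS.product (hτ.map)
      · refine le_trans (card_le_card (t := S) ?_) (hSc.trans hp)
        intro y hy
        obtain ⟨j, hj, rfl⟩ := mem_image.1 hy
        exact (mem_product.1 hj).1)
  -- An even power is non-negative, so the weights `f x` may be replaced by their upper bound, which
  -- turns the moment into a uniform one.
  calc ∑ x, f x * (∑ y, q y * walsh τ (razExtractor hP a p' hm x y)) ^ (2 * h)
      ≤ ∑ x, (2 : ℝ) ^ (-k₁) * (∑ y, q y * walsh τ (razExtractor hP a p' hm x y)) ^ (2 * h) :=
        sum_le_sum fun x _ => mul_le_mul_of_nonneg_right (hf x) (by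
          rw [pow_mul]; positivity)
    _ ≤ (2 : ℝ) ^ (-k₁) * (ζ * (2 : ℝ) ^ (n₁ / 2) * (2 : ℝ) ^ (n₁ / 2)
          + Fintype.card (Bits n₁) * (((2 * h : ℕ) : ℝ) ^ (2 * h) * ((2 : ℝ) ^ (-k₂)) ^ h)) := by
        rw [← mul_sum]
        refine mul_le_mul_of_nonneg_left (key.trans ?_) (by positivity)
        gcongr
    _ = _ := by
        rw [mul_assoc, ← hcard, sub_eq_add_neg, Real.rpow_add two_pos, ← hcard']
        ring

end Extractor

/-! ### The stated parameters -/

section Parameters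

theorem bias_and_extraction {n₁ n₂ : ℕ} (h₁ : 0 < n₁) (heven : Even n₁)
    {P : Polynomial (ZMod 2)} (hP : P.Monic) (hirr : Irreducible P) (hdeg : P.natDegree = n₁ / 2)
    (a : Bits n₂ → AdjoinRoot P) (ha : Function.Injective a) {k₁ k₂ m l p : ℕ} {γ ζ : ℝ}
    (hm0 : 0 < m) (hp0 : 0 < p) (hγ0 : 0 < γ) (hm : m ≤ n₁ / 2)
    (hl : (l : ℝ) ≤ n₂ + Real.logb 2 ((n₁ : ℝ) / 2)) (hpl : (p : ℝ) ≤ (2 : ℝ) ^ l / m)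
    (hpe : Even p) (hζ : ζ = (2 : ℝ) ^ ((l : ℝ) - (n₁ : ℝ) / 2))
    (hγ : (2 : ℝ) ^ (((n₁ : ℝ) - k₁) / p) *
        ((2 * ζ) ^ (1 / (p : ℝ)) + p * (2 : ℝ) ^ (-(k₂ : ℝ) / 2)) ≤ γ) :
    IsBiasedGenerator (2 ^ l) (2 * ζ)
        (bitGenerator hP a (2 ^ l) : Bits n₁ → Bits n₂ × Fin (n₁ / 2) → ZMod 2) ∧
      IsTwoSourceExtractor (k₁ : ℝ) (k₂ : ℝ) ((2 : ℝ) ^ ((m : ℝ) / 2) * γ)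
        (razExtractor hP a (2 ^ l) hm) ∧
      IsStrongTwoSourceExtractor
        ((k₁ : ℝ) + (m : ℝ) / 2 + 2 + Real.logb 2 (1 / γ))
        ((k₂ : ℝ) + (m : ℝ) / 2 + 2 + Real.logb 2 (1 / γ))
        (γ * (2 : ℝ) ^ ((m : ℝ) / 2 + 1))
        (razExtractor hP a (2 ^ l) hm) := by
  have hhalf : (n₁ : ℝ) / 2 = ((n₁ / 2 : ℕ) : ℝ) := by
    obtain ⟨k, rfl⟩ := heven
    have : (k + k) / 2 = k := by omega
    rw [this]
    push_cast
    ring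
  have ht0 : 0 < n₁ / 2 := by
    obtain ⟨k, rfl⟩ := heven
    omega
  have hζ0 : 0 < ζ := by rw [hζ]; positivity
  have hζt : ((2 ^ l : ℕ) : ℝ) = ζ * (2 : ℝ) ^ (n₁ / 2) := by
    rw [hζ, hhalf, ← Real.rpow_natCast 2 (n₁ / 2), ← Real.rpow_add two_pos, sub_add_cancel,
      Real.rpow_natCast]
    push_cast
    rfl
  have hζ2 : ((2 ^ l : ℕ) : ℝ) ≤ 2 * ζ * (2 : ℝ) ^ (n₁ / 2) := by
    rw [hζt]
    have : 0 < ζ * (2 : ℝ) ^ (n₁ / 2) := by positivity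
    linarith
  have hcard : 2 ^ l ≤ 2 ^ n₂ * (n₁ / 2) := by
    have h1 := Real.rpow_le_rpow_of_exponent_le one_le_two hl
    rw [Real.rpow_add two_pos, hhalf, Real.rpow_logb two_pos (by norm_num) (by exact_mod_cast ht0),
      Real.rpow_natCast, Real.rpow_natCast] at h1
    exact_mod_cast h1
  obtain ⟨h, rfl⟩ := hpe
  rw [← two_mul] at *
  have hh : 0 < h := by omega
  have hp' : 2 * h ≤ 2 ^ l := by
    have h1 : (2 : ℝ) ^ l / m ≤ 2 ^ l := div_le_self (by positivity) (by exact_mod_cast hm0)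
    have h2 := hpl.trans h1
    exact_mod_cast h2
  -- The hypothesis on `γ`, raised to the power `p = 2 * h`.
  have hpow : (2 : ℝ) ^ ((n₁ : ℝ) - k₁)
      * (2 * ζ + ((2 * h : ℕ) : ℝ) ^ (2 * h) * ((2 : ℝ) ^ (-(k₂ : ℝ))) ^ h) ≤ γ ^ (2 * h) := by
    have hne : ((2 * h : ℕ) : ℝ) ≠ 0 := by exact_mod_cast hp0.ne'
    have hA : ((2 : ℝ) ^ (((n₁ : ℝ) - k₁) / ((2 * h : ℕ) : ℝ))) ^ (2 * h)
        = (2 : ℝ) ^ ((n₁ : ℝ) - k₁) := by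
      rw [← Real.rpow_mul_natCast (by norm_num), div_mul_cancel₀ _ hne]
    have hB : ((2 * ζ) ^ (1 / ((2 * h : ℕ) : ℝ))) ^ (2 * h) = 2 * ζ := by
      rw [← Real.rpow_mul_natCast (by positivity), one_div_mul_cancel hne, Real.rpow_one]
    have hC : ((2 : ℝ) ^ (-(k₂ : ℝ) / 2)) ^ (2 * h) = ((2 : ℝ) ^ (-(k₂ : ℝ))) ^ h := by
      rw [← Real.rpow_mul_natCast (by norm_num), ← Real.rpow_mul_natCast (by norm_num)]
      congr 1
      push_cast
      ring
    refine le_trans ?_ (pow_le_pow_left₀ (by positivity) hγ (2 * h))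
    rw [mul_pow, hA]
    refine mul_le_mul_of_nonneg_left ?_ (by positivity)
    -- For non-negative numbers the power of a sum is at least the sum of the powers.
    refine le_trans (le_of_eq ?_) (pow_add_pow_le (by positivity) (by positivity) hp0.ne')
    rw [hB, mul_pow, hC]
  have hb := secondMomentBound_razExtractor hP hirr heven hdeg a ha hh hm hp'
    (Nat.cast_nonneg k₂) hζ2 hpow
  have hε : (2 : ℝ) ^ ((m : ℝ) / 2) * γ ≤ 2 * ((2 : ℝ) ^ ((m : ℝ) / 2) * γ) := by
    have : 0 < (2 : ℝ) ^ ((m : ℝ) / 2) * γ := by positivity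
    linarith
  exact ⟨isBiasedGenerator_bitGenerator hP hirr heven hdeg a ha (by positivity) hcard hζ2,
    hb.isTwoSourceExtractor hγ0.le hε, hb.isStrongTwoSourceExtractor hγ0⟩

end Parameters

/-! ### Reasoning about programs of the word RAM -/

namespace WordExpr

instance : Add WordExpr := ⟨.op .add⟩
instance : Sub WordExpr := ⟨.op .sub⟩
instance : Mul WordExpr := ⟨.op .mul⟩
instance : Div WordExpr := ⟨.op .div⟩
instance : Mod WordExpr := ⟨.op .mod⟩

/-- The comparison `a < b`, as a word. -/
def less (a b : WordExpr) : WordExpr := .op .lt a b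

/-- Bitwise exclusive or. -/
def bxor (a b : WordExpr) : WordExpr := .op .xor a b

variable (w : ℕ) (s : RamState) (a b : WordExpr)

@[simp] lemma eval_const (v : ℕ) : (const v).eval w s = v % 2 ^ w := rfl
@[simp] lemma eval_reg (r : ℕ) : (reg r).eval w s = s.reg r := rfl
@[simp] lemma eval_cell (r : ℕ) : (cell r a).eval w s = s.mem r (a.eval w s) := rfl
@[simp] lemma eval_add : (a + b).eval w s = (a.eval w s + b.eval w s) % 2 ^ w := rfl
@[simp] lemma eval_sub : (a - b).eval w s = (a.eval w s - b.eval w s) % 2 ^ w := rfl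
@[simp] lemma eval_mul : (a * b).eval w s = (a.eval w s * b.eval w s) % 2 ^ w := rfl
@[simp] lemma eval_div : (a / b).eval w s = (a.eval w s / b.eval w s) % 2 ^ w := rfl
@[simp] lemma eval_mod : (a % b).eval w s = (a.eval w s % b.eval w s) % 2 ^ w := rfl
@[simp] lemma eval_less :
    (a.less b).eval w s = (if a.eval w s < b.eval w s then 1 else 0) % 2 ^ w := rfl
@[simp] lemma eval_bxor : (a.bxor b).eval w s = (a.eval w s ^^^ b.eval w s) % 2 ^ w := rfl

/-- The arrays that occur in an expression. -/
def arrs : WordExpr → List ℕ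
  | .const _ => []
  | .reg _ => []
  | .cell a i => a :: i.arrs
  | .op _ e₁ e₂ => e₁.arrs ++ e₂.arrs

lemma eval_congr {w : ℕ} {s s' : RamState} (hr : s'.reg = s.reg) :
    ∀ e : WordExpr, (∀ a ∈ e.arrs, s'.mem a = s.mem a) → e.eval w s' = e.eval w s
  | .const _, _ => rfl
  | .reg r, _ => by simp [hr]
  | .cell a i, h => by
    have h1 := eval_congr (w := w) hr i fun b hb => h b (List.mem_cons_of_mem _ hb)
    rw [eval_cell, eval_cell, h1, h a List.mem_cons_self]
  | .op o e₁ e₂, h => by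
    have h1 := eval_congr (w := w) hr e₁ fun b hb => h b (List.mem_append_left _ hb)
    have h2 := eval_congr (w := w) hr e₂ fun b hb => h b (List.mem_append_right _ hb)
    simp only [eval, h1, h2]

end WordExpr

/-- The registers that a program may write. -/
def Program.regs : Program → List ℕ
  | .skip => []
  | .setReg r _ => [r]
  | .setCell _ _ _ => []
  | .seq c₁ c₂ => c₁.regs ++ c₂.regs
  | .ifNonzero _ c₁ c₂ => c₁.regs ++ c₂.regs
  | .whileNonzero _ c => c.regs

/-- The arrays that a program may write. -/
def Program.arrs : Program → List ℕ
  | .skip => []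
  | .setReg _ _ => []
  | .setCell a _ _ => [a]
  | .seq c₁ c₂ => c₁.arrs ++ c₂.arrs
  | .ifNonzero _ c₁ c₂ => c₁.arrs ++ c₂.arrs
  | .whileNonzero _ c => c.arrs

/-- Nothing but the registers and arrays written by `c` differs between the two states. -/
structure Frame (c : Program) (s s' : RamState) : Prop where
  reg : ∀ r ∉ c.regs, s'.reg r = s.reg r
  mem : ∀ a ∉ c.arrs, s'.mem a = s.mem a

lemma Frame.refl (c : Program) (s : RamState) : Frame c s s := ⟨fun _ _ => rfl, fun _ _ => rfl⟩

lemma Frame.trans {c : Program} {s₁ s₂ s₃ : RamState} (h : Frame c s₁ s₂) (h' : Frame c s₂ s₃) :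
    Frame c s₁ s₃ :=
  ⟨fun r hr => (h'.reg r hr).trans (h.reg r hr), fun a ha => (h'.mem a ha).trans (h.mem a ha)⟩

lemma Frame.mono {c c' : Program} {s₁ s₂ : RamState} (h : Frame c s₁ s₂) (hr : c.regs ⊆ c'.regs)
    (ha : c.arrs ⊆ c'.arrs) : Frame c' s₁ s₂ :=
  ⟨fun r h' => h.reg r fun h'' => h' (hr h''), fun a h' => h.mem a fun h'' => h' (ha h'')⟩

/-- What a program may write is read off its text. For concrete programs the side conditions of
later frame arguments are then decided by computation. -/
lemma Exec.frame {w : ℕ} {c : Program} {s s' : RamState} {T : ℕ} (h : Exec w c s T s') :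
    Frame c s s' := by
  induction h with
  | skip s => exact Frame.refl _ _
  | setReg s r e =>
    exact ⟨fun r' hr => Function.update_of_ne (by simpa [Program.regs] using hr) _ _,
      fun _ _ => rfl⟩
  | setCell s a i e =>
    exact ⟨fun _ _ => rfl,
      fun a' ha => Function.update_of_ne (by simpa [Program.arrs] using ha) _ _⟩
  | seq _ _ h₁ h₂ =>
    exact (h₁.mono (by simp [Program.regs]) (by simp [Program.arrs])).trans
      (h₂.mono (by simp [Program.regs]) (by simp [Program.arrs]))
  | ifTrue _ _ h => exact h.mono (by simp [Program.regs]) (by simp [Program.arrs])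
  | ifFalse _ _ h => exact h.mono (by simp [Program.regs]) (by simp [Program.arrs])
  | whileDone _ => exact Frame.refl _ _
  | whileStep _ _ _ h₁ h₂ => exact Frame.trans (h₁.mono (by simp [Program.regs])
      (by simp [Program.arrs])) h₂

/-- `c`, started in `s`, halts within `B` steps in a state that satisfies `Q`. -/
def Runs (w : ℕ) (c : Program) (s : RamState) (B : ℕ) (Q : RamState → Prop) : Prop :=
  ∃ T s', Exec w c s T s' ∧ T ≤ B ∧ Q s'

namespace Runs

variable {w : ℕ} {c c₁ c₂ : Program} {s : RamState} {B B₁ B₂ : ℕ} {Q Q' : RamState → Prop}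

lemma budget (h : Runs w c s B₁ Q) (hB : B₁ ≤ B₂) : Runs w c s B₂ Q :=
  let ⟨T, s', h1, h2, h3⟩ := h
  ⟨T, s', h1, h2.trans hB, h3⟩

lemma mono (h : Runs w c s B Q) (hQ : ∀ s', Frame c s s' → Q s' → Q' s') : Runs w c s B Q' :=
  let ⟨T, s', h1, h2, h3⟩ := h
  ⟨T, s', h1, h2, hQ s' h1.frame h3⟩

lemma seq (h : Runs w c₁ s B₁ fun s₁ => Runs w c₂ s₁ B₂ Q) :
    Runs w (c₁.seq c₂) s (B₁ + B₂ + 1) Q :=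
  let ⟨_, _, h1, h2, _, s', h3, h4, h5⟩ := h
  ⟨_, s', .seq h1 h3, by omega, h5⟩

/-- Sequential composition where the first program is specified separately. -/
lemma then_ (h : Runs w c₁ s B₁ Q') (h' : ∀ s', Frame c₁ s s' → Q' s' → Runs w c₂ s' B₂ Q) :
    Runs w (c₁.seq c₂) s (B₁ + B₂ + 1) Q := (h.mono h').seq

lemma setReg {r : ℕ} {e : WordExpr} (v : ℕ) (hv : e.eval w s = v)
    (hQ : Q ⟨Function.update s.reg r v, s.mem⟩) : Runs w (.setReg r e) s (e.cost + 1) Q :=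
  ⟨_, _, .setReg s r e, le_rfl, by rwa [hv]⟩

/-- The induction is on the number `n` of rounds still to come, so the index `i` of the next round
has to vary. -/
lemma whileNonzero_aux {e : WordExpr} (I : ℕ → RamState → Prop) (τ : ℕ → ℕ) :
    ∀ (n : ℕ) (i : ℕ) (s : RamState), I i s →
      (∀ j, i ≤ j → j < i + n → ∀ s, I j s → e.eval w s ≠ 0 ∧ Runs w c s (τ j) (I (j + 1))) →
      (∀ s, I (i + n) s → e.eval w s = 0) →
      Runs w (.whileNonzero e c) s
        (∑ j ∈ Finset.range n, (τ (i + j) + e.cost + 1) + e.cost + 1) (I (i + n))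
  | 0, i, s, hI, _, hend => ⟨_, s, .whileDone (hend s hI), by simp, hI⟩
  | n + 1, i, s, hI, hstep, hend => by
    obtain ⟨h0, T₁, s₁, h1, h2, h3⟩ := hstep i le_rfl (by omega) s hI
    obtain ⟨T₂, s₂, h4, h5, h6⟩ := whileNonzero_aux I τ n (i + 1) s₁ h3
      (fun j hj hj' => hstep j (by omega) (by omega)) (by
        rw [show i + 1 + n = i + (n + 1) by ring]; exact hend)
    refine ⟨_, s₂, .whileStep h0 h1 h4, ?_, ?_⟩
    · rw [Finset.sum_range_succ']
      have : ∀ j, i + 1 + j = i + (j + 1) := fun j => by ring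
      simp only [this] at h5
      simp only [Nat.add_zero]
      omega
    · rwa [show i + (n + 1) = i + 1 + n by ring]

/-- A loop with `n` rounds and invariant `I`. -/
lemma whileNonzero {e : WordExpr} (n : ℕ) (τ : ℕ → ℕ) (I : ℕ → RamState → Prop) (hI : I 0 s)
    (hstep : ∀ i < n, ∀ s', Frame c s s' → I i s' →
      e.eval w s' ≠ 0 ∧ Runs w c s' (τ i) (I (i + 1)))
    (hend : ∀ s', Frame c s s' → I n s' → e.eval w s' = 0) :
    Runs w (.whileNonzero e c) s
      (∑ i ∈ Finset.range n, (τ i + e.cost + 1) + e.cost + 1) (I n) := by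
  have := whileNonzero_aux (w := w) (c := c) (e := e) (fun i s' => I i s' ∧ Frame c s s') τ n 0 s
    ⟨hI, Frame.refl _ _⟩ (fun j _ hj s' hs' => by
      obtain ⟨h1, h2⟩ := hstep j (by omega) s' hs'.2 hs'.1
      exact ⟨h1, h2.mono fun s'' hf h => ⟨h, hs'.2.trans hf⟩⟩)
    (fun s' hs' => hend s' hs'.2 (by simpa using hs'.1))
  simp only [zero_add] at this
  exact this.mono fun s' _ h => h.1

end Runs

/-- `for reg 20 < reg rb do dst[reg 20] := e`. -/
def fill (dst rb : ℕ) (e : WordExpr) : Program :=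
  .seq (.setReg 20 (.const 0))
    (.whileNonzero (.less (.reg 20) (.reg rb))
      (.seq (.setCell dst (.reg 20) e) (.setReg 20 (.reg 20 + .const 1))))

/-- By `hread` the expression does not read the array being written, so every new cell is computed
from the original memory. -/
lemma Runs.fill {w : ℕ} {dst rb : ℕ} {e : WordExpr} {s : RamState} {n : ℕ} {Q : RamState → Prop}
    (hrb : s.reg rb = n) (hrb20 : rb ≠ 20) (hn : n < 2 ^ w) (hread : dst ∉ e.arrs)
    (hQ : ∀ s', s'.reg = Function.update s.reg 20 n → (∀ a ≠ dst, s'.mem a = s.mem a) →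
      (∀ i < n, s'.mem dst i = e.eval w ⟨Function.update s.reg 20 i, s.mem⟩) →
      (∀ i, n ≤ i → s'.mem dst i = s.mem dst i) → Q s') :
    Runs w (fill dst rb e) s (n * (e.cost + 12) + 10) Q := by
  let I : ℕ → RamState → Prop := fun i s' => s'.reg = Function.update s.reg 20 i ∧
    (∀ a ≠ dst, s'.mem a = s.mem a) ∧
    (∀ j < i, s'.mem dst j = e.eval w ⟨Function.update s.reg 20 j, s.mem⟩) ∧
    (∀ j, i ≤ j → s'.mem dst j = s.mem dst j)
  have key := Runs.seq (w := w) (s := s) (c₁ := .setReg 20 (.const 0)) (Q := I n)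
    (Runs.setReg 0 (by simp) (Runs.whileNonzero
      (c := .seq (.setCell dst (.reg 20) e) (.setReg 20 (.reg 20 + .const 1)))
      (e := .less (.reg 20) (.reg rb)) n (fun _ => e.cost + 7) I ⟨rfl, fun _ _ => rfl, by simp,
        fun _ _ => rfl⟩ ?_ ?_))
  · refine (key.budget ?_).mono fun s' _ h => hQ s' h.1 h.2.1 h.2.2.1 h.2.2.2
    simp only [Finset.sum_const, Finset.card_range, smul_eq_mul]
    simp only [WordExpr.cost, WordExpr.less]
    have : n * (e.cost + 7 + (1 + 1 + 1) + 1) ≤ n * (e.cost + 12) := Nat.mul_le_mul_left _ (by omega)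
    omega
  · intro i hi s' _ ⟨h1, h2, h3, h4⟩
    have h20 : s'.reg 20 = i := by rw [h1]; simp
    have hb : s'.reg rb = n := by rw [h1, Function.update_of_ne hrb20, hrb]
    have hw : 1 < 2 ^ w := by omega
    refine ⟨by simp [h20, hb, hi, Nat.mod_eq_of_lt hw], ?_⟩
    have he : e.eval w s' = e.eval w ⟨Function.update s.reg 20 i, s.mem⟩ :=
      WordExpr.eval_congr h1 e fun a ha => h2 a fun h => hread (h ▸ ha)
    refine ⟨_, _, .seq (.setCell s' dst (.reg 20) e) (.setReg _ 20 _), ?_, ?_⟩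
    · change 1 + e.cost + 1 + (1 + 1 + 1 + 1) + 1 ≤ _
      omega
    · refine ⟨?_, ?_, ?_, ?_⟩
      · simp only [WordExpr.eval_add, WordExpr.eval_reg, WordExpr.eval_const, h20,
          Nat.mod_eq_of_lt hw]
        rw [Nat.mod_eq_of_lt (by omega), h1, Function.update_idem]
      · intro a ha
        simp only [Function.update_of_ne ha]
        exact h2 a ha
      · intro j hj
        simp only [Function.update_self, WordExpr.eval_reg, h20]
        by_cases hji : j = i
        · subst hji
          rw [Function.update_self, he]
        · rw [Function.update_of_ne hji]
          exact h3 j (by omega)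
      · intro j hj
        simp only [Function.update_self, WordExpr.eval_reg, h20]
        rw [Function.update_of_ne (by omega)]
        exact h4 j (by omega)
  · intro s' _ ⟨h1, h2, h3, h4⟩
    have h20 : s'.reg 20 = n := by rw [h1]; simp
    have hb : s'.reg rb = n := by rw [h1, Function.update_of_ne hrb20, hrb]
    simp [h20, hb]

/-! ### The exact Fourier transform, in place and with bit-reversed twiddle factors -/

section Fourier

open Complex Finset

/-- The bit-reversal of `n`, as a binary fraction. -/
noncomputable def revFrac : ℕ → ℝ
  | 0 => 0
  | n + 1 => revFrac ((n + 1) / 2) / 2 + ((n + 1) % 2 : ℕ) / 2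

lemma revFrac_eq (n : ℕ) : revFrac n = revFrac (n / 2) / 2 + (n % 2 : ℕ) / 2 := by
  cases n with
  | zero => simp [revFrac]
  | succ n => rw [revFrac]

/-- Reversal moves the leading binary digit to the last place. Hence the second half of a twiddle
table is the first half times a single root. -/
lemma revFrac_two_pow_add (j : ℕ) : ∀ B < 2 ^ j, revFrac (2 ^ j + B) = (1 / 2) ^ (j + 1) + revFrac B := by
  induction j with
  | zero =>
    intro B hB
    obtain rfl : B = 0 := by simpa using hB
    rw [revFrac_eq]
    simp [revFrac]
  | succ j ih =>
    intro B hB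
    have h1 : (2 ^ (j + 1) + B) / 2 = 2 ^ j + B / 2 := by rw [pow_succ]; omega
    have h2 : (2 ^ (j + 1) + B) % 2 = B % 2 := by rw [pow_succ]; omega
    rw [revFrac_eq, h1, h2, ih _ (by rw [pow_succ] at hB; omega), revFrac_eq B]
    ring

/-- The twiddle factor of block `n`. -/
noncomputable def twiddle (n : ℕ) : ℂ := exp (Real.pi * revFrac n * I)

/-- The `n`-th node of the transform. -/
noncomputable def node (n : ℕ) : ℂ := exp (2 * (Real.pi * revFrac n) * I)

/-- The twiddle factor of block `2 ^ j`. -/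
noncomputable def twiddleRoot (j : ℕ) : ℂ := exp (((Real.pi * (1 / 2) ^ (j + 1) : ℝ) : ℂ) * I)

lemma twiddle_zero : twiddle 0 = 1 := by simp [twiddle, revFrac]

lemma norm_twiddle (n : ℕ) : ‖twiddle n‖ = 1 := by
  have : twiddle n = exp (((Real.pi * revFrac n : ℝ) : ℂ) * I) := by simp [twiddle]
  rw [this, norm_exp_ofReal_mul_I]

lemma norm_twiddleRoot (n : ℕ) : ‖twiddleRoot n‖ = 1 := norm_exp_ofReal_mul_I _

lemma twiddle_two_pow_add {j B : ℕ} (hB : B < 2 ^ j) :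
    twiddle (2 ^ j + B) = twiddle B * twiddleRoot j := by
  rw [twiddle, revFrac_two_pow_add j B hB, twiddle, twiddleRoot, ← exp_add]
  congr 1
  push_cast
  ring

/-- The nodes `2 * B` and `2 * B + 1` are the two square roots of node `B`; this is the sign in a
butterfly. -/
lemma node_two_mul (B : ℕ) : node (2 * B) = twiddle B := by
  have h1 : 2 * B / 2 = B := by omega
  have h2 : 2 * B % 2 = 0 := by omega
  rw [node, revFrac_eq, h1, h2, twiddle]
  congr 1
  push_cast
  ring

lemma node_two_mul_add_one (B : ℕ) : node (2 * B + 1) = -twiddle B := by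
  have h1 : (2 * B + 1) / 2 = B := by omega
  have h2 : (2 * B + 1) % 2 = 1 := by omega
  rw [node, revFrac_eq, h1, h2, twiddle]
  have : 2 * ((Real.pi : ℂ) * ((revFrac B / 2 + (1 : ℕ) / 2 : ℝ) : ℂ)) * I
      = Real.pi * revFrac B * I + Real.pi * I := by push_cast; ring
  rw [this, exp_add, exp_pi_mul_I]
  ring

lemma node_sq (n : ℕ) : node n ^ 2 = node (n / 2) := by
  rw [node, revFrac_eq, ← exp_nat_mul, node]
  have : ((2 : ℕ) : ℂ) * (2 * ((Real.pi : ℂ) * ((revFrac (n / 2) / 2 + (n % 2 : ℕ) / 2 : ℝ) : ℂ)) * I)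
      = 2 * (Real.pi * revFrac (n / 2)) * I + (n % 2 : ℕ) * (2 * Real.pi * I) := by
    push_cast; ring
  rw [this, exp_add, exp_nat_mul_two_pi_mul_I, mul_one]

lemma node_pow_two_pow (n k : ℕ) : node n ^ 2 ^ k = node (n / 2 ^ k) := by
  induction k with
  | zero => simp
  | succ k ih => rw [pow_succ, pow_mul, ih, node_sq, Nat.div_div_eq_div_mul]

/-- One stage of the forward transform: butterflies on blocks of size `2 * H`. -/
noncomputable def fwdStage (H : ℕ) (V : ℕ → ℂ) (n : ℕ) : ℂ :=
  -- `n / H / 2` is the number of the block of size `2 * H` that contains `n`, and `n / H % 2` tells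
  -- in which half of it `n` lies.
  V (n - n / H % 2 * H) +
    (1 - 2 * (n / H % 2 : ℕ)) * (twiddle (n / H / 2) * V (n - n / H % 2 * H + H))

/-- One stage of the inverse transform. -/
noncomputable def invStage (H : ℕ) (V : ℕ → ℂ) (n : ℕ) : ℂ :=
  (V (n - n / H % 2 * H) + (1 - 2 * (n / H % 2 : ℕ)) * V (n - n / H % 2 * H + H)) *
    (if n / H % 2 = 0 then 1 else (starRingEnd ℂ) (twiddle (n / H / 2)))

/-- The sum and the difference of the two outputs of a butterfly are twice its terms, and the
conjugate removes a twiddle factor of modulus 1. -/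
lemma invStage_fwdStage {H : ℕ} (hH : 0 < H) (V : ℕ → ℂ) (n : ℕ) :
    invStage H (fwdStage H V) n = 2 * V n := by
  have hz : ∀ B, twiddle B * (starRingEnd ℂ) (twiddle B) = 1 := by
    intro B
    rw [mul_conj, normSq_eq_norm_sq, norm_twiddle]
    simp
  rcases Nat.mod_two_eq_zero_or_one (n / H) with h | h
  · have h1 : (n + H) / H = n / H + 1 := Nat.add_div_right _ hH
    have h2 : (n / H + 1) % 2 = 1 := by omega
    have h3 : (n / H + 1) / 2 = n / H / 2 := by omega
    simp only [invStage, fwdStage, h, zero_mul, Nat.sub_zero, h1, h2, h3, one_mul,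
      Nat.add_sub_cancel, if_true]
    push_cast
    ring
  · have hle : H ≤ n := by
      by_contra hlt
      rw [Nat.div_eq_of_lt (by omega)] at h
      omega
    have h1 : (n - H) / H = n / H - 1 := by
      simpa using Nat.sub_mul_div n H 1
    have hq : ∀ q, q % 2 = 1 → (q - 1) % 2 = 0 ∧ (q - 1) / 2 = q / 2 := by omega
    obtain ⟨h2, h3⟩ := hq _ h
    have h4 : n - H + H = n := by omega
    simp only [invStage, fwdStage, h, one_mul, h4, h1, h2, h3, zero_mul, Nat.sub_zero,
      one_ne_zero, if_false]
    push_cast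
    linear_combination 2 * V n * hz (n / H / 2)

/-- The forward transform on blocks of size `2 ^ k`. -/
noncomputable def fwdAll : ℕ → (ℕ → ℂ) → ℕ → ℂ
  | 0, V => V
  | k + 1, V => fwdAll k (fwdStage (2 ^ k) V)

/-- The inverse transform on blocks of size `2 ^ k`, without normalization. -/
noncomputable def invAll : ℕ → (ℕ → ℂ) → ℕ → ℂ
  | 0, V => V
  | k + 1, V => invStage (2 ^ k) (invAll k V)

lemma invStage_smul (H : ℕ) (c : ℂ) (V : ℕ → ℂ) :
    invStage H (fun n => c * V n) = fun n => c * invStage H V n := by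
  ext n
  simp only [invStage]
  ring

lemma invAll_fwdAll (k : ℕ) : ∀ V : ℕ → ℂ, invAll k (fwdAll k V) = fun n => 2 ^ k * V n := by
  induction k with
  | zero => intro V; ext n; simp [invAll, fwdAll]
  | succ k ih =>
    intro V
    rw [invAll, fwdAll, ih, invStage_smul]
    ext n
    rw [invStage_fwdStage (by positivity)]
    ring

/-- A stage sends the polynomial in a block of size `2 ^ (k + 1)`, with lower half `f₀` and upper
half `f₁`, to `f₀ + c f₁` in its two halves, where `c` is plus or minus the twiddle factor. This is
its reduction modulo `X ^ (2 ^ k) - c`, and `c` is the `2 ^ k`-th power of every node belonging to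
that half. -/
lemma fwdAll_eq_sum (k : ℕ) : ∀ (V : ℕ → ℂ) (n : ℕ),
    fwdAll k V n = ∑ j ∈ range (2 ^ k), V (n / 2 ^ k * 2 ^ k + j) * node n ^ j := by
  induction k with
  | zero => intro V n; simp [fwdAll]
  | succ k ih =>
    intro V n
    have hpos : 0 < 2 ^ k := by positivity
    have hnode := node_pow_two_pow n k
    have hdd : n / 2 ^ (k + 1) = n / 2 ^ k / 2 := by rw [pow_succ, Nat.div_div_eq_div_mul]
    rw [fwdAll, ih, show 2 ^ (k + 1) = 2 ^ k + 2 ^ k by ring, sum_range_add, ← sum_add_distrib,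
      ← show 2 ^ (k + 1) = 2 ^ k + 2 ^ k by ring, hdd]
    set b := n / 2 ^ k with hb
    refine sum_congr rfl fun j hj => ?_
    have hj := mem_range.1 hj
    have hdiv : (b * 2 ^ k + j) / 2 ^ k = b := by
      rw [add_comm, Nat.add_mul_div_right _ _ hpos, Nat.div_eq_of_lt hj, zero_add]
    have hstart : b * 2 ^ k + j - b % 2 * 2 ^ k = b / 2 * 2 ^ (k + 1) + j := by
      have h1 : b * 2 ^ k = b / 2 * 2 ^ (k + 1) + b % 2 * 2 ^ k := by
        conv_lhs => rw [← Nat.div_add_mod b 2]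
        ring
      omega
    have htw : (1 - 2 * ((b % 2 : ℕ) : ℂ)) * twiddle (b / 2) = node b := by
      rcases Nat.even_or_odd' b with ⟨c, hc | hc⟩
      · have h1 : b % 2 = 0 := by omega
        have h2 : b / 2 = c := by omega
        rw [h1, h2, hc, node_two_mul]
        simp
      · have h1 : b % 2 = 1 := by omega
        have h2 : b / 2 = c := by omega
        rw [h1, h2, hc, node_two_mul_add_one]
        push_cast
        ring
    rw [fwdStage, hdiv, hstart, ← mul_assoc, htw, ← hnode, pow_add, add_assoc _ j, add_comm j]
    ring_nf

lemma norm_one_sub_two_mul_mod (n : ℕ) : ‖(1 - 2 * ((n % 2 : ℕ) : ℂ))‖ = 1 := by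
  rcases Nat.mod_two_eq_zero_or_one n with h | h
  · simp [h]
  · rw [h]; norm_num

lemma norm_fwdStage_le {H : ℕ} {V : ℕ → ℂ} {C : ℝ} (hV : ∀ n, ‖V n‖ ≤ C) (n : ℕ) :
    ‖fwdStage H V n‖ ≤ 2 * C := by
  refine (norm_add_le _ _).trans ?_
  rw [norm_mul, norm_mul, norm_one_sub_two_mul_mod, norm_twiddle]
  linarith [hV (n - n / H % 2 * H), hV (n - n / H % 2 * H + H)]

lemma norm_invStage_le {H : ℕ} {V : ℕ → ℂ} {C : ℝ} (hV : ∀ n, ‖V n‖ ≤ C) (n : ℕ) :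
    ‖invStage H V n‖ ≤ 2 * C := by
  have h1 : ‖V (n - n / H % 2 * H) + (1 - 2 * ((n / H % 2 : ℕ) : ℂ)) * V (n - n / H % 2 * H + H)‖
      ≤ 2 * C := by
    refine (norm_add_le _ _).trans ?_
    rw [norm_mul, norm_one_sub_two_mul_mod]
    linarith [hV (n - n / H % 2 * H), hV (n - n / H % 2 * H + H)]
  rw [invStage, norm_mul]
  split_ifs
  · rwa [norm_one, mul_one]
  · rwa [norm_conj, norm_twiddle, mul_one]

lemma norm_fwdAll_le (k : ℕ) : ∀ {V : ℕ → ℂ} {C : ℝ}, (∀ n, ‖V n‖ ≤ C) →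
    ∀ n, ‖fwdAll k V n‖ ≤ 2 ^ k * C := by
  induction k with
  | zero => intro V C hV n; simpa [fwdAll] using hV n
  | succ k ih =>
    intro V C hV n
    refine (ih (norm_fwdStage_le (H := 2 ^ k) hV) n).trans (le_of_eq ?_)
    ring

open Polynomial in
lemma fwdAll_coeff {k : ℕ} (f : ℕ[X]) (hf : f.natDegree < 2 ^ k) {n : ℕ} (hn : n < 2 ^ k) :
    fwdAll k (fun i => (f.coeff i : ℂ)) n = f.eval₂ (Nat.castRingHom ℂ) (node n) := by
  rw [fwdAll_eq_sum, Nat.div_eq_of_lt hn, eval₂_eq_sum_range' _ hf]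
  simp

open Polynomial in
/-- The transform of a product. -/
lemma fwdAll_coeff_mul {k : ℕ} (f g : ℕ[X]) (hfg : f.natDegree + g.natDegree < 2 ^ k) {n : ℕ}
    (hn : n < 2 ^ k) : fwdAll k (fun i => ((f * g).coeff i : ℂ)) n
      = fwdAll k (fun i => (f.coeff i : ℂ)) n * fwdAll k (fun i => (g.coeff i : ℂ)) n := by
  rw [fwdAll_coeff _ (natDegree_mul_le.trans_lt hfg) hn, fwdAll_coeff f (by omega) hn,
    fwdAll_coeff g (by omega) hn, eval₂_mul]

end Fourier

/-! ### Fixed-point complex numbers -/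

section FixedPoint

open Complex

/-- The words `x`, `y`, read modulo `2 * D ^ 3`, represent `z` with precision `1 / D` and absolute
error `E` in the units of the representation. -/
def FixRep (D : ℕ) (E : ℝ) (x y : ℕ) (z : ℂ) : Prop :=
  ∃ a b : ℤ, (x : ZMod (2 * D ^ 3)) = a ∧ (y : ZMod (2 * D ^ 3)) = b ∧
    ‖((a : ℂ) + b * I) - D * z‖ ≤ E

variable {D : ℕ} {E E₁ E₂ : ℝ} {x y x₁ y₁ x₂ y₂ : ℕ} {z z₁ z₂ : ℂ}

lemma FixRep.mono (h : FixRep D E₁ x y z) (hE : E₁ ≤ E₂) : FixRep D E₂ x y z :=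
  let ⟨a, b, h1, h2, h3⟩ := h
  ⟨a, b, h1, h2, h3.trans hE⟩

lemma FixRep.congr (h : FixRep D E x₁ y₁ z) (hx : (x : ZMod (2 * D ^ 3)) = x₁)
    (hy : (y : ZMod (2 * D ^ 3)) = y₁) : FixRep D E x y z :=
  let ⟨a, b, h1, h2, h3⟩ := h
  ⟨a, b, hx.trans h1, hy.trans h2, h3⟩

lemma FixRep.add (h₁ : FixRep D E₁ x₁ y₁ z₁) (h₂ : FixRep D E₂ x₂ y₂ z₂)
    (hx : (x : ZMod (2 * D ^ 3)) = x₁ + x₂) (hy : (y : ZMod (2 * D ^ 3)) = y₁ + y₂) :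
    FixRep D (E₁ + E₂) x y (z₁ + z₂) := by
  obtain ⟨a, b, h1, h2, h3⟩ := h₁
  obtain ⟨c, d, h4, h5, h6⟩ := h₂
  refine ⟨a + c, b + d, by rw [hx, h1, h4]; push_cast; rfl, by rw [hy, h2, h5]; push_cast; rfl, ?_⟩
  refine le_trans (le_of_eq ?_) ((norm_add_le _ _).trans (add_le_add h3 h6))
  congr 1
  push_cast
  ring

lemma FixRep.neg (h : FixRep D E x₁ y₁ z) (hx : (x : ZMod (2 * D ^ 3)) = -x₁)
    (hy : (y : ZMod (2 * D ^ 3)) = -y₁) : FixRep D E x y (-z) := by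
  obtain ⟨a, b, h1, h2, h3⟩ := h
  refine ⟨-a, -b, by rw [hx, h1]; push_cast; rfl, by rw [hy, h2]; push_cast; rfl, ?_⟩
  rw [← norm_neg]
  refine le_trans (le_of_eq ?_) h3
  congr 1
  push_cast
  ring

lemma FixRep.conj (h : FixRep D E x₁ y₁ z) (hx : (x : ZMod (2 * D ^ 3)) = x₁)
    (hy : (y : ZMod (2 * D ^ 3)) = -y₁) : FixRep D E x y ((starRingEnd ℂ) z) := by
  obtain ⟨a, b, h1, h2, h3⟩ := h
  refine ⟨a, -b, by rw [hx, h1], by rw [hy, h2]; push_cast; rfl, ?_⟩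
  refine le_trans (le_of_eq ?_) h3
  rw [← Complex.norm_conj]
  congr 1
  simp

/-- The rounded quotient by `D` of a signed number represented modulo `2 * D ^ 3`. -/
def roundQuot (D x : ℕ) : ℕ := (x + D ^ 3) % (2 * D ^ 3) / D + (2 * D ^ 3 - D ^ 2)

lemma shift_mod_eq {M H x : ℕ} {a : ℤ} (hx : (x : ZMod M) = a) (h1 : 0 ≤ a + H)
    (h2 : a + H < M) : (((x + H) % M : ℕ) : ℤ) = a + H := by
  have h3 : (((x + H : ℕ) : ℤ) : ZMod M) = ((a + H : ℤ) : ZMod M) := by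
    push_cast
    rw [hx]
  rw [ZMod.intCast_eq_intCast_iff] at h3
  push_cast at h3 ⊢
  rw [h3, Int.emod_eq_of_lt h1 h2]

/-- The shift by `D ^ 3` makes the signed number non-negative without wrapping around. After the
division it has become `D ^ 2`, which is removed by adding `2 * D ^ 3 - D ^ 2`, so that no negative
number occurs. -/
lemma cast_roundQuot (hD : 0 < D) {a : ℤ} (hx : (x : ZMod (2 * D ^ 3)) = a)
    (h1 : -(D : ℤ) ^ 3 ≤ a) (h2 : a < (D : ℤ) ^ 3) :
    ((roundQuot D x : ℕ) : ZMod (2 * D ^ 3)) = ((a / D : ℤ) : ZMod (2 * D ^ 3)) := by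
  have h3 := shift_mod_eq (H := D ^ 3) hx (by push_cast; linarith) (by push_cast; linarith)
  have hle : D ^ 2 ≤ 2 * D ^ 3 := by
    have : D ^ 2 * 1 ≤ D ^ 2 * D := Nat.mul_le_mul_left _ hD
    have : D ^ 3 = D ^ 2 * D := by ring
    omega
  have h4 : ((roundQuot D x : ℕ) : ℤ) = a / D + ((2 * D ^ 3 : ℕ) : ℤ) := by
    rw [roundQuot, Nat.cast_add, Int.natCast_div, h3, Nat.cast_sub hle]
    push_cast
    rw [show a + (D : ℤ) ^ 3 = a + D ^ 2 * D by ring, Int.add_mul_ediv_right _ _ (by positivity)]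
    ring
  have h5 : ((roundQuot D x : ℕ) : ZMod (2 * D ^ 3))
      = (((roundQuot D x : ℕ) : ℤ) : ZMod (2 * D ^ 3)) := by push_cast; rfl
  rw [h5, h4, Int.cast_add, Int.cast_natCast, ZMod.natCast_self, add_zero]

lemma norm_floor_sub_le (hD : 0 < D) (a b : ℤ) :
    ‖(((a / D : ℤ) : ℂ) + ((b / D : ℤ) : ℂ) * I) - ((a : ℂ) + b * I) / D‖ ≤ 2 := by
  have key : ∀ c : ℤ, ‖((c / D : ℤ) : ℂ) - (c : ℂ) / D‖ ≤ 1 := by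
    intro c
    have h0 : (0 : ℝ) < D := by exact_mod_cast hD
    have h1 : ((c / D : ℤ) : ℝ) * D + ((c % D : ℤ) : ℝ) = c := by
      exact_mod_cast Int.ediv_mul_add_emod c D
    have h2 : (0 : ℝ) ≤ ((c % D : ℤ) : ℝ) := by exact_mod_cast Int.emod_nonneg c (by omega)
    have h3 : ((c % D : ℤ) : ℝ) < D := by exact_mod_cast Int.emod_lt_of_pos c (by omega)
    have h4 : ((c / D : ℤ) : ℂ) - (c : ℂ) / D = ((((c / D : ℤ) : ℝ) - (c : ℝ) / D : ℝ) : ℂ) := by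
      push_cast; rfl
    rw [h4, Complex.norm_real, Real.norm_eq_abs, abs_le]
    have h5 : ((c / D : ℤ) : ℝ) - (c : ℝ) / D = -(((c % D : ℤ) : ℝ) / D) := by
      rw [← h1]
      field_simp
      ring
    rw [h5]
    have h6 : ((c % D : ℤ) : ℝ) / D ≤ 1 := (div_le_one h0).2 h3.le
    have h7 : 0 ≤ ((c % D : ℤ) : ℝ) / D := by positivity
    constructor <;> linarith
  have : (((a / D : ℤ) : ℂ) + ((b / D : ℤ) : ℂ) * I) - ((a : ℂ) + b * I) / D
      = (((a / D : ℤ) : ℂ) - (a : ℂ) / D) + (((b / D : ℤ) : ℂ) - (b : ℂ) / D) * I := by ring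
  rw [this]
  refine (norm_add_le _ _).trans ?_
  rw [norm_mul, norm_I, mul_one]
  linarith [key a, key b]

/-- The rounded product of fixed-point numbers. -/
lemma FixRep.mul (hD : 0 < D) (h₁ : FixRep D E₁ x₁ y₁ z₁) (h₂ : FixRep D E₂ x₂ y₂ z₂) {C₁ C₂ : ℝ}
    (hz₁ : ‖z₁‖ ≤ C₁) (hz₂ : ‖z₂‖ ≤ C₂)
    (hrange : (D * C₁ + E₁) * (D * C₂ + E₂) < (D : ℝ) ^ 3) {p q : ℕ}
    (hp : (p : ZMod (2 * D ^ 3)) = x₁ * x₂ - y₁ * y₂)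
    (hq : (q : ZMod (2 * D ^ 3)) = x₁ * y₂ + y₁ * x₂)
    (hx : (x : ZMod (2 * D ^ 3)) = (roundQuot D p : ℕ))
    (hy : (y : ZMod (2 * D ^ 3)) = (roundQuot D q : ℕ)) :
    FixRep D (E₁ * (C₂ + E₂ / D) + C₁ * E₂ + 2) x y (z₁ * z₂) := by
  have hD0 : (0 : ℝ) < D := by exact_mod_cast hD
  obtain ⟨a, b, h1, h2, h3⟩ := h₁
  obtain ⟨c, d, h4, h5, h6⟩ := h₂
  have hE₁ : 0 ≤ E₁ := (norm_nonneg _).trans h3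
  have hE₂ : 0 ≤ E₂ := (norm_nonneg _).trans h6
  have hC₁ : 0 ≤ C₁ := (norm_nonneg _).trans hz₁
  have hC₂ : 0 ≤ C₂ := (norm_nonneg _).trans hz₂
  have hn₁ : ‖(a : ℂ) + b * I‖ ≤ D * C₁ + E₁ := by
    have : (a : ℂ) + b * I = D * z₁ + (((a : ℂ) + b * I) - D * z₁) := by ring
    rw [this]
    refine (norm_add_le _ _).trans (add_le_add ?_ h3)
    rw [norm_mul, Complex.norm_natCast]
    gcongr
  have hn₂ : ‖(c : ℂ) + d * I‖ ≤ D * C₂ + E₂ := by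
    have : (c : ℂ) + d * I = D * z₂ + (((c : ℂ) + d * I) - D * z₂) := by ring
    rw [this]
    refine (norm_add_le _ _).trans (add_le_add ?_ h6)
    rw [norm_mul, Complex.norm_natCast]
    gcongr
  have hprod : ((a * c - b * d : ℤ) : ℂ) + ((a * d + b * c : ℤ) : ℂ) * I
      = ((a : ℂ) + b * I) * ((c : ℂ) + d * I) := by
    push_cast
    linear_combination -(b : ℂ) * d * I_sq
  -- The range hypothesis places the product before rounding in the interval where a residue modulo
  -- `2 * D ^ 3` determines the signed integer.
  have hn : ‖((a * c - b * d : ℤ) : ℂ) + ((a * d + b * c : ℤ) : ℂ) * I‖ < (D : ℝ) ^ 3 := by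
    rw [hprod, norm_mul]
    refine lt_of_le_of_lt ?_ hrange
    gcongr
  have hre : |((a * c - b * d : ℤ) : ℝ)| < (D : ℝ) ^ 3 := by
    refine lt_of_le_of_lt ?_ hn
    refine le_trans (le_of_eq ?_) (abs_re_le_norm _)
    simp
  have him : |((a * d + b * c : ℤ) : ℝ)| < (D : ℝ) ^ 3 := by
    refine lt_of_le_of_lt ?_ hn
    refine le_trans (le_of_eq ?_) (abs_im_le_norm _)
    simp
  rw [abs_lt] at hre him
  refine ⟨(a * c - b * d) / D, (a * d + b * c) / D, ?_, ?_, ?_⟩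
  · rw [hx]
    refine cast_roundQuot hD ?_ ?_ ?_
    · rw [hp, h1, h2, h4, h5]; push_cast; rfl
    · exact_mod_cast hre.1.le
    · exact_mod_cast hre.2
  · rw [hy]
    refine cast_roundQuot hD ?_ ?_ ?_
    · rw [hq, h1, h2, h4, h5]; push_cast; rfl
    · exact_mod_cast him.1.le
    · exact_mod_cast him.2
  · have hfl := norm_floor_sub_le hD (a * c - b * d) (a * d + b * c)
    rw [hprod] at hfl
    have hDC : (D : ℂ) ≠ 0 := by exact_mod_cast hD.ne'
    -- The first error meets the approximate second factor and the second error the exact first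
    -- factor; hence the asymmetric bound.
    have hsplit : ((a : ℂ) + b * I) * ((c : ℂ) + d * I) / D - D * (z₁ * z₂)
        = (((a : ℂ) + b * I) - D * z₁) * (((c : ℂ) + d * I) / D)
          + z₁ * (((c : ℂ) + d * I) - D * z₂) := by
      field_simp
      ring
    have hn2 : ‖((a : ℂ) + b * I) * ((c : ℂ) + d * I) / D - D * (z₁ * z₂)‖
        ≤ E₁ * (C₂ + E₂ / D) + C₁ * E₂ := by
      rw [hsplit]
      refine (norm_add_le _ _).trans (add_le_add ?_ ?_)
      · rw [norm_mul, norm_div, Complex.norm_natCast]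
        refine mul_le_mul h3 ?_ (by positivity) hE₁
        rw [div_le_iff₀ hD0, add_mul, div_mul_cancel₀ _ hD0.ne', mul_comm C₂]
        exact hn₂
      · rw [norm_mul]
        gcongr
    calc _ = ‖((((a * c - b * d) / D : ℤ) : ℂ) + (((a * d + b * c) / D : ℤ) : ℂ) * I
            - ((a : ℂ) + b * I) * ((c : ℂ) + d * I) / D)
            + (((a : ℂ) + b * I) * ((c : ℂ) + d * I) / D - D * (z₁ * z₂))‖ := by
          congr 1; ring
      _ ≤ 2 + (E₁ * (C₂ + E₂ / D) + C₁ * E₂) := (norm_add_le _ _).trans (add_le_add hfl hn2)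
      _ = _ := by ring

end FixedPoint

/-! ### Fixed-point arithmetic on the word RAM -/

section FixedPointPrograms

open WordExpr Function

/-- The registers `6` to `10` hold the constants of the fixed-point arithmetic. -/
structure FixEnv (w D : ℕ) (s : RamState) : Prop where
  pos : 0 < D
  dvd : 2 * D ^ 3 ∣ 2 ^ w
  lt : 2 * D ^ 3 < 2 ^ w
  r6 : s.reg 6 = D
  r7 : s.reg 7 = 2 * D ^ 3
  r8 : s.reg 8 = D ^ 3
  r9 : s.reg 9 = 2 * D ^ 3 - D ^ 2
  r10 : s.reg 10 = 2 * D ^ 3 - 1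

lemma FixEnv.congr {w D : ℕ} {s s' : RamState} (h : FixEnv w D s)
    (hr : ∀ r, 6 ≤ r → r ≤ 10 → s'.reg r = s.reg r) : FixEnv w D s' :=
  ⟨h.pos, h.dvd, h.lt, by rw [hr _ (by simp) (by simp), h.r6],
    by rw [hr _ (by simp) (by simp), h.r7], by rw [hr _ (by simp) (by simp), h.r8],
    by rw [hr _ (by simp) (by simp), h.r9], by rw [hr _ (by simp) (by simp), h.r10]⟩

/-- The program for the rounded quotient by `D`. -/
def roundQuotE (e : WordExpr) : WordExpr := (e + reg 8) % reg 7 / reg 6 + reg 9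

namespace FixEnv

variable {w D : ℕ} {s : RamState}

/-- Since `2 * D ^ 3` divides `2 ^ w`, truncation to words is invisible modulo `2 * D ^ 3`, and
overflow in sums and products does no harm. -/
lemma cast_mod (h : FixEnv w D s) (x : ℕ) :
    ((x % 2 ^ w : ℕ) : ZMod (2 * D ^ 3)) = x := by
  rw [ZMod.natCast_eq_natCast_iff', Nat.mod_mod_of_dvd _ h.dvd]

lemma cast_add (h : FixEnv w D s) (a b : WordExpr) :
    (((a + b).eval w s : ℕ) : ZMod (2 * D ^ 3)) = a.eval w s + b.eval w s := by
  rw [eval_add, h.cast_mod, Nat.cast_add]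

lemma cast_mul (h : FixEnv w D s) (a b : WordExpr) :
    (((a * b).eval w s : ℕ) : ZMod (2 * D ^ 3)) = a.eval w s * b.eval w s := by
  rw [eval_mul, h.cast_mod, Nat.cast_mul]

lemma cast_mod_reg (h : FixEnv w D s) (a : WordExpr) :
    (((a % reg 7).eval w s : ℕ) : ZMod (2 * D ^ 3)) = a.eval w s := by
  rw [eval_mod, h.cast_mod, eval_reg, h.r7, ZMod.natCast_mod]

/-- Machine subtraction is cut off at zero, so negation is multiplication by this representative of
`-1`. -/
lemma cast_neg (h : FixEnv w D s) :
    (((reg 10).eval w s : ℕ) : ZMod (2 * D ^ 3)) = -1 := by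
  have : 1 ≤ 2 * D ^ 3 := Nat.succ_le_of_lt (by have := h.pos; positivity)
  rw [eval_reg, h.r10, Nat.cast_sub this, ZMod.natCast_self]
  simp

lemma cast_roundQuotE (h : FixEnv w D s) (a : WordExpr) :
    (((roundQuotE a).eval w s : ℕ) : ZMod (2 * D ^ 3)) = (roundQuot D (a.eval w s) : ℕ) := by
  have h0 : 0 < 2 * D ^ 3 := by have := h.pos; positivity
  have h1 : (a.eval w s + D ^ 3) % (2 * D ^ 3) < 2 ^ w := (Nat.mod_lt _ h0).trans h.lt
  rw [roundQuotE, h.cast_add, eval_div, eval_mod, eval_add, eval_reg, eval_reg, eval_reg, eval_reg,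
    h.r6, h.r7, h.r8, h.r9, Nat.mod_mod_of_dvd _ h.dvd, Nat.mod_eq_of_lt h1,
    Nat.mod_eq_of_lt ((Nat.div_le_self _ _).trans_lt h1), roundQuot, Nat.cast_add]

end FixEnv

/-- Simultaneous assignment to two arrays. -/
def pairFill (d₁ d₂ rb : ℕ) (e₁ e₂ : WordExpr) : Program :=
  .seq (fill 21 rb e₁) (.seq (fill 22 rb e₂)
    (.seq (fill d₁ rb (cell 21 (reg 20))) (fill d₂ rb (cell 22 (reg 20)))))

/-- The buffers `21` and `22` let both expressions read the old contents of the two arrays; the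
results are copied only after both have been computed. The second expression must not read `21`,
which is already overwritten by then. -/
lemma Runs.pairFill {w : ℕ} {d₁ d₂ rb : ℕ} {e₁ e₂ : WordExpr} {s : RamState} {n : ℕ}
    {Q : RamState → Prop} (hrb : s.reg rb = n) (hrb20 : rb ≠ 20) (hn : n < 2 ^ w)
    (hd : d₁ ≠ d₂) (h1 : d₁ ∉ [21, 22]) (h2 : d₂ ∉ [21, 22]) (h21 : 21 ∉ e₁.arrs)
    (h21' : 21 ∉ e₂.arrs) (h22 : 22 ∉ e₂.arrs)
    (hQ : ∀ s', s'.reg = update s.reg 20 n → (∀ a ∉ [21, 22, d₁, d₂], s'.mem a = s.mem a) →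
      (∀ i < n, s'.mem d₁ i = e₁.eval w ⟨update s.reg 20 i, s.mem⟩) →
      (∀ i < n, s'.mem d₂ i = e₂.eval w ⟨update s.reg 20 i, s.mem⟩) → Q s') :
    Runs w (pairFill d₁ d₂ rb e₁ e₂) s (n * (e₁.cost + e₂.cost + 52) + 43) Q := by
  simp only [List.mem_cons, List.not_mem_nil, or_false, not_or] at h1 h2
  refine Runs.budget (Runs.seq (Runs.fill hrb hrb20 hn h21 fun s₁ r₁ m₁ v₁ _ =>
    Runs.seq (Runs.fill (n := n) (by rw [r₁, update_of_ne hrb20, hrb]) hrb20 hn h22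
      fun s₂ r₂ m₂ v₂ _ => Runs.seq (Runs.fill (n := n)
        (by rw [r₂, update_of_ne hrb20, r₁, update_of_ne hrb20, hrb]) hrb20 hn
        (by simpa [arrs] using h1.1) fun s₃ r₃ m₃ v₃ _ => Runs.fill (n := n)
          (by rw [r₃, update_of_ne hrb20, r₂, update_of_ne hrb20, r₁, update_of_ne hrb20, hrb])
          hrb20 hn (by simpa [arrs] using h2.2) fun s₄ r₄ m₄ v₄ _ => hQ s₄ ?_ ?_ ?_ ?_)))) ?_
  · rw [r₄, r₃, r₂, r₁]
    simp only [update_idem]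
  · intro a ha
    simp only [List.mem_cons, List.not_mem_nil, or_false, not_or] at ha
    rw [m₄ a ha.2.2.2, m₃ a ha.2.2.1, m₂ a ha.2.1, m₁ a ha.1]
  · intro i hi
    rw [m₄ d₁ hd, v₃ i hi]
    simp only [eval_cell, eval_reg, update_self]
    rw [m₂ 21 (by decide), v₁ i hi]
  · intro i hi
    rw [v₄ i hi]
    simp only [eval_cell, eval_reg, update_self]
    rw [m₃ 22 (Ne.symm h1.2), v₂ i hi]
    refine eval_congr (by simp only [r₁, update_idem]) _ fun a ha => m₁ a ?_
    rintro rfl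
    exact h21' ha
  · simp only [WordExpr.cost]
    ring_nf
    omega

/-! ### One stage of the transforms -/

/-- The position inside its butterfly of the cell that is being computed. -/
def parE : WordExpr := reg 20 / reg 13 % const 2
/-- The first index of the butterfly. -/
def fstE : WordExpr := reg 20 - parE * reg 13
/-- The second index of the butterfly. -/
def sndE : WordExpr := fstE + reg 13
/-- The index of the twiddle factor of the butterfly. -/
def blockE : WordExpr := reg 20 / reg 13 / const 2
/-- The sign of the second term of the butterfly. -/
def signE : WordExpr := const 1 + parE * (reg 10 + reg 10)

/-- The result of a forward butterfly, real part. -/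
def fwdReE (re im : ℕ) : WordExpr :=
  (cell re fstE + signE * roundQuotE (cell 11 blockE * cell re sndE
    + reg 10 * (cell 12 blockE * cell im sndE))) % reg 7
/-- The result of a forward butterfly, imaginary part. -/
def fwdImE (re im : ℕ) : WordExpr :=
  (cell im fstE + signE * roundQuotE (cell 11 blockE * cell im sndE
    + cell 12 blockE * cell re sndE)) % reg 7

/-- The factor of an inverse butterfly, real part. -/
def facReE : WordExpr := (const 1 - parE) * reg 6 + parE * cell 11 blockE
/-- The factor of an inverse butterfly, imaginary part. -/
def facImE : WordExpr := reg 10 * (parE * cell 12 blockE)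
/-- The combination of an inverse butterfly. -/
def combE (a : ℕ) : WordExpr := cell a fstE + signE * cell a sndE
/-- The result of an inverse butterfly, real part. -/
def invReE (re im : ℕ) : WordExpr :=
  roundQuotE (combE re * facReE + reg 10 * (combE im * facImE)) % reg 7
/-- The result of an inverse butterfly, imaginary part. -/
def invImE (re im : ℕ) : WordExpr :=
  roundQuotE (combE re * facImE + combE im * facReE) % reg 7

/-- The arrays `re`, `im` represent the first `N` values of `V`. -/
def RepArr (D : ℕ) (E : ℝ) (N : ℕ) (re im : ℕ → ℕ) (V : ℕ → ℂ) : Prop :=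
  ∀ n < N, FixRep D E (re n) (im n) (V n)

lemma butterfly_snd_lt {N H i : ℕ} (hH : 0 < H) (hN : 2 * H ∣ N) (hi : i < N) :
    i - i / H % 2 * H + H < N := by
  obtain ⟨q, rfl⟩ := hN
  have h1 : i / H / 2 < q := by
    rw [Nat.div_div_eq_div_mul, Nat.div_lt_iff_lt_mul (by positivity)]
    linarith
  have h2 := Nat.div_add_mod i H
  have h3 := Nat.mod_lt i hH
  have h4 : i = 2 * H * (i / H / 2) + i / H % 2 * H + i % H := by
    conv_lhs => rw [← h2, ← Nat.div_add_mod (i / H) 2]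
    ring
  have h5 : 2 * H * (i / H / 2 + 1) ≤ 2 * H * q := Nat.mul_le_mul_left _ h1
  have h6 : 2 * H * (i / H / 2 + 1) = 2 * H * (i / H / 2) + 2 * H := by ring
  omega

lemma butterfly_block_lt {N H i : ℕ} (hH : 0 < H) (hN : 2 * H ∣ N) (hi : i < N) :
    i / H / 2 < N / 2 := by
  obtain ⟨q, rfl⟩ := hN
  have h1 : i / H / 2 < q := by
    rw [Nat.div_div_eq_div_mul, Nat.div_lt_iff_lt_mul (by positivity)]
    linarith
  have h2 : 2 * H * q / 2 = H * q := by
    rw [mul_assoc, Nat.mul_div_cancel_left _ two_pos]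
  have h3 : 1 * q ≤ H * q := Nat.mul_le_mul_right _ hH
  omega

section Stage

variable {w D N H i re im : ℕ} {s : RamState} {V : ℕ → ℂ} {E δ C : ℝ}

lemma eval_parE (h20 : s.reg 20 = i) (h13 : s.reg 13 = H) (hN : N < 2 ^ w) (hi : i < N)
    (hN2 : 2 ≤ N) : parE.eval w s = i / H % 2 := by
  have h2 := Nat.div_le_self i H
  have h3 : 2 < 2 ^ w := by omega
  simp only [parE, eval_mod, eval_div, eval_reg, eval_const, h20, h13]
  rw [Nat.mod_eq_of_lt h3, Nat.mod_eq_of_lt (a := i / H) (by omega), Nat.mod_eq_of_lt (by omega)]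

lemma eval_blockE (h20 : s.reg 20 = i) (h13 : s.reg 13 = H) (hN : N < 2 ^ w) (hi : i < N)
    (hN2 : 2 ≤ N) : blockE.eval w s = i / H / 2 := by
  have h2 := Nat.div_le_self i H
  have h3 : 2 < 2 ^ w := by omega
  simp only [blockE, eval_div, eval_reg, eval_const, h20, h13]
  rw [Nat.mod_eq_of_lt h3, Nat.mod_eq_of_lt (a := i / H) (by omega), Nat.mod_eq_of_lt (by omega)]

lemma eval_fstE (h20 : s.reg 20 = i) (h13 : s.reg 13 = H) (hN : N < 2 ^ w) (hi : i < N)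
    (hN2 : 2 ≤ N) : fstE.eval w s = i - i / H % 2 * H := by
  have h1 : i / H % 2 * H ≤ i :=
    (Nat.mul_le_mul_right _ (Nat.mod_le _ _)).trans (Nat.div_mul_le_self i H)
  rw [fstE, eval_sub, eval_mul, eval_parE h20 h13 hN hi hN2, eval_reg, eval_reg, h20, h13,
    Nat.mod_eq_of_lt (a := i / H % 2 * H) (by omega), Nat.mod_eq_of_lt (by omega)]

lemma eval_sndE (h20 : s.reg 20 = i) (h13 : s.reg 13 = H) (hN : N < 2 ^ w) (hi : i < N)
    (hN2 : 2 ≤ N) (hH : 0 < H) (hdvd : 2 * H ∣ N) :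
    sndE.eval w s = i - i / H % 2 * H + H := by
  have h1 := butterfly_snd_lt hH hdvd hi
  rw [sndE, eval_add, eval_fstE h20 h13 hN hi hN2, eval_reg, h13, Nat.mod_eq_of_lt (by omega)]

lemma FixEnv.cast_signE (hs : FixEnv w D s) (h20 : s.reg 20 = i) (h13 : s.reg 13 = H)
    (hN : N < 2 ^ w) (hi : i < N) (hN2 : 2 ≤ N) :
    ((signE.eval w s : ℕ) : ZMod (2 * D ^ 3)) = 1 - 2 * (i / H % 2 : ℕ) := by
  rw [signE, hs.cast_add, hs.cast_mul, hs.cast_add, hs.cast_neg, eval_parE h20 h13 hN hi hN2,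
    eval_const, hs.cast_mod]
  push_cast
  ring

/-- The new error is that of the first entry plus that of the rounded product of the second entry
with a twiddle factor of norm 1. A minus sign does not change it. -/
lemma fixRep_fwdStage (hs : FixEnv w D s) (h20 : s.reg 20 = i) (h13 : s.reg 13 = H)
    (hN : N < 2 ^ w) (hi : i < N) (hH : 0 < H) (hdvd : 2 * H ∣ N)
    (htw : ∀ B < N / 2, FixRep D δ (s.mem 11 B) (s.mem 12 B) (twiddle B))
    (hV : RepArr D E N (s.mem re) (s.mem im) V) (hC : ∀ n, ‖V n‖ ≤ C)
    (hrange : (D * 1 + δ) * (D * C + E) < (D : ℝ) ^ 3) :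
    FixRep D (E + (δ * (C + E / D) + 1 * E + 2)) ((fwdReE re im).eval w s)
      ((fwdImE re im).eval w s) (fwdStage H V i) := by
  have hN2 : 2 ≤ N := (by omega : 2 ≤ 2 * H).trans (Nat.le_of_dvd (by omega) hdvd)
  have hv := butterfly_snd_lt hH hdvd hi
  have hu : i - i / H % 2 * H < N := by omega
  have hmul := (htw _ (butterfly_block_lt hH hdvd hi)).mul hs.pos (hV _ hv)
    (norm_twiddle _).le (hC _) hrange
    (p := (cell 11 blockE * cell re sndE + reg 10 * (cell 12 blockE * cell im sndE)).eval w s)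
    (q := (cell 11 blockE * cell im sndE + cell 12 blockE * cell re sndE).eval w s)
    (by
      rw [hs.cast_add, hs.cast_mul, hs.cast_mul, hs.cast_mul, hs.cast_neg]
      simp only [eval_cell, eval_blockE h20 h13 hN hi hN2, eval_sndE h20 h13 hN hi hN2 hH hdvd]
      ring)
    (by
      rw [hs.cast_add, hs.cast_mul, hs.cast_mul]
      simp only [eval_cell, eval_blockE h20 h13 hN hi hN2, eval_sndE h20 h13 hN hi hN2 hH hdvd])
    (hs.cast_roundQuotE _) (hs.cast_roundQuotE _)
  have hre : (((fwdReE re im).eval w s : ℕ) : ZMod (2 * D ^ 3))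
      = s.mem re (i - i / H % 2 * H) + (1 - 2 * (i / H % 2 : ℕ)) *
        ((roundQuotE (cell 11 blockE * cell re sndE
          + reg 10 * (cell 12 blockE * cell im sndE))).eval w s : ℕ) := by
    rw [fwdReE, hs.cast_mod_reg, hs.cast_add, hs.cast_mul, hs.cast_signE h20 h13 hN hi hN2,
      eval_cell, eval_fstE h20 h13 hN hi hN2]
  have him : (((fwdImE re im).eval w s : ℕ) : ZMod (2 * D ^ 3))
      = s.mem im (i - i / H % 2 * H) + (1 - 2 * (i / H % 2 : ℕ)) *
        ((roundQuotE (cell 11 blockE * cell im sndE + cell 12 blockE * cell re sndE)).eval w s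
          : ℕ) := by
    rw [fwdImE, hs.cast_mod_reg, hs.cast_add, hs.cast_mul, hs.cast_signE h20 h13 hN hi hN2,
      eval_cell, eval_fstE h20 h13 hN hi hN2]
  rw [fwdStage]
  rcases Nat.mod_two_eq_zero_or_one (i / H) with h | h
  · rw [h] at hu hmul
    simp only [h] at hre him ⊢
    have := (hV _ hu).add hmul (by rw [hre]; push_cast; ring) (by rw [him]; push_cast; ring)
    simpa using this
  · rw [h] at hu hmul
    simp only [h] at hre him ⊢
    have := (hV _ hu).add ((hmul.neg (x := ((reg 10 * roundQuotE (cell 11 blockE * cell re sndE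
      + reg 10 * (cell 12 blockE * cell im sndE))).eval w s))
      (y := ((reg 10 * roundQuotE (cell 11 blockE * cell im sndE
      + cell 12 blockE * cell re sndE)).eval w s))
      (by rw [hs.cast_mul, hs.cast_neg]; ring) (by rw [hs.cast_mul, hs.cast_neg]; ring)))
      (x := (fwdReE re im).eval w s) (y := (fwdImE re im).eval w s)
      (by rw [hre, hs.cast_mul, hs.cast_neg]; push_cast; ring)
      (by rw [him, hs.cast_mul, hs.cast_neg]; push_cast; ring)
    convert this using 1
    push_cast
    ring

lemma fixRep_invStage (hs : FixEnv w D s) (h20 : s.reg 20 = i) (h13 : s.reg 13 = H)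
    (hN : N < 2 ^ w) (hi : i < N) (hH : 0 < H) (hdvd : 2 * H ∣ N) (hδ : 0 ≤ δ)
    (htw : ∀ B < N / 2, FixRep D δ (s.mem 11 B) (s.mem 12 B) (twiddle B))
    (hV : RepArr D E N (s.mem re) (s.mem im) V) (hC : ∀ n, ‖V n‖ ≤ C)
    (hrange : (D * (C + C) + (E + E)) * (D * 1 + δ) < (D : ℝ) ^ 3) :
    FixRep D ((E + E) * (1 + δ / D) + (C + C) * δ + 2) ((invReE re im).eval w s)
      ((invImE re im).eval w s) (invStage H V i) := by
  have hN2 : 2 ≤ N := (by omega : 2 ≤ 2 * H).trans (Nat.le_of_dvd (by omega) hdvd)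
  have hv := butterfly_snd_lt hH hdvd hi
  have hu : i - i / H % 2 * H < N := by omega
  have hcomb : ∀ a, (((combE a).eval w s : ℕ) : ZMod (2 * D ^ 3)) =
      s.mem a (i - i / H % 2 * H) + (1 - 2 * (i / H % 2 : ℕ)) * s.mem a (i - i / H % 2 * H + H) := by
    intro a
    rw [combE, hs.cast_add, hs.cast_mul, hs.cast_signE h20 h13 hN hi hN2, eval_cell, eval_cell,
      eval_fstE h20 h13 hN hi hN2, eval_sndE h20 h13 hN hi hN2 hH hdvd]
  have h1w : 1 < 2 ^ w := by omega
  have hcomp : (((const 1 - parE).eval w s : ℕ) : ZMod (2 * D ^ 3)) = 1 - (i / H % 2 : ℕ) := by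
    have : i / H % 2 ≤ 1 := by omega
    rw [eval_sub, eval_parE h20 h13 hN hi hN2, eval_const, Nat.mod_eq_of_lt h1w, hs.cast_mod,
      Nat.cast_sub this, Nat.cast_one]
  have hfr : ((facReE.eval w s : ℕ) : ZMod (2 * D ^ 3)) = (1 - (i / H % 2 : ℕ)) * D
      + (i / H % 2 : ℕ) * s.mem 11 (i / H / 2) := by
    rw [facReE, hs.cast_add, hs.cast_mul, hs.cast_mul, hcomp, eval_parE h20 h13 hN hi hN2,
      eval_reg, hs.r6, eval_cell, eval_blockE h20 h13 hN hi hN2]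
  have hfi : ((facImE.eval w s : ℕ) : ZMod (2 * D ^ 3))
      = -((i / H % 2 : ℕ) * s.mem 12 (i / H / 2)) := by
    rw [facImE, hs.cast_mul, hs.cast_mul, hs.cast_neg, eval_parE h20 h13 hN hi hN2, eval_cell,
      eval_blockE h20 h13 hN hi hN2]
    ring
  have hA : FixRep D (E + E) ((combE re).eval w s) ((combE im).eval w s)
      (V (i - i / H % 2 * H) + (1 - 2 * (i / H % 2 : ℕ)) * V (i - i / H % 2 * H + H)) := by
    have hre := hcomb re
    have him := hcomb im
    rcases Nat.mod_two_eq_zero_or_one (i / H) with h | h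
    · rw [h] at hu hv
      simp only [h] at hre him ⊢
      have := (hV _ hu).add (hV _ hv) (by rw [hre]; push_cast; ring) (by rw [him]; push_cast; ring)
      simpa using this
    · rw [h] at hu hv
      simp only [h] at hre him ⊢
      have := (hV _ hu).add ((hV _ hv).neg
        (x := ((reg 10 * cell re sndE).eval w s)) (y := ((reg 10 * cell im sndE).eval w s))
        (by
          rw [hs.cast_mul, hs.cast_neg, eval_cell, eval_sndE h20 h13 hN hi hN2 hH hdvd, h]; ring)
        (by
          rw [hs.cast_mul, hs.cast_neg, eval_cell, eval_sndE h20 h13 hN hi hN2 hH hdvd, h]; ring))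
        (x := (combE re).eval w s) (y := (combE im).eval w s)
        (by
          rw [hre, hs.cast_mul, hs.cast_neg, eval_cell, eval_sndE h20 h13 hN hi hN2 hH hdvd, h]
          push_cast; ring)
        (by
          rw [him, hs.cast_mul, hs.cast_neg, eval_cell, eval_sndE h20 h13 hN hi hN2 hH hdvd, h]
          push_cast; ring)
      convert this using 1
      push_cast
      ring
  -- In the first half of a block the factor is 1, which `D` represents exactly; in the second half
  -- it is a conjugated table entry with error `δ`.
  have hB : FixRep D δ (facReE.eval w s) (facImE.eval w s)
      (if i / H % 2 = 0 then 1 else (starRingEnd ℂ) (twiddle (i / H / 2))) := by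
    rcases Nat.mod_two_eq_zero_or_one (i / H) with h | h
    · simp only [h] at hfr hfi ⊢
      refine ⟨D, 0, by rw [hfr]; push_cast; ring, by rw [hfi]; push_cast; ring, ?_⟩
      simpa using hδ
    · simp only [h] at hfr hfi ⊢
      exact (htw _ (butterfly_block_lt hH hdvd hi)).conj (by rw [hfr]; push_cast; ring)
        (by rw [hfi]; push_cast; ring)
  have hAn : ‖V (i - i / H % 2 * H) + (1 - 2 * ((i / H % 2 : ℕ) : ℂ)) * V (i - i / H % 2 * H + H)‖
      ≤ C + C := by
    refine (norm_add_le _ _).trans ?_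
    rw [norm_mul, norm_one_sub_two_mul_mod, one_mul]
    exact add_le_add (hC _) (hC _)
  have hBn : ‖(if i / H % 2 = 0 then (1 : ℂ) else (starRingEnd ℂ) (twiddle (i / H / 2)))‖ ≤ 1 := by
    split_ifs
    · simp
    · rw [Complex.norm_conj, norm_twiddle]
  exact hA.mul hs.pos hB hAn hBn hrange
    (p := (combE re * facReE + reg 10 * (combE im * facImE)).eval w s)
    (q := (combE re * facImE + combE im * facReE).eval w s)
    (by rw [hs.cast_add, hs.cast_mul, hs.cast_mul, hs.cast_mul, hs.cast_neg]; ring)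
    (by rw [hs.cast_add, hs.cast_mul, hs.cast_mul])
    (by rw [invReE, hs.cast_mod_reg, hs.cast_roundQuotE])
    (by rw [invImE, hs.cast_mod_reg, hs.cast_roundQuotE])

end Stage

end FixedPointPrograms

/-! ### The transforms as programs, with their error growth -/

section Transform

open WordExpr Function Finset

/-- Fixed-point arithmetic together with a table of the first `K` twiddle factors. -/
structure FFTEnv (w D K : ℕ) (δ : ℝ) (s : RamState) : Prop extends FixEnv w D s where
  tw : ∀ B < K, FixRep D δ (s.mem 11 B) (s.mem 12 B) (twiddle B)

lemma FFTEnv.congr {w D K : ℕ} {δ : ℝ} {s s' : RamState} (h : FFTEnv w D K δ s)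
    (hr : ∀ r, 6 ≤ r → r ≤ 10 → s'.reg r = s.reg r) (h11 : s'.mem 11 = s.mem 11)
    (h12 : s'.mem 12 = s.mem 12) : FFTEnv w D K δ s' :=
  { h.toFixEnv.congr hr with tw := fun B hB => by rw [h11, h12]; exact h.tw B hB }

lemma FFTEnv.of_frame {w D K : ℕ} {δ : ℝ} {s s' : RamState} {c : Program} (h : FFTEnv w D K δ s)
    (hf : Frame c s s') (hr : ∀ r ∈ [6, 7, 8, 9, 10], r ∉ c.regs) (h11 : 11 ∉ c.arrs)
    (h12 : 12 ∉ c.arrs) : FFTEnv w D K δ s' :=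
  h.congr (fun r h1 h2 => hf.reg r (hr r (by simp; omega))) (hf.mem _ h11) (hf.mem _ h12)

lemma pairFill_regs (d₁ d₂ rb : ℕ) (e₁ e₂ : WordExpr) :
    (pairFill d₁ d₂ rb e₁ e₂).regs = [20, 20, 20, 20, 20, 20, 20, 20] := rfl

lemma pairFill_arrs (d₁ d₂ rb : ℕ) (e₁ e₂ : WordExpr) :
    (pairFill d₁ d₂ rb e₁ e₂).arrs = [21, 22, d₁, d₂] := rfl

/-- A forward stage on the arrays `re`, `im`. -/
def fwdStageP (re im : ℕ) : Program := pairFill re im 12 (fwdReE re im) (fwdImE re im)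

/-- An inverse stage on the arrays `re`, `im`. -/
def invStageP (re im : ℕ) : Program := pairFill re im 12 (invReE re im) (invImE re im)

/-- The arrays `re`, `im` are distinct and are not used for other purposes. -/
def GoodPair (re im : ℕ) : Prop := re ≠ im ∧ re ∉ [11, 12, 21, 22] ∧ im ∉ [11, 12, 21, 22]

variable {w D K N H re im : ℕ} {δ E C : ℝ} {s : RamState} {V : ℕ → ℂ}

lemma GoodPair.pairFill {rb n : ℕ} (hg : GoodPair re im) {e₁ e₂ : WordExpr} {Q : RamState → Prop}
    (hrb : s.reg rb = n) (hrb20 : rb ≠ 20) (hn : n < 2 ^ w) (h₁ : e₁.arrs ⊆ [re, 11, 12, im])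
    (h₂ : e₂.arrs ⊆ [re, 11, 12, im])
    (hQ : ∀ s', (∀ i < n, s'.mem re i = e₁.eval w ⟨update s.reg 20 i, s.mem⟩) →
      (∀ i < n, s'.mem im i = e₂.eval w ⟨update s.reg 20 i, s.mem⟩) → Q s') :
    Runs w (pairFill re im rb e₁ e₂) s (n * (e₁.cost + e₂.cost + 52) + 43) Q := by
  obtain ⟨h1, h2, h3⟩ := hg
  simp only [List.mem_cons, List.not_mem_nil, or_false, not_or] at h2 h3
  have h21 : 21 ∉ [re, 11, 12, im] := by simp; omega
  have h22 : 22 ∉ [re, 11, 12, im] := by simp; omega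
  exact Runs.pairFill hrb hrb20 hn h1 (by simp; omega) (by simp; omega)
    (fun h => h21 (h₁ h)) (fun h => h21 (h₂ h)) (fun h => h22 (h₂ h))
    fun s' _ _ v1 v2 => hQ s' v1 v2

lemma Runs.fwdStageP (hg : GoodPair re im) (hs : FFTEnv w D K δ s) (h12 : s.reg 12 = N)
    (h13 : s.reg 13 = H) (hN : N < 2 ^ w) (hH : 0 < H) (hdvd : 2 * H ∣ N) (hK : N / 2 ≤ K)
    (hV : RepArr D E N (s.mem re) (s.mem im) V) (hC : ∀ n, ‖V n‖ ≤ C)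
    (hrange : (D * 1 + δ) * (D * C + E) < (D : ℝ) ^ 3) :
    Runs w (fwdStageP re im) s (N * 198 + 43) fun s' =>
      RepArr D (E + (δ * (C + E / D) + 1 * E + 2)) N (s'.mem re) (s'.mem im) (fwdStage H V) := by
  have a1 : (fwdReE re im).arrs = [re, 11, re, 12, im] := rfl
  have a2 : (fwdImE re im).arrs = [im, 11, im, 12, re] := rfl
  refine hg.pairFill h12 (by decide) hN (by simp [a1]) (by simp [a2]) fun s' v1 v2 i hi => ?_
  rw [v1 i hi, v2 i hi]
  refine fixRep_fwdStage (s := ⟨update s.reg 20 i, s.mem⟩) ?_ (by simp) (by simp [h13]) hN hi hH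
    hdvd (fun B hB => hs.tw B (hB.trans_le hK)) hV hC hrange
  exact hs.toFixEnv.congr fun r _ h => by simp [show r ≠ 20 by omega]

lemma Runs.invStageP (hg : GoodPair re im) (hs : FFTEnv w D K δ s) (h12 : s.reg 12 = N)
    (h13 : s.reg 13 = H) (hN : N < 2 ^ w) (hH : 0 < H) (hdvd : 2 * H ∣ N) (hK : N / 2 ≤ K)
    (hδ : 0 ≤ δ) (hV : RepArr D E N (s.mem re) (s.mem im) V) (hC : ∀ n, ‖V n‖ ≤ C)
    (hrange : (D * (C + C) + (E + E)) * (D * 1 + δ) < (D : ℝ) ^ 3) :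
    Runs w (invStageP re im) s (N * 292 + 43) fun s' =>
      RepArr D ((E + E) * (1 + δ / D) + (C + C) * δ + 2) N (s'.mem re) (s'.mem im)
        (invStage H V) := by
  have a1 : (invReE re im).arrs = [re, re, 11, im, im, 12] := rfl
  have a2 : (invImE re im).arrs = [re, re, 12, im, im, 11] := rfl
  refine hg.pairFill h12 (by decide) hN (by simp [a1]) (by simp [a2]) fun s' v1 v2 i hi => ?_
  rw [v1 i hi, v2 i hi]
  refine fixRep_invStage (s := ⟨update s.reg 20 i, s.mem⟩) ?_ (by simp) (by simp [h13]) hN hi hH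
    hdvd hδ (fun B hB => hs.tw B (hB.trans_le hK)) hV hC hrange
  exact hs.toFixEnv.congr fun r _ h => by simp [show r ≠ 20 by omega]

/-- The forward transform of the arrays `re`, `im`, of the length in register `12`. -/
def fwdP (re im : ℕ) : Program :=
  .seq (.setReg 13 (reg 12 / const 2))
    (.whileNonzero (reg 13) (.seq (fwdStageP re im) (.setReg 13 (reg 13 / const 2))))

/-- The inverse transform of the arrays `re`, `im`, of the length in register `12`. -/
def invP (re im : ℕ) : Program :=
  .seq (.setReg 13 (const 1))
    (.whileNonzero (less (reg 13) (reg 12))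
      (.seq (invStageP re im) (.setReg 13 (reg 13 + reg 13))))

lemma GoodPair.env_of_frame (hg : GoodPair re im) {c : Program} {s' : RamState}
    (hs : FFTEnv w D K δ s) (hf : Frame c s s') (hr : c.regs ⊆ [13, 20])
    (ha : c.arrs ⊆ [21, 22, re, im]) : FFTEnv w D K δ s' := by
  obtain ⟨h1, h2, h3⟩ := hg
  simp only [List.mem_cons, List.not_mem_nil, or_false, not_or] at h2 h3
  have h11 : 11 ∉ [21, 22, re, im] := by simp; omega
  have h12 : 12 ∉ [21, 22, re, im] := by simp; omega
  refine hs.of_frame hf (fun r h h' => ?_) (fun h => h11 (ha h)) (fun h => h12 (ha h))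
  have := hr h'
  simp at h this
  omega

/-- Each stage at most doubles the values. The condition `hX` absorbs the part of the new error that
comes from twiddle errors and rounding, so a stage multiplies the error by at most 8; over all
stages this is the cube of the length. -/
lemma Runs.fwdP (hg : GoodPair re im) {k : ℕ} {X : ℝ} (hs : FFTEnv w D K δ s)
    (h12 : s.reg 12 = 2 ^ k) (hN : 2 ^ k < 2 ^ w) (hK : 2 ^ k / 2 ≤ K) (hk : 0 < k) (hδ : 0 ≤ δ)
    (hδD : δ ≤ D) (hC0 : 0 ≤ C) (hX : 2 ^ k * C * δ + 2 ≤ X)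
    (hV : RepArr D X (2 ^ k) (s.mem re) (s.mem im) V) (hC : ∀ n, ‖V n‖ ≤ C)
    (hrange : (D * 1 + δ) * (D * (2 ^ k * C) + 8 ^ k * X) < (D : ℝ) ^ 3) :
    Runs w (fwdP re im) s (k * (2 ^ k * 198 + 51) + 7) fun s' =>
      RepArr D (8 ^ k * X) (2 ^ k) (s'.mem re) (s'.mem im) (fwdAll k V) := by
  have hD0 : (0 : ℝ) < D := by exact_mod_cast hs.pos
  have hX0 : 0 ≤ X := le_trans (by positivity) hX
  have h2w : 2 < 2 ^ w := by
    by_cases h : k = 1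
    · subst h
      simpa using hN
    · refine lt_of_le_of_lt ?_ hN
      calc 2 = 2 ^ 1 := rfl
        _ ≤ 2 ^ k := Nat.pow_le_pow_right two_pos hk
  -- Stages run from the largest blocks to the smallest, so the invariant says that the remaining
  -- stages complete the transform. After `k` rounds register `13` is `2 ^ k / 2 ^ (k + 1) = 0`,
  -- which stops the loop.
  let I : ℕ → RamState → Prop := fun i s' => s'.reg 13 = 2 ^ k / 2 ^ (i + 1) ∧
    ∃ V', RepArr D (8 ^ i * X) (2 ^ k) (s'.mem re) (s'.mem im) V' ∧
      (∀ n, ‖V' n‖ ≤ 2 ^ i * C) ∧ fwdAll (k - i) V' = fwdAll k V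
  have hs0 : FFTEnv w D K δ ⟨update s.reg 13 (2 ^ k / 2), s.mem⟩ :=
    hs.congr (fun r _ h => by simp [show r ≠ 13 by omega]) rfl rfl
  refine (Runs.seq (Runs.setReg (2 ^ k / 2) ?_ ((Runs.whileNonzero k
    (fun _ => 2 ^ k * 198 + 48) I ?_ ?_ ?_).mono fun s' _ h => ?_))).budget ?_
  · simp only [eval_div, eval_reg, h12, eval_const, Nat.mod_eq_of_lt h2w]
    exact Nat.mod_eq_of_lt (by omega)
  · exact ⟨by simp, V, by simpa using hV, by simpa using hC, rfl⟩
  · intro i hi s' hf hI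
    obtain ⟨h13, V', hV', hC', he⟩ := hI
    have hs' := hg.env_of_frame hs0 hf (by simp [Program.regs, _root_.fwdStageP, pairFill_regs])
      (by simp [Program.arrs, _root_.fwdStageP, pairFill_arrs])
    have h12' : s'.reg 12 = 2 ^ k := by
      rw [hf.reg 12 (by simp [Program.regs, _root_.fwdStageP, pairFill_regs])]
      simpa using h12
    have hH : 2 ^ k / 2 ^ (i + 1) = 2 ^ (k - (i + 1)) := Nat.pow_div (by omega) two_pos
    rw [hH] at h13
    have hdvd : 2 * 2 ^ (k - (i + 1)) ∣ 2 ^ k := by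
      rw [← pow_succ']
      exact pow_dvd_pow _ (by omega)
    have hpi : (2 : ℝ) ^ i ≤ 2 ^ k := pow_le_pow_right₀ (by norm_num) hi.le
    have hpi' : (8 : ℝ) ^ i ≤ 8 ^ k := pow_le_pow_right₀ (by norm_num) hi.le
    have hlt : 2 ^ (k - (i + 1)) < 2 ^ w :=
      lt_of_le_of_lt (Nat.pow_le_pow_right two_pos (by omega)) hN
    refine ⟨by simp [h13], (Runs.seq ((Runs.fwdStageP hg hs' h12' h13 hN (by positivity) hdvd hK hV' hC'
      (lt_of_le_of_lt ?_ hrange)).mono fun s'' hf' hV'' => Runs.setReg (2 ^ k / 2 ^ (i + 1 + 1)) ?_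
      ⟨by simp, fwdStage (2 ^ (k - (i + 1))) V', ?_, ?_, ?_⟩)).budget (by
        simp only [WordExpr.cost, HDiv.hDiv, Div.div]; omega)⟩
    · gcongr
    · have : s''.reg 13 = 2 ^ k / 2 ^ (i + 1) := by
        rw [hf'.reg 13 (by simp [_root_.fwdStageP, pairFill_regs]), h13, hH]
      simp only [eval_div, eval_reg, this, eval_const, Nat.mod_eq_of_lt h2w]
      rw [Nat.div_div_eq_div_mul, ← pow_succ]
      exact Nat.mod_eq_of_lt ((Nat.div_le_self _ _).trans_lt hN)
    · refine fun n hn => (hV'' n hn).mono ?_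
      have h8 : X ≤ 8 ^ i * X := le_mul_of_one_le_left hX0 (one_le_pow₀ (by norm_num))
      have h1 : δ * (8 ^ i * X / D) ≤ 8 ^ i * X := by
        rw [mul_div_assoc', div_le_iff₀ hD0, mul_comm]
        gcongr
      have h2 : δ * (2 ^ i * C) ≤ 2 ^ k * C * δ := by
        rw [mul_comm]
        gcongr
      rw [pow_succ]
      linarith
    · intro n
      refine (norm_fwdStage_le hC' n).trans (le_of_eq ?_)
      ring
    · rw [← he, show k - i = (k - (i + 1)) + 1 by omega]
      rfl
  · intro s' _ h
    rw [eval_reg, h.1]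
    exact Nat.div_eq_of_lt (Nat.pow_lt_pow_right (by norm_num) (by omega))
  · obtain ⟨_, V', h1, _, h2⟩ := h
    rw [Nat.sub_self] at h2
    rw [← h2]
    exact h1
  · simp only [sum_const, card_range, smul_eq_mul, WordExpr.cost, HDiv.hDiv, Div.div]
    ring_nf
    omega

lemma Runs.invP (hg : GoodPair re im) {k : ℕ} {X : ℝ} (hs : FFTEnv w D K δ s)
    (h12 : s.reg 12 = 2 ^ k) (hN : 2 ^ k < 2 ^ w) (hK : 2 ^ k / 2 ≤ K) (hδ : 0 ≤ δ)
    (hδD : δ ≤ D) (hC0 : 0 ≤ C) (hX : 2 * (2 ^ k * C) * δ + 2 ≤ X)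
    (hV : RepArr D X (2 ^ k) (s.mem re) (s.mem im) V) (hC : ∀ n, ‖V n‖ ≤ C)
    (hrange : (D * (2 ^ k * C + 2 ^ k * C) + (8 ^ k * X + 8 ^ k * X)) * (D * 1 + δ)
      < (D : ℝ) ^ 3) :
    Runs w (invP re im) s (k * (2 ^ k * 292 + 54) + 10) fun s' =>
      RepArr D (8 ^ k * X) (2 ^ k) (s'.mem re) (s'.mem im) (invAll k V) := by
  have hD0 : (0 : ℝ) < D := by exact_mod_cast hs.pos
  have hX0 : 0 ≤ X := le_trans (by positivity) hX
  have h1w : 1 < 2 ^ w := lt_of_le_of_lt Nat.one_le_two_pow hN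
  let I : ℕ → RamState → Prop := fun i s' => s'.reg 13 = 2 ^ i ∧
      RepArr D (8 ^ i * X) (2 ^ k) (s'.mem re) (s'.mem im) (invAll i V) ∧
      (∀ n, ‖invAll i V n‖ ≤ 2 ^ i * C)
  have hs0 : FFTEnv w D K δ ⟨update s.reg 13 1, s.mem⟩ :=
    hs.congr (fun r _ h => by simp [show r ≠ 13 by omega]) rfl rfl
  have h12' : ∀ s', Frame (.seq (_root_.invStageP re im) (.setReg 13 (reg 13 + reg 13)))
      ⟨update s.reg 13 1, s.mem⟩ s' → s'.reg 12 = 2 ^ k := by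
    intro s' hf
    rw [hf.reg 12 (by simp [Program.regs, _root_.invStageP, pairFill_regs])]
    simpa using h12
  refine (Runs.seq (Runs.setReg 1 ?_ ((Runs.whileNonzero k
    (fun _ => 2 ^ k * 292 + 48) I ?_ ?_ ?_).mono fun s' _ h => h.2.1))).budget ?_
  · simp only [eval_const, Nat.mod_eq_of_lt h1w]
  · exact ⟨by simp, by simpa [invAll] using hV, by simpa [invAll] using hC⟩
  · intro i hi s' hf hI
    obtain ⟨h13, hV', hC'⟩ := hI
    have hs' := hg.env_of_frame hs0 hf (by simp [Program.regs, _root_.invStageP, pairFill_regs])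
      (by simp [Program.arrs, _root_.invStageP, pairFill_arrs])
    have hdvd : 2 * 2 ^ i ∣ 2 ^ k := by
      rw [← pow_succ']
      exact pow_dvd_pow _ (by omega)
    have hpi : (2 : ℝ) ^ i ≤ 2 ^ k := pow_le_pow_right₀ (by norm_num) hi.le
    have hpi' : (8 : ℝ) ^ i ≤ 8 ^ k := pow_le_pow_right₀ (by norm_num) hi.le
    have hltk : 2 ^ i < 2 ^ k := Nat.pow_lt_pow_right (by norm_num) hi
    have hlek : 2 ^ (i + 1) ≤ 2 ^ k := Nat.pow_le_pow_right two_pos hi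
    refine ⟨by simp [h13, h12' s' hf, hltk, Nat.mod_eq_of_lt h1w],
      (Runs.seq ((Runs.invStageP hg hs' (h12' s' hf) h13 hN (by positivity) hdvd hK hδ hV' hC'
      (lt_of_le_of_lt ?_ hrange)).mono fun s'' hf' hV'' => Runs.setReg (2 ^ (i + 1)) ?_
      ⟨by simp, ?_, ?_⟩)).budget (by
        simp only [WordExpr.cost, HAdd.hAdd, Add.add]; simp only [Nat.add_eq]; omega)⟩
    · gcongr
    · have : s''.reg 13 = 2 ^ i := by
        rw [hf'.reg 13 (by simp [_root_.invStageP, pairFill_regs]), h13]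
      simp only [eval_add, eval_reg, this]
      rw [← mul_two, ← pow_succ]
      exact Nat.mod_eq_of_lt (hlek.trans_lt hN)
    · refine fun n hn => (hV'' n hn).mono ?_
      have h8 : X ≤ 8 ^ i * X := le_mul_of_one_le_left hX0 (one_le_pow₀ (by norm_num))
      have h1 : (8 ^ i * X + 8 ^ i * X) * (δ / D) ≤ 8 ^ i * X + 8 ^ i * X :=
        mul_le_of_le_one_right (by positivity) ((div_le_one hD0).2 hδD)
      have h2 : (2 ^ i * C + 2 ^ i * C) * δ ≤ 2 * (2 ^ k * C) * δ := by
        rw [← two_mul]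
        gcongr
      rw [pow_succ]
      linarith
    · intro n
      refine (norm_invStage_le hC' n).trans (le_of_eq ?_)
      ring
  · intro s' hf h
    simp [h.1, h12' s' hf]
  · simp only [sum_const, card_range, smul_eq_mul, WordExpr.cost, WordExpr.less]
    ring_nf
    omega

end Transform

/-! ### Multiplication of polynomials over `𝔽₂` on the word RAM -/

section Multiplication

open Finset Function WordExpr
open Polynomial hiding eval_add eval_mul eval_sub

/-- The array `a` starts with the first `n` coefficients of `f`. -/
def HoldsPoly (a : ℕ → ℕ) (n : ℕ) (f : (ZMod 2)[X]) : Prop := ∀ i < n, a i = (f.coeff i).val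

/-- The lift of a polynomial over `𝔽₂` to natural coefficients. -/
noncomputable def liftNat (f : (ZMod 2)[X]) : ℕ[X] :=
  ∑ i ∈ range (f.natDegree + 1), monomial i (f.coeff i).val

lemma coeff_liftNat (f : (ZMod 2)[X]) (i : ℕ) : (liftNat f).coeff i = (f.coeff i).val := by
  simp only [liftNat, finsetSum_coeff, coeff_monomial, sum_ite_eq', mem_range]
  split_ifs with h
  · rfl
  · rw [coeff_eq_zero_of_natDegree_lt (by omega), ZMod.val_zero]

lemma natDegree_liftNat_le (f : (ZMod 2)[X]) : (liftNat f).natDegree ≤ f.natDegree :=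
  natDegree_le_iff_coeff_eq_zero.2 fun i hi => by
    rw [coeff_liftNat, coeff_eq_zero_of_natDegree_lt hi, ZMod.val_zero]

lemma map_liftNat (f : (ZMod 2)[X]) : (liftNat f).map (Nat.castRingHom (ZMod 2)) = f := by
  ext i
  rw [coeff_map, coeff_liftNat]
  simp

lemma coeff_liftNat_mul_mod (f g : (ZMod 2)[X]) (i : ℕ) :
    (liftNat f * liftNat g).coeff i % 2 = ((f * g).coeff i).val := by
  conv_rhs => rw [← map_liftNat f, ← map_liftNat g, ← Polynomial.map_mul, coeff_map]
  rw [eq_natCast, ZMod.val_natCast]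

lemma coeff_liftNat_le (f : (ZMod 2)[X]) (i : ℕ) : (liftNat f).coeff i ≤ 1 := by
  rw [coeff_liftNat]
  exact Nat.lt_succ_iff.1 (ZMod.val_lt _)

lemma coeff_liftNat_mul_le (f g : (ZMod 2)[X]) {N : ℕ} (h : f.natDegree + g.natDegree < N) (i : ℕ) :
    (liftNat f * liftNat g).coeff i ≤ N := by
  by_cases hi : i < N
  · rw [coeff_mul]
    refine (sum_le_card_nsmul _ _ 1 fun x _ => ?_).trans ?_
    · exact Nat.mul_le_mul (coeff_liftNat_le f _) (coeff_liftNat_le g _)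
    · rw [Finset.Nat.card_antidiagonal]
      simpa using hi
  · rw [coeff_eq_zero_of_natDegree_lt]
    · exact Nat.zero_le _
    · have := natDegree_liftNat_le f
      have := natDegree_liftNat_le g
      have := natDegree_mul_le (p := liftNat f) (q := liftNat g)
      omega

/-- The fixed-point environment for transforms of length at most `n`. -/
def MulEnv (w n : ℕ) (s : RamState) : Prop := 4 ≤ n ∧ FFTEnv w (n ^ 20) (n / 2) ((n : ℝ) ^ 5) s

/-- The entry of a transform input read from the bit array `a`. -/
def inputE (a : ℕ) : WordExpr := less (reg 20) (reg 11) * cell a (reg 20) * reg 6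

/-- The real part of the pointwise product of the arrays `7`, `8` and `9`, `10`. -/
def prodReE : WordExpr :=
  roundQuotE (cell 7 (reg 20) * cell 9 (reg 20) + reg 10 * (cell 8 (reg 20) * cell 10 (reg 20)))
    % reg 7
/-- The imaginary part of the pointwise product of the arrays `7`, `8` and `9`, `10`. -/
def prodImE : WordExpr :=
  roundQuotE (cell 7 (reg 20) * cell 10 (reg 20) + cell 8 (reg 20) * cell 9 (reg 20)) % reg 7

/-- The parity of a coefficient recovered from its fixed-point approximation. -/
def parityE : WordExpr :=
  (cell 7 (reg 20) + reg 6 * reg 11) % reg 7 / (reg 6 * reg 12) % const 2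

/-- The product of the polynomials in the arrays `4` and `5`, of the length in register `11`, is
written to array `6`. -/
def mulP : Program :=
  .seq (.setReg 12 (reg 11 + reg 11))
  (.seq (pairFill 7 8 12 (inputE 4) (const 0))
  (.seq (pairFill 9 10 12 (inputE 5) (const 0))
  (.seq (fwdP 7 8)
  (.seq (fwdP 9 10)
  (.seq (pairFill 7 8 12 prodReE prodImE)
  (.seq (invP 7 8) (fill 6 12 parityE)))))))

variable {w n κ D : ℕ} {s : RamState} {f g : (ZMod 2)[X]}

/-- Integers are represented without error, and the comparison in `inputE` pads the input with zeros
up to the transform length. -/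
lemma FixEnv.fixRep_input (hs : FixEnv w D s) {a i h : ℕ} (h11 : s.reg 11 = h)
    (h20 : s.reg 20 = i) (hf : HoldsPoly (s.mem a) h f) (hd : f.natDegree < h)
    {E : ℝ} (hE : 0 ≤ E) :
    FixRep D E ((inputE a).eval w s) ((const 0).eval w s) ((liftNat f).coeff i : ℂ) := by
  refine ⟨(liftNat f).coeff i * D, 0, ?_, by simp, by simpa [mul_comm] using hE⟩
  rw [inputE, hs.cast_mul, hs.cast_mul, eval_less, eval_reg, eval_reg, eval_reg, eval_cell, eval_reg,
    h11, h20, hs.r6, coeff_liftNat, hs.cast_mod]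
  by_cases hi : i < h
  · simp [hi, hf i hi]
  · simp [hi, coeff_eq_zero_of_natDegree_lt (show f.natDegree < i by omega)]

/-- The inverse transform is not normalized, so the cell holds about `D * (2 * h) * c`. Adding half
the spacing `D * (2 * h)` before dividing by it rounds to the nearest integer, correctly for errors
below `D * h`; `hr` excludes wraparound. -/
lemma FixEnv.eval_parityE (hs : FixEnv w D s) {h c i : ℕ} {E : ℝ} (h11 : s.reg 11 = h)
    (h12 : s.reg 12 = 2 * h) (h20 : s.reg 20 = i) (hc : c ≤ 2 * h) (hE : E < D * h)
    (hr : 2 * h * (2 * h + 1) < 2 * D ^ 2)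
    (hrep : FixRep D E (s.mem 7 i) (s.mem 8 i) (((2 * h : ℕ) : ℂ) * (c : ℂ))) :
    parityE.eval w s = c % 2 := by
  obtain ⟨a, b, h1, _, h3⟩ := hrep
  have hD := hs.pos
  have hM := hs.lt
  have hre : |(a : ℝ) - D * (2 * h * c)| < D * h := by
    refine lt_of_le_of_lt (le_trans (le_of_eq ?_) (Complex.abs_re_le_norm _)) (h3.trans_lt hE)
    simp
  rw [abs_lt] at hre
  have hlo : (D * (2 * h) * c : ℤ) < a + D * h := by
    have : ((D * (2 * h) * c : ℤ) : ℝ) < ((a + D * h : ℤ) : ℝ) := by push_cast; linarith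
    exact_mod_cast this
  have hhi : a + D * h < (D * (2 * h) * (c + 1) : ℤ) := by
    have : ((a + D * h : ℤ) : ℝ) < ((D * (2 * h) * (c + 1) : ℤ) : ℝ) := by push_cast; linarith
    exact_mod_cast this
  have hh : 0 < h := by
    rcases Nat.eq_zero_or_pos h with rfl | h'
    · simp at hlo hhi
      omega
    · exact h'
  have hlt : D * (2 * h) * (c + 1) < 2 * D ^ 3 := by
    calc D * (2 * h) * (c + 1) ≤ D * (2 * h) * (2 * h + 1) := by gcongr
      _ = D * (2 * h * (2 * h + 1)) := by ring
      _ < D * (2 * D ^ 2) := by gcongr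
      _ = 2 * D ^ 3 := by ring
  have hltz : (D * (2 * h) * (c + 1) : ℤ) < 2 * D ^ 3 := by exact_mod_cast hlt
  have h0 : (0 : ℤ) ≤ D * (2 * h) * c := by positivity
  have hN : D * (2 * h) < 2 ^ w := by
    refine lt_of_le_of_lt ?_ (hlt.trans hM)
    exact Nat.le_mul_of_pos_right _ (by omega)
  have hsh : (((s.mem 7 i + D * h) % (2 * D ^ 3) : ℕ) : ℤ) = a + D * h := by
    have := shift_mod_eq (H := D * h) h1 (by push_cast; linarith) (by push_cast; linarith)
    rw [this]
    push_cast
    ring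
  have h2w : 2 < 2 ^ w := by
    refine lt_of_le_of_lt ?_ hM
    have := Nat.pow_pos (n := 3) hD
    omega
  have hq : (s.mem 7 i + D * h) % (2 * D ^ 3) / (D * (2 * h)) = c := by
    generalize (s.mem 7 i + D * h) % (2 * D ^ 3) = q at hsh
    refine Nat.div_eq_of_lt_le ?_ ?_
    · zify
      rw [hsh]
      linarith
    · zify
      rw [hsh]
      linarith
  have hltDh : D * h < 2 ^ w := by
    refine lt_of_le_of_lt ?_ hN
    exact Nat.mul_le_mul_left _ (by omega)
  have hMw : (s.mem 7 i + D * h) % (2 * D ^ 3) < 2 ^ w :=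
    (Nat.mod_lt _ (by positivity)).trans hM
  simp only [parityE, eval_mod, eval_div, eval_add, eval_mul, eval_reg, eval_cell, eval_const,
    h11, h12, h20, hs.r6, hs.r7]
  rw [Nat.mod_eq_of_lt h2w, Nat.mod_eq_of_lt hltDh, Nat.mod_eq_of_lt hN,
    Nat.mod_mod_of_dvd _ hs.dvd, Nat.mod_eq_of_lt hMw, hq, Nat.mod_eq_of_lt (a := c),
    Nat.mod_eq_of_lt]
  · omega
  · refine lt_of_le_of_lt ?_ (hlt.trans hM)
    have : 1 ≤ D * (2 * h) := Nat.succ_le_of_lt (by positivity)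
    nlinarith

/-- The error budget of a multiplication, with `x = n` and `N` the transform length. The precision
is `x ^ 20`, the table has error `x ^ 5`, and the error exponents are 7 before and 10 after the
forward transforms, 13 after the pointwise product and 16 at the end. The other inequalities are the
range conditions of the products. -/
lemma mul_bounds {x N : ℝ} (hx : 4 ≤ x) (hN0 : 0 ≤ N) (hN : N ≤ x) :
    N * 1 * x ^ 5 + 2 ≤ x ^ 7 ∧
    (x ^ 20 * 1 + x ^ 5) * (x ^ 20 * (N * 1) + N ^ 3 * x ^ 7) < (x ^ 20) ^ 3 ∧
    (x ^ 20 * N + N ^ 3 * x ^ 7) * (x ^ 20 * N + N ^ 3 * x ^ 7) < (x ^ 20) ^ 3 ∧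
    N ^ 3 * x ^ 7 * (N + N ^ 3 * x ^ 7 / x ^ 20) + N * (N ^ 3 * x ^ 7) + 2 ≤ x ^ 13 ∧
    2 * (N * N) * N * x ^ 5 + 2 ≤ x ^ 13 ∧
    (x ^ 20 * (N * (N * N) + N * (N * N)) + (N ^ 3 * x ^ 13 + N ^ 3 * x ^ 13)) * (x ^ 20 * 1 + x ^ 5)
      < (x ^ 20) ^ 3 ∧
    N ^ 3 * x ^ 13 ≤ x ^ 16 := by
  have hx0 : 0 ≤ x := by linarith
  have hx1 : 1 ≤ x := by linarith
  have mono : ∀ {a b : ℕ}, a ≤ b → x ^ a ≤ x ^ b := fun h => pow_le_pow_right₀ hx1 h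
  have up : ∀ {a b : ℕ}, a < b → 4 * x ^ a ≤ x ^ b := fun {a b} h => by
    refine le_trans ?_ (mono (Nat.succ_le_of_lt h))
    rw [pow_succ']
    gcongr
  have one : ∀ a : ℕ, 1 ≤ x ^ a := fun a => one_le_pow₀ hx1
  have hN3 : N ^ 3 ≤ x ^ 3 := by gcongr
  have hN7 : N ^ 3 * x ^ 7 ≤ x ^ 10 := by
    calc N ^ 3 * x ^ 7 ≤ x ^ 3 * x ^ 7 := by gcongr
      _ = x ^ 10 := by ring
  have hN13 : N ^ 3 * x ^ 13 ≤ x ^ 16 := by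
    calc N ^ 3 * x ^ 13 ≤ x ^ 3 * x ^ 13 := by gcongr
      _ = x ^ 16 := by ring
  have hA : x ^ 20 * N + N ^ 3 * x ^ 7 ≤ 2 * x ^ 21 := by
    have h1 : x ^ 20 * N ≤ x ^ 20 * x := by gcongr
    have h2 : x ^ 20 * x = x ^ 21 := by ring
    have := mono (show 10 ≤ 21 by norm_num)
    linarith
  have hB : x ^ 20 * 1 + x ^ 5 ≤ 2 * x ^ 20 := by
    have := mono (show 5 ≤ 20 by norm_num)
    linarith
  have big : x ^ 50 < (x ^ 20) ^ 3 := by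
    rw [← pow_mul]
    exact pow_lt_pow_right₀ (by linarith) (by norm_num)
  refine ⟨?_, ?_, ?_, ?_, ?_, ?_, hN13⟩
  · have h1 : N * 1 * x ^ 5 ≤ x * 1 * x ^ 5 := by gcongr
    have h2 : x * 1 * x ^ 5 = x ^ 6 := by ring
    linarith [up (show 6 < 7 by norm_num), one 6]
  · refine lt_of_le_of_lt ?_ big
    calc _ ≤ (2 * x ^ 20) * (2 * x ^ 21) := by
          rw [mul_one N]
          gcongr
      _ = 4 * x ^ 41 := by ring
      _ ≤ x ^ 50 := up (by norm_num)
  · refine lt_of_le_of_lt ?_ big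
    calc _ ≤ (2 * x ^ 21) * (2 * x ^ 21) := by gcongr
      _ = 4 * x ^ 42 := by ring
      _ ≤ x ^ 50 := up (by norm_num)
  · have h1 : N ^ 3 * x ^ 7 / x ^ 20 ≤ 1 := by
      rw [div_le_one (by positivity)]
      exact hN7.trans (mono (by norm_num))
    calc _ ≤ x ^ 10 * (x + 1) + x * x ^ 10 + 2 := by gcongr
      _ = 2 * x ^ 11 + x ^ 10 + 2 := by ring
      _ ≤ x ^ 13 := by
        linarith [up (show 11 < 13 by norm_num), one 11, mono (show 10 ≤ 11 by norm_num), up (show 10 < 11 by norm_num), one 10]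
  · have h1 : 2 * (N * N) * N * x ^ 5 ≤ 2 * (x * x) * x * x ^ 5 := by gcongr
    have h2 : 2 * (x * x) * x * x ^ 5 = 2 * x ^ 8 := by ring
    linarith [up (show 8 < 13 by norm_num), one 8]
  · refine lt_of_le_of_lt ?_ big
    have h1 : N * (N * N) ≤ x * (x * x) := by gcongr
    have h2 : x ^ 20 * (N * (N * N) + N * (N * N)) ≤ x ^ 20 * (x * (x * x) + x * (x * x)) := by
      gcongr
    have h3 : x ^ 20 * (x * (x * x) + x * (x * x)) = 2 * x ^ 23 := by ring
    calc _ ≤ (4 * x ^ 23) * (2 * x ^ 20) := by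
          gcongr
          linarith [mono (show 16 ≤ 23 by norm_num)]
      _ = 2 * (4 * x ^ 43) := by ring
      _ ≤ x ^ 50 := by
        linarith [up (show 43 < 44 by norm_num), up (show 44 < 50 by norm_num), one 44]

/-- The environment during a multiplication of polynomials of length `2 ^ κ`. -/
structure MulEnvAt (w n κ : ℕ) (s : RamState) : Prop where
  env : FFTEnv w (n ^ 20) (n / 2) ((n : ℝ) ^ 5) s
  r11 : s.reg 11 = 2 ^ κ
  r12 : s.reg 12 = 2 ^ (κ + 1)

lemma MulEnvAt.of_frame {c : Program} {s' : RamState} (h : MulEnvAt w n κ s) (hf : Frame c s s')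
    (hr : ∀ r ∈ [6, 7, 8, 9, 10, 11, 12], r ∉ c.regs) (ha : ∀ a ∈ [11, 12], a ∉ c.arrs) :
    MulEnvAt w n κ s' :=
  ⟨h.env.of_frame hf (fun r h => hr r (by simp at h ⊢; omega)) (ha _ (by simp)) (ha _ (by simp)),
    by rw [hf.reg _ (hr _ (by simp)), h.r11], by rw [hf.reg _ (hr _ (by simp)), h.r12]⟩

lemma MulEnvAt.tick (h : MulEnvAt w n κ s) (i : ℕ) :
    FixEnv w (n ^ 20) ⟨update s.reg 20 i, s.mem⟩ :=
  h.env.toFixEnv.congr fun r _ h => by simp [show r ≠ 20 by omega]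

/-- The transform is twice as long as the inputs, so the cyclic product is the true one. Its integer
coefficients are recovered exactly, and their parities are the coefficients over `𝔽₂`. -/
lemma Runs.mulP (hs : MulEnv w n s) (h11 : s.reg 11 = 2 ^ κ) (hn : 2 * 2 ^ κ ≤ n)
    (hf : HoldsPoly (s.mem 4) (2 ^ κ) f) (hfd : f.natDegree < 2 ^ κ)
    (hg : HoldsPoly (s.mem 5) (2 ^ κ) g) (hgd : g.natDegree < 2 ^ κ) :
    Runs w mulP s (4000 * (2 ^ κ * (κ + 1))) fun s' => HoldsPoly (s'.mem 6) (2 * 2 ^ κ) (f * g) := by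
  obtain ⟨hn4, hs⟩ := hs
  set D := n ^ 20 with hD
  set N := 2 ^ (κ + 1) with hN
  have hN2 : N = 2 * 2 ^ κ := pow_succ' 2 κ
  have hNn : N ≤ n := hN2 ▸ hn
  have hNr : ((N : ℕ) : ℝ) = (2 : ℝ) ^ (κ + 1) := by rw [hN]; push_cast; rfl
  have hnD : n ≤ D := Nat.le_self_pow (by norm_num) n
  have hnw : n < 2 ^ w := by
    refine lt_of_le_of_lt ?_ hs.lt
    have : D ≤ D ^ 3 := Nat.le_self_pow (by norm_num) D
    omega
  have hNw : N < 2 ^ w := hNn.trans_lt hnw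
  have h8 : (8 : ℝ) ^ (κ + 1) = ((2 : ℝ) ^ (κ + 1)) ^ 3 := by rw [← pow_mul, mul_comm, pow_mul]; norm_num
  obtain ⟨b1, b2, b3, b4, b5, b6, b7⟩ := mul_bounds (x := n) (N := (2 : ℝ) ^ (κ + 1))
    (by exact_mod_cast hn4) (by positivity) (by rw [← hNr]; exact_mod_cast hNn)
  have hDr : (D : ℝ) = (n : ℝ) ^ 20 := by rw [hD]; push_cast; rfl
  have hδD : (n : ℝ) ^ 5 ≤ D := by
    rw [hDr]
    exact pow_le_pow_right₀ (by exact_mod_cast (by omega : 1 ≤ n)) (by norm_num)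
  set F : ℕ → ℂ := fun i => ((liftNat f).coeff i : ℂ) with hF
  set G : ℕ → ℂ := fun i => ((liftNat g).coeff i : ℂ) with hG
  set W : ℕ → ℂ := fun i => ((liftNat f * liftNat g).coeff i : ℂ) with hW
  have hK : N / 2 ≤ n / 2 := Nat.div_le_div_right hNn
  have hdeg := natDegree_liftNat_le f
  have hdeg' := natDegree_liftNat_le g
  have hF1 : ∀ i, ‖F i‖ ≤ 1 := fun i => by
    rw [hF, Complex.norm_natCast]
    exact_mod_cast coeff_liftNat_le f i
  have hG1 : ∀ i, ‖G i‖ ≤ 1 := fun i => by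
    rw [hG, Complex.norm_natCast]
    exact_mod_cast coeff_liftNat_le g i
  have hW1 : ∀ i, ‖W i‖ ≤ (2 : ℝ) ^ (κ + 1) := fun i => by
    rw [hW, Complex.norm_natCast, ← hNr]
    exact_mod_cast coeff_liftNat_mul_le f g (by omega) i
  have hprod : ∀ i < N, fwdAll (κ + 1) W i = fwdAll (κ + 1) F i * fwdAll (κ + 1) G i :=
    fun i hi => fwdAll_coeff_mul _ _ (by omega) hi
  have hx7 : (0 : ℝ) ≤ (n : ℝ) ^ 7 := by positivity
  -- The final error is below half the spacing used in `parityE`.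
  have hE : (n : ℝ) ^ 16 < (D : ℝ) * ((2 ^ κ : ℕ) : ℝ) := by
    rw [hDr]
    refine lt_of_lt_of_le (pow_lt_pow_right₀ (by exact_mod_cast (by omega : 1 < n))
      (by norm_num : 16 < 20)) (le_mul_of_one_le_right (by positivity) ?_)
    exact_mod_cast Nat.one_le_two_pow
  have hrng : 2 * 2 ^ κ * (2 * 2 ^ κ + 1) < 2 * D ^ 2 := by
    have h1 : 2 * 2 ^ κ ≤ D := hn.trans hnD
    have h2 : 2 ≤ D := by omega
    calc 2 * 2 ^ κ * (2 * 2 ^ κ + 1) ≤ D * (D + 1) := by gcongr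
      _ < 2 * D ^ 2 := by nlinarith
  -- The phases are verified from the last to the first, each statement covering the whole remaining
  -- program.
  have e7 : ∀ s, MulEnvAt w n κ s →
      RepArr D ((n : ℝ) ^ 16) N (s.mem 7) (s.mem 8) (fun i => 2 ^ (κ + 1) * W i) →
      Runs w (_root_.fill 6 12 parityE) s (N * 26 + 10)
        fun s' => HoldsPoly (s'.mem 6) (2 * 2 ^ κ) (f * g) := by
    intro s hs hrep
    refine Runs.fill hs.r12 (by decide) hNw (by decide) fun s' _ _ hv _ i hi => ?_
    rw [hv i (by omega), ← coeff_liftNat_mul_mod]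
    refine (hs.tick i).eval_parityE (h := 2 ^ κ) (i := i) (by simpa using hs.r11)
      (by simpa [pow_succ'] using hs.r12) (by simp) ?_ hE hrng (E := (n : ℝ) ^ 16) ?_
    · rw [← hN2]
      exact coeff_liftNat_mul_le f g (by omega) i
    · have := hrep i (by omega)
      rw [hW] at this
      convert this using 2
      push_cast
      ring
  have e6 : ∀ s, MulEnvAt w n κ s →
      RepArr D ((n : ℝ) ^ 13) N (s.mem 7) (s.mem 8) (fwdAll (κ + 1) W) →
      Runs w (.seq (_root_.invP 7 8) (_root_.fill 6 12 parityE)) s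
        ((κ + 1) * (2 ^ (κ + 1) * 292 + 54) + 10 + (N * 26 + 10) + 1)
        fun s' => HoldsPoly (s'.mem 6) (2 * 2 ^ κ) (f * g) := by
    intro s hs hrep
    refine Runs.then_ (Runs.invP (by simp [GoodPair]) hs.env hs.r12 hNw hK (by positivity) hδD
      (C := (2 : ℝ) ^ (κ + 1) * 2 ^ (κ + 1)) (by positivity) ?_ hrep (norm_fwdAll_le _ hW1) ?_)
      fun s' hf h => e7 s' (hs.of_frame hf (by decide) (by decide)) ?_
    · refine le_trans (le_of_eq ?_) b5
      ring
    · rw [hDr, h8]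
      exact b6
    · rw [h8, invAll_fwdAll] at h
      exact fun i hi => (h i hi).mono b7
  have e5 : ∀ s, MulEnvAt w n κ s →
      RepArr D (8 ^ (κ + 1) * (n : ℝ) ^ 7) N (s.mem 7) (s.mem 8) (fwdAll (κ + 1) F) →
      RepArr D (8 ^ (κ + 1) * (n : ℝ) ^ 7) N (s.mem 9) (s.mem 10) (fwdAll (κ + 1) G) →
      Runs w (.seq (_root_.pairFill 7 8 12 prodReE prodImE)
        (.seq (_root_.invP 7 8) (_root_.fill 6 12 parityE))) s
        (N * (23 + 21 + 52) + 43 + ((κ + 1) * (2 ^ (κ + 1) * 292 + 54) + 10 + (N * 26 + 10) + 1) + 1)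
        fun s' => HoldsPoly (s'.mem 6) (2 * 2 ^ κ) (f * g) := by
    intro s hs hr1 hr2
    refine Runs.then_ (Q' := fun s' => RepArr D ((n : ℝ) ^ 13) N (s'.mem 7) (s'.mem 8)
        (fwdAll (κ + 1) W)) (Runs.pairFill hs.r12 (by decide) hNw (by decide) (by decide) (by decide)
        (by decide) (by decide) (by decide) fun s' _ _ v1 v2 i hi => ?_)
      fun s' hf h => e6 s' (hs.of_frame hf (by decide) (by decide)) h
    rw [v1 i hi, v2 i hi, hprod i hi]
    have he := hs.tick i
    refine ((hr1 i hi).mul he.pos (hr2 i hi) (norm_fwdAll_le _ hF1 i) (norm_fwdAll_le _ hG1 i)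
      ?_ (p := (cell 7 (reg 20) * cell 9 (reg 20)
        + reg 10 * (cell 8 (reg 20) * cell 10 (reg 20))).eval w ⟨update s.reg 20 i, s.mem⟩)
      (q := (cell 7 (reg 20) * cell 10 (reg 20) + cell 8 (reg 20) * cell 9 (reg 20)).eval w
        ⟨update s.reg 20 i, s.mem⟩) ?_ ?_ ?_ ?_).mono ?_
    · rw [hDr, h8, mul_one]
      exact b3
    · rw [he.cast_add, he.cast_mul, he.cast_mul, he.cast_mul, he.cast_neg]
      simp only [eval_cell, eval_reg, update_self]
      ring
    · rw [he.cast_add, he.cast_mul, he.cast_mul]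
      simp only [eval_cell, eval_reg, update_self]
    · rw [prodReE, he.cast_mod_reg, he.cast_roundQuotE]
    · rw [prodImE, he.cast_mod_reg, he.cast_roundQuotE]
    · rw [hDr, h8, mul_one]
      exact b4
  have hfwd : 2 ^ (κ + 1) * 1 * (n : ℝ) ^ 5 + 2 ≤ (n : ℝ) ^ 7 := b1
  have hrange : ((D : ℝ) * 1 + (n : ℝ) ^ 5) * (D * (2 ^ (κ + 1) * 1) + 8 ^ (κ + 1) * (n : ℝ) ^ 7)
      < (D : ℝ) ^ 3 := by
    rw [hDr, h8]
    exact b2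
  have e3 : ∀ s, MulEnvAt w n κ s →
      RepArr D ((n : ℝ) ^ 7) N (s.mem 7) (s.mem 8) F →
      RepArr D ((n : ℝ) ^ 7) N (s.mem 9) (s.mem 10) G →
      Runs w (.seq (_root_.fwdP 7 8) (.seq (_root_.fwdP 9 10)
        (.seq (_root_.pairFill 7 8 12 prodReE prodImE)
        (.seq (_root_.invP 7 8) (_root_.fill 6 12 parityE))))) s
        (((κ + 1) * (2 ^ (κ + 1) * 198 + 51) + 7) + (((κ + 1) * (2 ^ (κ + 1) * 198 + 51) + 7) +
          (N * (23 + 21 + 52) + 43 + ((κ + 1) * (2 ^ (κ + 1) * 292 + 54) + 10 + (N * 26 + 10) + 1)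
            + 1) + 1) + 1)
        fun s' => HoldsPoly (s'.mem 6) (2 * 2 ^ κ) (f * g) := by
    intro s hs hr1 hr2
    refine Runs.then_ (Runs.fwdP (by simp [GoodPair]) hs.env hs.r12 hNw hK (by omega) (by positivity) hδD
      zero_le_one hfwd hr1 hF1 hrange) fun s' hf h => ?_
    have hs' : MulEnvAt w n κ s' := hs.of_frame hf (by decide) (by decide)
    rw [← hf.mem 9 (by decide), ← hf.mem 10 (by decide)] at hr2
    refine Runs.then_ (Runs.fwdP (by simp [GoodPair]) hs'.env hs'.r12 hNw hK (by omega) (by positivity) hδD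
      zero_le_one hfwd hr2 hG1 hrange) fun s'' hf' h' => ?_
    rw [← hf'.mem 7 (by decide), ← hf'.mem 8 (by decide)] at h
    exact e5 s'' (hs'.of_frame hf' (by decide) (by decide)) h h'
  have e2 : ∀ s a p, MulEnvAt w n κ s → HoldsPoly (s.mem a) (2 ^ κ) p → p.natDegree < 2 ^ κ → ∀ i,
      FixRep D ((n : ℝ) ^ 7) ((inputE a).eval w ⟨update s.reg 20 i, s.mem⟩)
        ((WordExpr.const 0).eval w ⟨update s.reg 20 i, s.mem⟩) ((liftNat p).coeff i : ℂ) :=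
    fun s a p hs hp hpd i => (hs.tick i).fixRep_input (by simpa using hs.r11) (by simp) hp hpd hx7
  have e1 : ∀ s, MulEnvAt w n κ s → HoldsPoly (s.mem 4) (2 ^ κ) f → HoldsPoly (s.mem 5) (2 ^ κ) g →
      Runs w (.seq (_root_.pairFill 7 8 12 (inputE 4) (WordExpr.const 0))
        (.seq (_root_.pairFill 9 10 12 (inputE 5) (WordExpr.const 0))
        (.seq (_root_.fwdP 7 8) (.seq (_root_.fwdP 9 10)
        (.seq (_root_.pairFill 7 8 12 prodReE prodImE)
        (.seq (_root_.invP 7 8) (_root_.fill 6 12 parityE))))))) s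
        (N * (8 + 1 + 52) + 43 + (N * (8 + 1 + 52) + 43 +
        (((κ + 1) * (2 ^ (κ + 1) * 198 + 51) + 7) + (((κ + 1) * (2 ^ (κ + 1) * 198 + 51) + 7) +
          (N * (23 + 21 + 52) + 43 + ((κ + 1) * (2 ^ (κ + 1) * 292 + 54) + 10 + (N * 26 + 10) + 1)
            + 1) + 1) + 1) + 1) + 1)
        fun s' => HoldsPoly (s'.mem 6) (2 * 2 ^ κ) (f * g) := by
    intro s hs hp hq
    refine Runs.then_ (Q' := fun s' => RepArr D ((n : ℝ) ^ 7) N (s'.mem 7) (s'.mem 8) F)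
      (Runs.pairFill hs.r12 (by decide) hNw (by decide) (by decide) (by decide)
        (by decide) (by decide) (by decide) fun s' _ _ v1 v2 i hi => ?_) fun s' hf h => ?_
    · rw [v1 i hi, v2 i hi]
      exact e2 s 4 f hs hp hfd i
    have hs' : MulEnvAt w n κ s' := hs.of_frame hf (by decide) (by decide)
    rw [← hf.mem 5 (by decide)] at hq
    refine Runs.then_ (Q' := fun s' => RepArr D ((n : ℝ) ^ 7) N (s'.mem 9) (s'.mem 10) G)
      (Runs.pairFill hs'.r12 (by decide) hNw (by decide) (by decide) (by decide)
        (by decide) (by decide) (by decide) fun s'' _ _ v1 v2 i hi => ?_) fun s'' hf' h' => ?_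
    · rw [v1 i hi, v2 i hi]
      exact e2 s' 5 g hs' hq hgd i
    rw [← hf'.mem 7 (by decide), ← hf'.mem 8 (by decide)] at h
    exact e3 s'' (hs'.of_frame hf' (by decide) (by decide)) h h'
  refine Runs.budget (Runs.seq (Runs.setReg N ?_ (e1 _ ⟨?_, ?_, ?_⟩ hf hg))) ?_
  · rw [eval_add, eval_reg, h11, ← two_mul, ← hN2]
    exact Nat.mod_eq_of_lt hNw
  · exact hs.congr (fun r _ h => by simp [show r ≠ 12 by omega]) rfl rfl
  · simpa using h11
  · simp [hN]
  · change 4 + _ + 1 ≤ _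
    rw [← hN, hN2]
    have h1 : 1 ≤ 2 ^ κ := Nat.one_le_two_pow
    have h2 : 2 ^ κ ≤ 2 ^ κ * (κ + 1) := Nat.le_mul_of_pos_right _ (by omega)
    have h3 : (κ + 1) ≤ 2 ^ κ * (κ + 1) := Nat.le_mul_of_pos_left _ (by omega)
    ring_nf at h2 h3 ⊢
    omega

end Multiplication

/-! ### The table of twiddle factors -/

section TwiddleTable

open Finset Function WordExpr

/-- Half-angle formulas in fixed-point arithmetic. -/
lemma half_angle {D c s : ℕ} {θ ε : ℝ} (hD : 0 < D) (hDe : Even D) (h0 : 0 ≤ θ)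
    (h1 : θ ≤ Real.pi / 2) (hc : |(c : ℝ) - D * Real.cos θ| ≤ ε)
    (hs : |(s : ℝ) - D * Real.sin θ| ≤ ε) :
    |((D * (D + c) / 2).sqrt : ℝ) - D * Real.cos (θ / 2)| ≤ ε + 1 ∧
    |((s * D / (2 * (D * (D + c) / 2).sqrt) : ℕ) : ℝ) - D * Real.sin (θ / 2)| ≤ 3 * ε + 3 := by
  obtain ⟨q, hq⟩ := hDe
  have hε : 0 ≤ ε := (abs_nonneg _).trans hc
  have hDr : (0 : ℝ) < D := by exact_mod_cast hD
  set A := D * (D + c) / 2 with hA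
  -- `D` is even, so the halving inside `A` is exact and `A` approximates `(D cos (θ/2)) ^ 2`.
  have hA2 : 2 * A = D * (D + c) := by
    rw [hA, Nat.mul_div_cancel' ]
    exact Dvd.dvd.mul_right ⟨q, by omega⟩ _
  have hAr : 2 * (A : ℝ) = D * (D + c) := by exact_mod_cast hA2
  set r := A.sqrt with hr
  have hr1 : (r : ℝ) * r ≤ A := by exact_mod_cast Nat.sqrt_le A
  have hr2 : (A : ℝ) < (r + 1) * (r + 1) := by exact_mod_cast Nat.lt_succ_sqrt A
  -- The root is at least `D / 2`, which keeps the later division by it stable.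
  have hrq : q ≤ r := by
    rw [hr, Nat.le_sqrt]
    nlinarith [Nat.zero_le (D * c)]
  have hrD : (D : ℝ) ≤ 2 * r := by
    have : D ≤ 2 * r := by omega
    exact_mod_cast this
  set C := D * Real.cos (θ / 2) with hC
  set S := D * Real.sin (θ / 2) with hS
  have hpi := Real.pi_pos
  have hcos0 : 0 ≤ Real.cos (θ / 2) :=
    Real.cos_nonneg_of_neg_pi_div_two_le_of_le (by linarith) (by linarith)
  have hcosθ : 0 ≤ Real.cos θ := Real.cos_nonneg_of_neg_pi_div_two_le_of_le (by linarith) h1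
  have hsin0 : 0 ≤ Real.sin (θ / 2) :=
    Real.sin_nonneg_of_nonneg_of_le_pi (by linarith) (by linarith)
  have hcosdbl : Real.cos θ = 2 * Real.cos (θ / 2) ^ 2 - 1 := by
    rw [← Real.cos_two_mul]
    congr 1
    ring
  have hsindbl : Real.sin θ = 2 * Real.sin (θ / 2) * Real.cos (θ / 2) := by
    rw [← Real.sin_two_mul]
    congr 1
    ring
  have hC0 : 0 ≤ C := by positivity
  have hS0 : 0 ≤ S := by positivity
  have hSD : S ≤ D := by
    rw [hS]
    exact mul_le_of_le_one_right hDr.le (Real.sin_le_one _)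
  have hC2 : 2 * (C * C) = D * (D + D * Real.cos θ) := by
    rw [hC, hcosdbl]
    ring
  have hCD : (D : ℝ) ≤ 2 * C := by
    have : (D : ℝ) * D ≤ 2 * (C * C) := by
      rw [hC2]
      nlinarith [mul_nonneg hDr.le hcosθ]
    by_contra! h
    nlinarith
  rw [abs_le] at hc hs
  -- The squares of `r` and `C` differ by about `D * ε / 2` apart from rounding, while `r + C ≥ D`.
  have hdiff : |(r : ℝ) - C| ≤ ε + 1 := by
    have e1 : (D : ℝ) * c ≤ D * (D * Real.cos θ) + D * ε := by
      rw [← mul_add]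
      exact mul_le_mul_of_nonneg_left (by linarith) hDr.le
    have e2 : (D : ℝ) * (D * Real.cos θ) ≤ D * c + D * ε := by
      rw [← mul_add]
      exact mul_le_mul_of_nonneg_left (by linarith) hDr.le
    rw [abs_le]
    constructor
    · by_contra! h
      nlinarith
    · by_contra! h
      nlinarith
  refine ⟨hdiff, ?_⟩
  have hr0 : (0 : ℝ) < r := by linarith
  have hSr : S * C * 2 = D * (D * Real.sin θ) := by
    rw [hS, hC, hsindbl]
    ring
  -- Here `sin (θ/2) = sin θ / (2 cos (θ/2))`, and the error splits into that of the sine and that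
  -- of the denominator.
  have hnum : |(s : ℝ) * D / (2 * r) - S| ≤ 3 * ε + 2 := by
    have : (s : ℝ) * D / (2 * r) - S
        = (s - D * Real.sin θ) * (D / (2 * r)) + (C - r) * (S / r) := by
      have : (s : ℝ) * D / (2 * r) - S = (s * D - 2 * r * S) / (2 * r) := by field_simp
      rw [this]
      have : (s - D * Real.sin θ) * (D / (2 * r)) + (C - r) * (S / r)
        = (s * D - D * (D * Real.sin θ) + (C - r) * S * 2) / (2 * r) := by
        field_simp
      rw [this, ← hSr]
      congr 1
      ring
    rw [this]
    refine (abs_add_le _ _).trans ?_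
    rw [abs_mul, abs_mul]
    have h3 : |(D : ℝ) / (2 * r)| ≤ 1 := by
      rw [abs_of_nonneg (by positivity)]
      exact (div_le_one (by positivity)).2 hrD
    have h4 : |S / r| ≤ 2 := by
      rw [abs_of_nonneg (by positivity), div_le_iff₀ hr0]
      linarith
    have h5 : |(s : ℝ) - D * Real.sin θ| ≤ ε := abs_le.2 hs
    rw [abs_sub_comm] at hdiff
    calc _ ≤ ε * 1 + (ε + 1) * 2 := by gcongr
      _ = 3 * ε + 2 := by ring
  have hfl : |((s * D / (2 * r) : ℕ) : ℝ) - (s : ℝ) * D / (2 * r)| ≤ 1 := by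
    have h3 : ((s * D / (2 * r) : ℕ) : ℝ) ≤ ((s * D : ℕ) : ℝ) / ((2 * r : ℕ) : ℝ) := Nat.cast_div_le
    have h4 := Nat.lt_div_mul_add (a := s * D) (b := 2 * r) (by
      have : 0 < r := by exact_mod_cast hr0
      omega)
    have h5 : ((s * D : ℕ) : ℝ) / ((2 * r : ℕ) : ℝ) < ((s * D / (2 * r) : ℕ) : ℝ) + 1 := by
      rw [div_lt_iff₀ (by push_cast; positivity)]
      have : ((s * D : ℕ) : ℝ) < ((s * D / (2 * r) * (2 * r) + 2 * r : ℕ) : ℝ) := by exact_mod_cast h4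
      push_cast at this ⊢
      linarith
    push_cast at h3 h5 ⊢
    rw [abs_le]
    constructor <;> linarith
  have := abs_sub_le ((s * D / (2 * r) : ℕ) : ℝ) ((s : ℝ) * D / (2 * r)) S
  linarith

/-- The integer square root of register `23` is written to register `24`. -/
def sqrtP : Program :=
  .seq (.setReg 24 (const 0)) (.seq (.setReg 25 (reg 6)) (.whileNonzero (reg 25)
    (.seq (.setReg 24 (reg 24 + reg 25 *
        (const 1 - less (reg 23) ((reg 24 + reg 25) * (reg 24 + reg 25)))))
      (.setReg 25 (reg 25 / const 2)))))

variable {w : ℕ} {s : RamState}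

/-- Bisection: the root lies between `r` and `r + g i`, where `g i` halves in every round and
register `25` holds half of it. All tested squares are below `9 * (2 ^ d) ^ 2`, so they fit in a
word. -/
lemma Runs.sqrtP {d A : ℕ} (h6 : s.reg 6 = 2 ^ d) (h23 : s.reg 23 = A) (hA : A < 4 * (2 ^ d) ^ 2)
    (hw : 9 * (2 ^ d) ^ 2 ≤ 2 ^ w) :
    Runs w sqrtP s ((d + 1) * 23 + 10) fun s' => s'.reg 24 = A.sqrt := by
  have hd1 : 1 ≤ (2 : ℕ) ^ d := Nat.one_le_two_pow
  have hdd : (2 : ℕ) ^ d ≤ (2 ^ d) ^ 2 := Nat.le_self_pow (by norm_num) _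
  let g : ℕ → ℕ := fun i => 2 ^ (d + 1) / 2 ^ i
  have hg : ∀ i ≤ d, g i = 2 * g (i + 1) ∧ 0 < g (i + 1) ∧ g (i + 1) ≤ 2 ^ d := by
    intro i hi
    have h1 : g i = 2 ^ (d + 1 - i) := Nat.pow_div (by omega) two_pos
    have h2 : g (i + 1) = 2 ^ (d + 1 - (i + 1)) := Nat.pow_div (by omega) two_pos
    refine ⟨?_, by rw [h2]; positivity, ?_⟩
    · rw [h1, h2, ← pow_succ']
      congr 1
      omega
    · rw [h2]
      exact Nat.pow_le_pow_right two_pos (by omega)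
  let I : ℕ → RamState → Prop := fun i s' => s'.reg 23 = A ∧ s'.reg 25 = g i / 2 ∧
    s'.reg 24 * s'.reg 24 ≤ A ∧ A < (s'.reg 24 + g i) * (s'.reg 24 + g i)
  refine (Runs.seq (Runs.setReg 0 (by simp) (Runs.seq (Runs.setReg (2 ^ d) (by simp [h6])
    ((Runs.whileNonzero (d + 1) (fun _ => 21) I ?_ ?_ ?_).mono fun s' _ h => ?_))))).budget ?_
  · refine ⟨by simp [h23], ?_, by simp, ?_⟩
    · simp [g, pow_succ]
    · simp only [g, update_of_ne (show (24 : ℕ) ≠ 25 by norm_num), update_self]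
      rw [pow_succ]
      simp only [pow_zero, Nat.div_one]
      nlinarith
  · intro i hi s' _ ⟨h1, h2, h3, h4⟩
    obtain ⟨g1, g2, g3⟩ := hg i (by omega)
    rw [g1, Nat.mul_div_cancel_left _ two_pos] at h2
    rw [g1] at h4
    have h24 : s'.reg 24 < 2 * 2 ^ d := by
      by_contra! h
      nlinarith
    set r := s'.reg 24
    set b := g (i + 1)
    have hsq : (r + b) * (r + b) < 2 ^ w := by
      refine lt_of_lt_of_le ?_ hw
      nlinarith
    have hrb : r + b < 2 ^ w := lt_of_le_of_lt (Nat.le_mul_self _) hsq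
    have h2w : 2 < 2 ^ w := by omega
    refine ⟨by simp only [eval_reg, h2]; omega, ?_⟩
    refine (Runs.seq (Runs.setReg (if A < (r + b) * (r + b) then r else r + b) ?_
      (Runs.setReg (b / 2) ?_ ⟨?_, ?_, ?_, ?_⟩))).budget (by decide)
    · simp only [eval_add, eval_mul, eval_sub, eval_less, eval_reg, eval_const, h1, h2]
      change (r + _) % _ = _
      rw [show s'.reg 24 = r from rfl, Nat.mod_eq_of_lt hrb, Nat.mod_eq_of_lt hsq,
        Nat.mod_eq_of_lt (a := 1) (by omega)]
      split_ifs with h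
      · have hr : r < 2 ^ w := by omega
        simp [Nat.mod_eq_of_lt (a := 1) (b := 2 ^ w) (by omega), Nat.mod_eq_of_lt hr]
      · simp [Nat.mod_eq_of_lt (a := 1) (b := 2 ^ w) (by omega),
          Nat.mod_eq_of_lt (a := b) (b := 2 ^ w) (by omega), Nat.mod_eq_of_lt hrb]
    · simp only [eval_div, eval_reg, eval_const, update_of_ne (show (25 : ℕ) ≠ 24 by norm_num), h2,
        Nat.mod_eq_of_lt h2w]
      exact Nat.mod_eq_of_lt (by omega)
    · simp [h1]
    · simp [b]
    · simp only [update_of_ne (show (24 : ℕ) ≠ 25 by norm_num), update_self]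
      split_ifs with h
      · exact h3
      · exact not_lt.1 h
    · simp only [update_of_ne (show (24 : ℕ) ≠ 25 by norm_num), update_self]
      split_ifs with h
      · exact h
      · rw [add_assoc, ← two_mul]
        exact h4
  · intro s' _ ⟨_, h2, _, _⟩
    rw [eval_reg, h2]
    simp [g]
  · obtain ⟨_, _, h3, h4⟩ := h
    have : g (d + 1) = 1 := by simp [g]
    rw [this] at h4
    exact (Nat.eq_sqrt.2 ⟨h3, h4⟩)
  · simp only [sum_const, card_range, smul_eq_mul, WordExpr.cost]
    ring_nf
    omega

lemma Runs.setCell {c : ℕ} {i e : WordExpr} {Q : RamState → Prop} (j v : ℕ) (hj : i.eval w s = j)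
    (hv : e.eval w s = v) (hQ : Q ⟨s.reg, update s.mem c (update (s.mem c) j v)⟩) :
    Runs w (.setCell c i e) s (i.cost + e.cost + 1) Q :=
  ⟨_, _, .setCell s c i e, le_rfl, by rwa [hj, hv]⟩

/-- Whether the cell that is being computed is in the known part of the table. -/
def knownE : WordExpr := less (reg 20) (reg 16)

/-- An entry of the doubled table, real part. -/
def tableReE : WordExpr :=
  knownE * cell 11 (reg 20) + (const 1 - knownE) * roundQuotE
    (cell 11 (reg 20 - reg 16) * reg 17 + reg 10 * (cell 12 (reg 20 - reg 16) * reg 18))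
/-- An entry of the doubled table, imaginary part. -/
def tableImE : WordExpr :=
  knownE * cell 12 (reg 20) + (const 1 - knownE) * roundQuotE
    (cell 11 (reg 20 - reg 16) * reg 18 + cell 12 (reg 20 - reg 16) * reg 17)

/-- The table is doubled by means of the root in the registers `17`, `18`, which is then replaced
by its square root. -/
def tableStepP : Program :=
  .seq (.setReg 19 (reg 16 + reg 16))
  (.seq (pairFill 11 12 19 tableReE tableImE)
  (.seq (.setReg 16 (reg 19))
  (.seq (.setReg 23 (reg 6 * (reg 6 + reg 17) / const 2))
  (.seq sqrtP
  (.seq (.setReg 18 (reg 18 * reg 6 / (const 2 * reg 24))) (.setReg 17 (reg 24)))))))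

/-- The twiddle factors, as many as register `15` says, are written to the arrays `11`, `12`. -/
def tableP : Program :=
  .seq (.setCell 11 (const 0) (reg 6))
  (.seq (.setCell 12 (const 0) (const 0))
  (.seq (.setReg 16 (const 1))
  (.seq (.setReg 17 (const 0))
  (.seq (.setReg 18 (reg 6)) (.whileNonzero (less (reg 16) (reg 15)) tableStepP)))))

/-- Entries below `2 ^ j` are copied, and entry `2 ^ j + B` is entry `B` times `twiddleRoot j`. -/
lemma fixRep_tableEntry {D j i : ℕ} {δ ε : ℝ} {s : RamState} (hs : FixEnv w D s) (hD : 4 < D)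
    (hw : 2 * 2 ^ j < 2 ^ w) (h16 : s.reg 16 = 2 ^ j) (h20 : s.reg 20 = i) (hi : i < 2 * 2 ^ j)
    (hδ : δ ≤ D) (hε : ε ≤ D)
    (hρ : FixRep D ε (s.reg 17) (s.reg 18) (twiddleRoot j))
    (ht : ∀ B < 2 ^ j, FixRep D δ (s.mem 11 B) (s.mem 12 B) (twiddle B)) :
    FixRep D (δ + 2 * ε + 2) (tableReE.eval w s) (tableImE.eval w s) (twiddle i) := by
  have hD0 : (0 : ℝ) < D := by exact_mod_cast hs.pos
  have hε0 : 0 ≤ ε := by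
    obtain ⟨_, _, _, _, h⟩ := hρ
    exact (norm_nonneg _).trans h
  have hδ0 : 0 ≤ δ := by
    obtain ⟨_, _, _, _, h⟩ := ht 0 (by positivity)
    exact (norm_nonneg _).trans h
  have h1w : 1 < 2 ^ w := lt_of_le_of_lt (by have := Nat.one_le_two_pow (n := j); omega) hw
  have hk : knownE.eval w s = if i < 2 ^ j then 1 else 0 := by
    rw [knownE, eval_less, eval_reg, eval_reg, h16, h20]
    split_ifs
    · exact Nat.mod_eq_of_lt h1w
    · simp
  have hk' : (const 1 - knownE).eval w s = if i < 2 ^ j then 0 else 1 := by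
    rw [eval_sub, hk, eval_const, Nat.mod_eq_of_lt h1w]
    split_ifs
    · simp
    · exact Nat.mod_eq_of_lt h1w
  have hre : ((tableReE.eval w s : ℕ) : ZMod (2 * D ^ 3)) =
      (if i < 2 ^ j then 1 else 0 : ℕ) * s.mem 11 i + (if i < 2 ^ j then 0 else 1 : ℕ) *
        (roundQuot D ((cell 11 (reg 20 - reg 16) * reg 17
          + reg 10 * (cell 12 (reg 20 - reg 16) * reg 18)).eval w s) : ℕ) := by
    rw [tableReE, hs.cast_add, hs.cast_mul, hs.cast_mul, hs.cast_roundQuotE, hk, hk', eval_cell,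
      eval_reg, h20]
  have him : ((tableImE.eval w s : ℕ) : ZMod (2 * D ^ 3)) =
      (if i < 2 ^ j then 1 else 0 : ℕ) * s.mem 12 i + (if i < 2 ^ j then 0 else 1 : ℕ) *
        (roundQuot D ((cell 11 (reg 20 - reg 16) * reg 18
          + cell 12 (reg 20 - reg 16) * reg 17).eval w s) : ℕ) := by
    rw [tableImE, hs.cast_add, hs.cast_mul, hs.cast_mul, hs.cast_roundQuotE, hk, hk', eval_cell,
      eval_reg, h20]
  by_cases hij : i < 2 ^ j
  · simp only [if_pos hij, Nat.cast_one, Nat.cast_zero, one_mul, zero_mul, add_zero] at hre him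
    exact ((ht i hij).congr hre him).mono (by linarith)
  · simp only [if_neg hij, Nat.cast_one, Nat.cast_zero, one_mul, zero_mul, zero_add] at hre him
    obtain ⟨B, rfl⟩ := Nat.exists_eq_add_of_le (not_lt.1 hij)
    have hB : B < 2 ^ j := by omega
    have hidx : (reg 20 - reg 16).eval w s = B := by
      rw [eval_sub, eval_reg, eval_reg, h20, h16, Nat.add_sub_cancel_left]
      exact Nat.mod_eq_of_lt (by omega)
    rw [twiddle_two_pow_add hB]
    refine ((ht B hB).mul hs.pos hρ (norm_twiddle B).le (norm_twiddleRoot j).le ?_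
      (p := (cell 11 (reg 20 - reg 16) * reg 17
          + reg 10 * (cell 12 (reg 20 - reg 16) * reg 18)).eval w s)
      (q := (cell 11 (reg 20 - reg 16) * reg 18
          + cell 12 (reg 20 - reg 16) * reg 17).eval w s) ?_ ?_ hre him).mono ?_
    · have h4 : (4 : ℝ) < D := by exact_mod_cast hD
      calc _ ≤ ((D : ℝ) * 1 + D) * (D * 1 + D) := by gcongr
        _ = 4 * (D : ℝ) ^ 2 := by ring
        _ < D * (D : ℝ) ^ 2 := by gcongr
        _ = (D : ℝ) ^ 3 := by ring
    · rw [hs.cast_add, hs.cast_mul, hs.cast_mul, hs.cast_mul, hs.cast_neg, eval_cell, eval_cell,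
        hidx, eval_reg, eval_reg]
      ring
    · rw [hs.cast_add, hs.cast_mul, hs.cast_mul, eval_cell, eval_cell, hidx, eval_reg, eval_reg]
    · have : δ * (ε / D) ≤ ε := by
        rw [mul_div_assoc', div_le_iff₀ hD0, mul_comm]
        gcongr
      linarith

lemma fixRep_of_cos_sin {D c s : ℕ} {θ ε : ℝ} (hc : |(c : ℝ) - D * Real.cos θ| ≤ ε)
    (hs : |(s : ℝ) - D * Real.sin θ| ≤ ε) :
    FixRep D (2 * ε) c s (Complex.exp (θ * Complex.I)) := by
  refine ⟨c, s, by simp, by simp, ?_⟩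
  have h : ((c : ℤ) : ℂ) + ((s : ℤ) : ℂ) * Complex.I - D * Complex.exp (θ * Complex.I)
      = ((c - D * Real.cos θ : ℝ) : ℂ) + ((s - D * Real.sin θ : ℝ) : ℂ) * Complex.I := by
    rw [Complex.exp_mul_I]
    push_cast
    ring
  rw [h]
  refine (norm_add_le _ _).trans ?_
  rw [norm_mul, Complex.norm_I, mul_one, Complex.norm_real, Complex.norm_real, Real.norm_eq_abs,
    Real.norm_eq_abs]
  linarith

end TwiddleTable

section Costs

namespace WordExpr

variable (a b : WordExpr)

lemma cost_const (v : ℕ) : (const v).cost = 1 := rfl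
lemma cost_reg (r : ℕ) : (reg r).cost = 1 := rfl
lemma cost_add : (a + b).cost = a.cost + b.cost + 1 := rfl
lemma cost_sub : (a - b).cost = a.cost + b.cost + 1 := rfl
lemma cost_mul : (a * b).cost = a.cost + b.cost + 1 := rfl
lemma cost_div : (a / b).cost = a.cost + b.cost + 1 := rfl
lemma cost_less : (a.less b).cost = a.cost + b.cost + 1 := rfl

end WordExpr

end Costs

/-! ### Filling the table by repeated doubling -/

section TwiddleTable

open Finset Function WordExpr

variable {w : ℕ} {s : RamState}

/-- The first `2 ^ j` twiddle factors and the root for the next doubling have been computed. -/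
structure TableInv (D j : ℕ) (s : RamState) : Prop where
  r16 : s.reg 16 = 2 ^ j
  cos : |(s.reg 17 : ℝ) - D * Real.cos (Real.pi * (1 / 2) ^ (j + 1))| ≤ 3 * 4 ^ j
  sin : |(s.reg 18 : ℝ) - D * Real.sin (Real.pi * (1 / 2) ^ (j + 1))| ≤ 3 * 4 ^ j
  tw : ∀ B < 2 ^ j, FixRep D (14 * 4 ^ j) (s.mem 11 B) (s.mem 12 B) (twiddle B)

/-- A halving of the angle turns the error `ε` of the cosine and sine into at most `3 * ε + 3`, and
a doubling of the table turns `δ` into `δ + 4 * ε + 2`. The bounds `3 * 4 ^ j` and `14 * 4 ^ j`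
majorize both recursions. -/
lemma Runs.tableStepP {D d j : ℕ} (hs : FixEnv w D s) (hDd : D = 2 ^ d) (h9 : 9 < D)
    (hj : 14 * (4 : ℝ) ^ j ≤ D) (hw : 2 * 2 ^ j < 2 ^ w) (hI : TableInv D j s) :
    Runs w tableStepP s (2 * 2 ^ j * 122 + 23 * d + 110) (TableInv D (j + 1)) := by
  obtain ⟨h16, hc, hsn, ht⟩ := hI
  have hDM := hs.lt
  have h4 : (0 : ℝ) < 4 ^ j := by positivity
  have hcos1 := Real.cos_le_one (Real.pi * (1 / 2) ^ (j + 1))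
  have hsin1 := Real.sin_le_one (Real.pi * (1 / 2) ^ (j + 1))
  have hD0 : (0 : ℝ) < D := by exact_mod_cast hs.pos
  have hcD : s.reg 17 ≤ 2 * D := by
    have h1 := (abs_le.1 hc).2
    have h2 := mul_le_of_le_one_right hD0.le hcos1
    have : (s.reg 17 : ℝ) ≤ 2 * D := by linarith
    exact_mod_cast this
  have hsD : s.reg 18 ≤ 2 * D := by
    have h1 := (abs_le.1 hsn).2
    have h2 := mul_le_of_le_one_right hD0.le hsin1
    have : (s.reg 18 : ℝ) ≤ 2 * D := by linarith
    exact_mod_cast this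
  have hD3 : 9 * D ^ 2 ≤ 2 ^ w := by
    refine le_trans ?_ hDM.le
    rw [pow_succ D 2]
    nlinarith [Nat.zero_le (D ^ 2)]
  have hD1 : 9 * D ≤ 9 * D ^ 2 := Nat.mul_le_mul_left _ (Nat.le_self_pow (by norm_num) D)
  set A := D * (D + s.reg 17) / 2 with hA
  have hA1 : D * (D + s.reg 17) ≤ 3 * D ^ 2 := by nlinarith
  have hA4 : A < 4 * D ^ 2 := by
    have : A ≤ D * (D + s.reg 17) := Nat.div_le_self _ _
    nlinarith [hs.pos]
  have hsq : A.sqrt < 2 * D := by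
    rw [Nat.sqrt_lt]
    nlinarith
  have hsqlo : 0 < A.sqrt := by
    rw [Nat.sqrt_pos, hA]
    refine Nat.div_pos ?_ two_pos
    nlinarith [Nat.zero_le (D * s.reg 17)]
  have hθ : Real.pi * (1 / 2) ^ (j + 1) / 2 = Real.pi * (1 / 2) ^ (j + 1 + 1) := by ring
  have hDe : Even D := by
    rw [hDd, Nat.even_pow]
    refine ⟨even_two, ?_⟩
    rintro rfl
    omega
  have hpi := Real.pi_pos
  have hθ1 : Real.pi * (1 / 2) ^ (j + 1) ≤ Real.pi / 2 := by
    rw [pow_succ, ← mul_assoc, mul_one_div]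
    gcongr
    exact mul_le_of_le_one_right hpi.le (pow_le_one₀ (by norm_num) (by norm_num))
  obtain ⟨g1, g2⟩ := half_angle hs.pos hDe (by positivity) hθ1 hc hsn
  rw [hθ, ← hA] at g1 g2
  have hρ : FixRep D (6 * 4 ^ j) (s.reg 17) (s.reg 18) (twiddleRoot j) := by
    refine (fixRep_of_cos_sin hc hsn).mono (le_of_eq ?_)
    ring
  have e5 : ∀ s' : RamState, s'.reg 24 = A.sqrt → s'.reg 18 = s.reg 18 → s'.reg 6 = D →
      s'.reg 16 = 2 ^ (j + 1) → (∀ B < 2 ^ (j + 1), FixRep D (14 * 4 ^ (j + 1)) (s'.mem 11 B)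
        (s'.mem 12 B) (twiddle B)) →
      Runs w (.seq (.setReg 18 (reg 18 * reg 6 / (const 2 * reg 24))) (.setReg 17 (reg 24))) s'
        11 (TableInv D (j + 1)) := by
    intro s' h1 h2 h3 h4' h5
    refine Runs.seq (Runs.setReg (s.reg 18 * D / (2 * A.sqrt)) ?_ (Runs.setReg A.sqrt (by simp [h1])
      ⟨by simpa using h4', ?_, ?_, h5⟩))
    · have hb1 : s.reg 18 * D < 2 ^ w := by nlinarith
      have hb2 : 2 * A.sqrt < 2 ^ w := by omega
      have hb3 : 2 < 2 ^ w := by omega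
      rw [eval_div, eval_mul, eval_mul, eval_reg, eval_reg, eval_reg, eval_const, h1, h2, h3,
        Nat.mod_eq_of_lt hb1, Nat.mod_eq_of_lt hb3, Nat.mod_eq_of_lt hb2,
        Nat.mod_eq_of_lt ((Nat.div_le_self _ _).trans_lt hb1)]
    · simp only [update_self]
      refine g1.trans ?_
      rw [pow_succ]
      linarith [one_le_pow₀ (M₀ := ℝ) (n := j) (show (1 : ℝ) ≤ 4 by norm_num)]
    · simp only [update_of_ne (show (18 : ℕ) ≠ 17 by norm_num), update_self]
      refine g2.trans ?_
      rw [pow_succ]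
      linarith [one_le_pow₀ (M₀ := ℝ) (n := j) (show (1 : ℝ) ≤ 4 by norm_num)]
  have e3 : ∀ s' : RamState, FixEnv w D s' → s'.reg 17 = s.reg 17 → s'.reg 18 = s.reg 18 →
      s'.reg 19 = 2 * 2 ^ j → (∀ B < 2 * 2 ^ j, FixRep D (14 * 4 ^ (j + 1)) (s'.mem 11 B)
        (s'.mem 12 B) (twiddle B)) →
      Runs w (.seq (.setReg 16 (reg 19))
        (.seq (.setReg 23 (reg 6 * (reg 6 + reg 17) / const 2))
        (.seq _root_.sqrtP
        (.seq (.setReg 18 (reg 18 * reg 6 / (const 2 * reg 24))) (.setReg 17 (reg 24)))))) s'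
        (23 * d + 60) (TableInv D (j + 1)) := by
    intro s' hs' h1 h2 h3 h5
    have hw9 : 9 * (2 ^ d) ^ 2 ≤ 2 ^ w := by rwa [← hDd]
    refine Runs.budget (Runs.seq (Runs.setReg (2 * 2 ^ j) (by simp [h3]) (Runs.seq (Runs.setReg A ?_
      (Runs.then_ (Runs.sqrtP (d := d) (A := A) ?_ ?_ (by rwa [← hDd]) hw9)
      fun s'' hf h => e5 s'' h ?_ ?_ ?_ ?_))))) ?_
    · have hb3 : 2 < 2 ^ w := by omega
      simp only [eval_div, eval_mul, eval_add, eval_reg, eval_const,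
        update_of_ne (show (6 : ℕ) ≠ 16 by norm_num), update_of_ne (show (17 : ℕ) ≠ 16 by norm_num),
        h1, hs'.r6]
      rw [Nat.mod_eq_of_lt hb3, Nat.mod_eq_of_lt (a := D + s.reg 17) (by omega),
        Nat.mod_eq_of_lt (a := D * (D + s.reg 17)) (by omega), Nat.mod_eq_of_lt (by omega)]
    · simp [hs'.r6, hDd]
    · simp
    · rw [hf.reg 18 (by decide)]
      simp [h2]
    · rw [hf.reg 6 (by decide)]
      simp [hs'.r6]
    · rw [hf.reg 16 (by decide)]
      simp [pow_succ']
    · rw [hf.mem 11 (by decide), hf.mem 12 (by decide), pow_succ' 2 j]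
      exact h5
    · simp only [cost_reg, cost_mul, cost_add, cost_div, cost_const]
      omega
  have hs1 : FixEnv w D ⟨update s.reg 19 (2 * 2 ^ j), s.mem⟩ :=
    hs.congr fun r _ h => by simp [show r ≠ 19 by omega]
  refine Runs.budget (Runs.seq (Runs.setReg (2 * 2 ^ j) ?_ (Runs.then_ (Q' := fun s' =>
      ∀ B < 2 * 2 ^ j, FixRep D (14 * 4 ^ (j + 1)) (s'.mem 11 B) (s'.mem 12 B) (twiddle B))
    (Runs.pairFill (n := 2 * 2 ^ j) (by simp) (by decide) hw (by decide) (by decide) (by decide)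
      (by decide) (by decide) (by decide) fun s' _ _ v1 v2 i hi => ?_) fun s' hf h => e3 s' ?_ ?_ ?_ ?_ h)))
    ?_
  · rw [eval_add, eval_reg, h16, ← two_mul]
    exact Nat.mod_eq_of_lt hw
  · rw [v1 i hi, v2 i hi]
    refine (fixRep_tableEntry (s := ⟨update (update s.reg 19 (2 * 2 ^ j)) 20 i, s.mem⟩) (j := j) (δ := 14 * 4 ^ j) (ε := 6 * 4 ^ j)
      ?_ (by omega) hw (by simp [h16]) (by simp)
      hi hj (by linarith) (by simpa using hρ) ht).mono ?_
    · exact hs.congr fun r _ h => by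
        simp [show r ≠ 20 by omega, show r ≠ 19 by omega]
    rw [pow_succ]
    linarith [one_le_pow₀ (M₀ := ℝ) (n := j) (show (1 : ℝ) ≤ 4 by norm_num)]
  · exact hs1.congr fun r h1 h2 => hf.reg r (by simp [pairFill_regs]; omega)
  · rw [hf.reg 17 (by decide)]; simp
  · rw [hf.reg 18 (by decide)]; simp
  · rw [hf.reg 19 (by decide)]; simp
  · have h1 : tableReE.cost = 36 := rfl
    have h2 : tableImE.cost = 34 := rfl
    simp only [h1, h2, cost_reg, cost_add]
    omega

lemma Runs.tableP {κ : ℕ} (hs : FixEnv w ((4 * 2 ^ κ) ^ 20) s) (h15 : s.reg 15 = 2 * 2 ^ κ) :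
    Runs w tableP s (1400 * (2 ^ κ * (κ + 1))) (MulEnv w (4 * 2 ^ κ)) := by
  set n := 4 * 2 ^ κ with hn
  set D := n ^ 20 with hD
  have hn2 : n = 2 ^ (κ + 2) := by rw [hn]; ring
  have hDd : D = 2 ^ ((κ + 2) * 20) := by rw [hD, hn2, ← pow_mul]
  have h1 : 1 ≤ 2 ^ κ := Nat.one_le_two_pow
  have hn4 : 4 ≤ n := by omega
  have hnD : n ^ 2 ≤ D := Nat.pow_le_pow_right (by omega) (by norm_num)
  have h9 : 9 < D := by nlinarith
  have hnw : n < 2 ^ w := by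
    refine lt_of_le_of_lt ?_ hs.lt
    have : D ≤ D ^ 3 := Nat.le_self_pow (by norm_num) D
    nlinarith
  have hnr : (n : ℝ) = 4 * 2 ^ κ := by rw [hn]; push_cast; rfl
  -- After `κ + 1` doublings the table has `n / 2` entries, and `4 ^ (κ + 1) = n ^ 2 / 4`.
  have h14 : ∀ j ≤ κ + 1, 14 * (4 : ℝ) ^ j ≤ (n : ℝ) ^ 2 * 4 := by
    intro j hj
    have h2 : (4 : ℝ) ^ j ≤ 4 ^ (κ + 1) := pow_le_pow_right₀ (by norm_num) hj
    have h3 : (n : ℝ) ^ 2 = 4 * 4 ^ (κ + 1) := by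
      rw [hnr, mul_pow, ← pow_mul, mul_comm κ, pow_mul]
      norm_num
      ring
    rw [h3]
    linarith [show (0 : ℝ) < 4 ^ (κ + 1) by positivity]
  have hn5 : (n : ℝ) ^ 2 * 4 ≤ (n : ℝ) ^ 5 := by
    have h4 : (4 : ℝ) ≤ n := by exact_mod_cast hn4
    calc (n : ℝ) ^ 2 * 4 ≤ (n : ℝ) ^ 2 * n ^ 1 := by rw [pow_one]; gcongr
      _ = (n : ℝ) ^ 3 := by ring
      _ ≤ (n : ℝ) ^ 5 := pow_le_pow_right₀ (by linarith) (by norm_num)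
  have hn5D : (n : ℝ) ^ 5 ≤ D := by
    rw [hD]
    push_cast
    exact pow_le_pow_right₀ (by exact_mod_cast (by omega : 1 ≤ n)) (by norm_num)
  have hloop : ∀ s', FixEnv w D s' → s'.reg 15 = 2 * 2 ^ κ → TableInv D 0 s' →
      Runs w (.whileNonzero (less (reg 16) (reg 15)) _root_.tableStepP) s'
        ((κ + 1) * (2 * 2 ^ κ * 122 + 23 * ((κ + 2) * 20) + 114) + 4) (MulEnv w n) := by
    intro s' hs' h15' hI
    refine Runs.budget ((Runs.whileNonzero (κ + 1) (fun _ => 2 * 2 ^ κ * 122 + 23 * ((κ + 2) * 20) + 110)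
      (TableInv D) hI ?_ ?_).mono fun s'' hf hI' => ?_) ?_
    · intro j hj s'' hf hI'
      have hj2 : 2 ^ j ≤ 2 ^ κ := Nat.pow_le_pow_right two_pos (by omega)
      refine ⟨?_, (Runs.tableStepP (D := D) (hs'.congr fun r h1 h2 => hf.reg r ?_) hDd h9
        (((h14 j (by omega)).trans hn5).trans hn5D) (by omega) hI').budget (by gcongr)⟩
      · have hlt : 2 ^ j < 2 * 2 ^ κ := by omega
        simp [hI'.r16, hf.reg 15 (by decide), h15', hlt, Nat.mod_eq_of_lt (show 1 < 2 ^ w by omega)]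
      · clear * - h1 h2
        have : _root_.tableStepP.regs = [19, 20, 20, 20, 20, 20, 20, 20, 20, 16, 23, 24, 25, 24, 25, 18, 17] :=
          rfl
        rw [this]
        simp
        omega
    · intro s'' hf hI'
      simp [hI'.r16, hf.reg 15 (by decide), h15', pow_succ']
    · refine ⟨hn4, ?_⟩
      have : FixEnv w D s'' := hs'.congr fun r h1 h2 => hf.reg r (by
        have : (Program.whileNonzero (less (reg 16) (reg 15)) _root_.tableStepP).regs
          = [19, 20, 20, 20, 20, 20, 20, 20, 20, 16, 23, 24, 25, 24, 25, 18, 17] := rfl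
        rw [this]
        simp
        omega)
      refine ⟨this, fun B hB => (hI'.tw B ?_).mono ((h14 _ le_rfl).trans hn5)⟩
      rw [pow_succ']
      omega
    · simp only [sum_const, card_range, smul_eq_mul, cost_less, cost_reg]
      ring_nf
      omega
  -- The first root is `exp (i π / 2) = i`, represented exactly by `0` and `D`.
  have hpi : Real.pi * (1 / 2) ^ (0 + 1) = Real.pi / 2 := by ring
  refine Runs.budget (Runs.seq (Runs.setCell 0 D (by simp) (by simp [hs.r6]) (Runs.seq
    (Runs.setCell 0 0 (by simp) (by simp) (Runs.seq (Runs.setReg 1 ?_ (Runs.seq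
    (Runs.setReg 0 (by simp) (Runs.seq (Runs.setReg D (by simp [hs.r6])
    (hloop _ ?_ (by simpa using h15) ⟨by simp, ?_, ?_, ?_⟩))))))))))) ?_
  · rw [eval_const]
    exact Nat.mod_eq_of_lt (by omega)
  · exact hs.congr fun r _ h => by
      simp [show r ≠ 16 by omega, show r ≠ 17 by omega, show r ≠ 18 by omega]
  · rw [hpi, Real.cos_pi_div_two]
    simp
  · rw [hpi, Real.sin_pi_div_two]
    simp
  · intro B hB
    obtain rfl : B = 0 := by simpa using hB
    refine ⟨D, 0, by simp, by simp, ?_⟩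
    simp [twiddle_zero]
  · simp only [cost_const, cost_reg]
    have h2 : κ + 1 ≤ 2 ^ κ := Nat.lt_two_pow_self
    have h3 : (κ + 1) * (κ + 1) ≤ 2 ^ κ * (κ + 1) := Nat.mul_le_mul_right _ h2
    have h4 : 2 ^ κ ≤ 2 ^ κ * (κ + 1) := Nat.le_mul_of_pos_right _ (by omega)
    ring_nf at h3 h4 ⊢
    omega

end TwiddleTable

/-! ### Computing the constants from the input -/

section Setup

open Finset Function WordExpr

/-- The field size, the length of the transforms, the constants of the fixed-point arithmetic and
the twiddle factors are computed from `n₁`. -/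
def setupP : Program :=
  .seq (.setReg 4 (reg 0 / const 2))
  (.seq (.setReg 5 (const 1))
  (.seq (.whileNonzero (less (reg 5) (reg 4)) (.setReg 5 (reg 5 + reg 5)))
  (.seq (.setReg 15 (reg 5 + reg 5))
  (.seq (.setReg 14 (reg 15 + reg 15))
  (.seq (.setReg 16 (reg 14 * reg 14))
  (.seq (.setReg 17 (reg 16 * reg 16))
  (.seq (.setReg 16 (reg 17 * reg 17))
  (.seq (.setReg 16 (reg 16 * reg 16))
  (.seq (.setReg 6 (reg 16 * reg 17))
  (.seq (.setReg 8 (reg 6 * reg 6 * reg 6))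
  (.seq (.setReg 7 (reg 8 + reg 8))
  (.seq (.setReg 9 (reg 7 - reg 6 * reg 6))
  (.seq (.setReg 10 (reg 7 - const 1)) tableP)))))))))))))

variable {w : ℕ} {s : RamState}

/-- The precision is formed by repeated squaring, `n ^ 20 = n ^ 16 * n ^ 4`. The modulus is the
power `2 ^ (60 * (κ + 2) + 1)` of two, so `hw` makes it a proper divisor of `2 ^ w`. -/
lemma Runs.setupP {t κ : ℕ} (h0 : s.reg 0 = 2 * t) (hw : 60 * (κ + 2) + 1 < w)
    (ht : t ≤ 2 ^ κ) (hκ : ∀ i < κ, 2 ^ i < t) :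
    Runs w setupP s (1500 * (2 ^ κ * (κ + 1))) fun s' =>
      s'.reg 4 = t ∧ s'.reg 5 = 2 ^ κ ∧ MulEnv w (4 * 2 ^ κ) s' := by
  set n := 4 * 2 ^ κ with hn
  set D := n ^ 20 with hD
  have hn2 : n = 2 ^ (κ + 2) := by rw [hn]; ring
  have hM : 2 * D ^ 3 = 2 ^ (60 * (κ + 2) + 1) := by
    rw [hD, hn2, ← pow_mul, ← pow_mul, ← pow_succ']
    congr 1
    ring
  have hlt : 2 * D ^ 3 < 2 ^ w := by
    rw [hM]
    exact Nat.pow_lt_pow_right (by norm_num) hw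
  have hdvd : 2 * D ^ 3 ∣ 2 ^ w := by
    rw [hM]
    exact pow_dvd_pow _ hw.le
  have h1 : 1 ≤ 2 ^ κ := Nat.one_le_two_pow
  have hpow : ∀ a ≤ 20, n ^ a ≤ D := fun a ha => Nat.pow_le_pow_right (by omega) ha
  have hD0 : 0 < D := by positivity
  have hD23 : D ^ 2 ≤ D ^ 3 := Nat.pow_le_pow_right hD0 (by norm_num)
  have hD13 : D ≤ D ^ 3 := Nat.le_self_pow (by norm_num) D
  have hmod : ∀ x, x ≤ 2 * D ^ 3 → x % 2 ^ w = x := fun x hx => Nat.mod_eq_of_lt (hx.trans_lt hlt)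
  have hmodn : ∀ a ≤ 20, n ^ a % 2 ^ w = n ^ a := fun a ha => hmod _ ((hpow a ha).trans (by omega))
  have hnD : n ≤ D := by simpa using hpow 1 (by norm_num)
  have e3 : ∀ s', s'.reg 4 = t → s'.reg 5 = 2 ^ κ → Runs w
      (.seq (.setReg 15 (reg 5 + reg 5))
      (.seq (.setReg 14 (reg 15 + reg 15))
      (.seq (.setReg 16 (reg 14 * reg 14))
      (.seq (.setReg 17 (reg 16 * reg 16))
      (.seq (.setReg 16 (reg 17 * reg 17))
      (.seq (.setReg 16 (reg 16 * reg 16))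
      (.seq (.setReg 6 (reg 16 * reg 17))
      (.seq (.setReg 8 (reg 6 * reg 6 * reg 6))
      (.seq (.setReg 7 (reg 8 + reg 8))
      (.seq (.setReg 9 (reg 7 - reg 6 * reg 6))
      (.seq (.setReg 10 (reg 7 - const 1)) _root_.tableP))))))))))) s'
      (1400 * (2 ^ κ * (κ + 1)) + 66) fun s' => s'.reg 4 = t ∧ s'.reg 5 = 2 ^ κ ∧ MulEnv w n s' := by
    intro s' h4 h5
    refine Runs.budget (Runs.seq (Runs.setReg (2 * 2 ^ κ) ?_ (Runs.seq (Runs.setReg n ?_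
      (Runs.seq (Runs.setReg (n ^ 2) ?_ (Runs.seq (Runs.setReg (n ^ 4) ?_
      (Runs.seq (Runs.setReg (n ^ 8) ?_ (Runs.seq (Runs.setReg (n ^ 16) ?_
      (Runs.seq (Runs.setReg D ?_ (Runs.seq (Runs.setReg (D ^ 3) ?_
      (Runs.seq (Runs.setReg (2 * D ^ 3) ?_ (Runs.seq (Runs.setReg (2 * D ^ 3 - D ^ 2) ?_
      (Runs.seq (Runs.setReg (2 * D ^ 3 - 1) ?_
      ((Runs.tableP (κ := κ) ⟨hD0, hdvd, hlt, ?_, ?_, ?_, ?_, ?_⟩ ?_).mono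
        fun s'' hf h => ⟨?_, ?_, h⟩))))))))))))))))))))))) ?_
    · rw [eval_add, eval_reg, h5, ← two_mul, hmod _ (by omega)]
    · simp only [eval_add, eval_reg, update_self]
      rw [hmod _ (by omega)]
      omega
    · simp only [eval_mul, eval_reg, update_self]
      rw [← pow_two, hmodn 2 (by norm_num)]
    · simp only [eval_mul, eval_reg, update_self]
      rw [← pow_add, hmodn _ (by norm_num)]
    · simp only [eval_mul, eval_reg, update_self]
      rw [← pow_add, hmodn _ (by norm_num)]
    · simp only [eval_mul, eval_reg, update_self]
      rw [← pow_add, hmodn _ (by norm_num)]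
    · simp only [eval_mul, eval_reg, update_self, update_of_ne (show (17 : ℕ) ≠ 16 by norm_num)]
      rw [← pow_add, hmodn _ (by norm_num)]
    · simp only [eval_mul, eval_reg, update_self]
      rw [← pow_two, hmod (D ^ 2) (by omega), ← pow_succ]
      exact hmod _ (Nat.le_mul_of_pos_left _ two_pos)
    · simp only [eval_add, eval_reg, update_self]
      rw [← two_mul, hmod _ le_rfl]
    · simp only [eval_mul, eval_sub, eval_reg, update_self, update_of_ne (show (6 : ℕ) ≠ 7 by norm_num),
        update_of_ne (show (6 : ℕ) ≠ 8 by norm_num)]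
      rw [← pow_two, hmod (D ^ 2) (by omega), hmod _ (by omega)]
    · simp only [eval_sub, eval_reg, eval_const, update_self, update_of_ne (show (7 : ℕ) ≠ 9 by norm_num)]
      rw [hmod 1 (by omega), hmod _ (by omega)]
    · simp [hD, hn]
    · simp [hD, hn]
    · simp [hD, hn]
    · simp [hD, hn]
    · simp [hD, hn]
    · simp
    · rw [hf.reg 4 (by decide)]
      simp [h4]
    · rw [hf.reg 5 (by decide)]
      simp [h5]
    · simp only [cost_add, cost_mul, cost_sub, cost_reg, cost_const]
      omega
  have h2w : 2 * 2 ^ κ < 2 ^ w := by omega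
  refine Runs.budget (Runs.seq (Runs.setReg t ?_ (Runs.seq (Runs.setReg 1 ?_
    (Runs.then_ (Runs.whileNonzero κ (fun _ => 4) (fun i s' => s'.reg 4 = t ∧ s'.reg 5 = 2 ^ i)
      ?_ ?_ ?_) fun s' _ h => e3 s' h.1 h.2))))) ?_
  · rw [eval_div, eval_reg, eval_const, h0, Nat.mod_eq_of_lt (show 2 < 2 ^ w by omega),
      Nat.mul_div_cancel_left _ two_pos]
    exact Nat.mod_eq_of_lt (by omega)
  · rw [eval_const]
    exact Nat.mod_eq_of_lt (by omega)
  · simp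
  · rintro i hi s' - ⟨h4, h5⟩
    refine ⟨by simp [h4, h5, hκ i hi, Nat.mod_eq_of_lt (show 1 < 2 ^ w by omega)],
      Runs.setReg (2 ^ (i + 1)) ?_ ⟨by simpa using h4, by simp⟩⟩
    have : 2 ^ (i + 1) ≤ 2 ^ κ := Nat.pow_le_pow_right two_pos hi
    rw [eval_add, eval_reg, h5, ← two_mul, ← pow_succ']
    exact Nat.mod_eq_of_lt (by omega)
  · rintro s' - ⟨h4, h5⟩
    simp [h4, h5, not_lt.2 ht]
  · simp only [sum_const, card_range, smul_eq_mul, cost_div, cost_less, cost_reg, cost_const]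
    have h2 : κ + 1 ≤ 2 ^ κ := Nat.lt_two_pow_self
    have h4 : 2 ^ κ ≤ 2 ^ κ * (κ + 1) := Nat.le_mul_of_pos_right _ (by omega)
    omega

end Setup

/-! ### Division by the modulus -/

section Reduction

open Polynomial

variable {P : (ZMod 2)[X]}

lemma degree_mul_lt_of_le {f g : (ZMod 2)[X]} {a b : ℕ} (hf : f.degree ≤ (a : WithBot ℕ)) (hg : g.degree < (b : WithBot ℕ)) :
    (f * g).degree < ((a + b : ℕ) : WithBot ℕ) := by
  rw [degree_mul]
  by_cases hf0 : f = 0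
  · simp [hf0]
  · push_cast
    exact WithBot.add_lt_add_of_le_of_lt (degree_ne_bot.2 hf0) hf hg

lemma degree_X_pow_mul_lt {f : (ZMod 2)[X]} {a b : ℕ} (hf : f.degree < (b : WithBot ℕ)) :
    (X ^ a * f).degree < ((a + b : ℕ) : WithBot ℕ) :=
  degree_mul_lt_of_le (degree_X_pow a).le hf

lemma degree_lt_of_X_pow_mul {f : (ZMod 2)[X]} {a b : ℕ} (hf : (X ^ a * f).degree < ((a + b : ℕ) : WithBot ℕ)) :
    f.degree < (b : WithBot ℕ) := by
  rw [degree_mul, degree_X_pow] at hf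
  push_cast at hf
  exact lt_of_add_lt_add_left hf

lemma coeff_divByMonic_X_pow (f : (ZMod 2)[X]) (k i : ℕ) :
    (f /ₘ X ^ k).coeff i = f.coeff (i + k) := by
  conv_rhs => rw [← modByMonic_add_div f (X ^ k), coeff_add, mul_comm, coeff_mul_X_pow]
  have : (f %ₘ X ^ k).coeff (i + k) = 0 := by
    refine coeff_eq_zero_of_degree_lt (lt_of_lt_of_le (degree_modByMonic_lt f (monic_X_pow k)) ?_)
    rw [degree_X_pow]
    exact_mod_cast Nat.le_add_left k i
  rw [this, zero_add]

/-- The approximation `⌊X ^ (t + s) / P⌋` of the inverse of the polynomial `P` of degree `t`. -/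
noncomputable def approxInv (P : (ZMod 2)[X]) (s : ℕ) : (ZMod 2)[X] := X ^ (P.natDegree + s) /ₘ P

lemma natDegree_approxInv (hP : P.Monic) (s : ℕ) : (approxInv P s).natDegree = s := by
  rw [approxInv, natDegree_divByMonic _ hP, natDegree_X_pow, Nat.add_sub_cancel_left]

/-- Uniqueness of division with remainder: a quotient is recognized by the degree of what it leaves.
-/
lemma eq_approxInv (hP : P.Monic) {s : ℕ} {Q : (ZMod 2)[X]}
    (h : (X ^ (P.natDegree + s) - P * Q).degree < (P.natDegree : WithBot ℕ)) : Q = approxInv P s := by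
  refine ((div_modByMonic_unique Q (X ^ (P.natDegree + s) - P * Q) hP ⟨by ring, ?_⟩).1).symm
  rwa [degree_eq_natDegree hP.ne_zero]

lemma degree_approxInv_rem (hP : P.Monic) (s : ℕ) :
    (X ^ (P.natDegree + s) - P * approxInv P s).degree < (P.natDegree : WithBot ℕ) := by
  have h := modByMonic_add_div (X ^ (P.natDegree + s)) P
  rw [approxInv, sub_eq_of_eq_add h.symm, ← degree_eq_natDegree hP.ne_zero]
  exact degree_modByMonic_lt _ hP

/-- The start of Newton's iteration. In the product of `P` with the right side the coefficient of
degree `P.natDegree` is a sum of two equal terms, which is zero in characteristic 2. -/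
lemma approxInv_one (hP : P.Monic) (h0 : 0 < P.natDegree) :
    approxInv P 1 = X + C (P.coeff (P.natDegree - 1)) := by
  refine (eq_approxInv hP ?_).symm
  rw [degree_lt_iff_coeff_zero]
  intro i hi
  obtain ⟨i, rfl⟩ : ∃ j, i = j + 1 := ⟨i - 1, by omega⟩
  rw [coeff_sub, mul_add, coeff_add, coeff_mul_X, coeff_mul_C, coeff_X_pow]
  rcases eq_or_lt_of_le hi with h | h
  · have h1 : P.natDegree - 1 = i := by omega
    have h2 : P.coeff (i + 1) = 1 := by rw [← h]; exact hP
    rw [if_neg (by omega), h1, h2, one_mul, CharTwo.add_self_eq_zero, sub_zero]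
  · have h2 : P.coeff (i + 1) = 0 := coeff_eq_zero_of_natDegree_lt h
    rcases eq_or_lt_of_le (show P.natDegree ≤ i by omega) with h' | h'
    · have : P.coeff i = 1 := by rw [← h']; exact hP
      rw [if_pos (by omega), h2, this]
      simp
    · rw [if_neg (by omega), h2, coeff_eq_zero_of_natDegree_lt h']
      simp

/-- Doubling the precision of the approximate inverse: the polynomial `P'` consists of the leading
coefficients of `P`. -/
lemma approxInv_two_mul (hP : P.Monic) {s a b : ℕ} {P' P'' : (ZMod 2)[X]}
    (hab : a + P.natDegree = b + 2 * s) (h : X ^ a * P = X ^ b * P' + P'') (h'' : P''.degree < (b : WithBot ℕ)) :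
    approxInv P (2 * s) = (approxInv P s ^ 2 * P') /ₘ X ^ (2 * s) := by
  set t := P.natDegree with ht
  set J := approxInv P s with hJ
  set R := X ^ (t + s) - P * J with hR
  set Q := (J ^ 2 * P') /ₘ X ^ (2 * s) with hQ
  set L := (J ^ 2 * P') %ₘ X ^ (2 * s) with hL
  have hRd : R.degree < (t : WithBot ℕ) := degree_approxInv_rem hP s
  have hLd : L.degree < ((2 * s : ℕ) : WithBot ℕ) := by
    have := degree_modByMonic_lt (J ^ 2 * P') (monic_X_pow (R := ZMod 2) (2 * s))
    rwa [degree_X_pow] at this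
  have hdiv : L + X ^ (2 * s) * Q = J ^ 2 * P' := modByMonic_add_div _ _
  have hPd : P.degree ≤ (t : WithBot ℕ) := degree_le_natDegree
  have hJd : J.degree ≤ (s : WithBot ℕ) := by
    rw [← natDegree_approxInv hP s]
    exact degree_le_natDegree
  have hJ2 : (J ^ 2).degree ≤ ((2 * s : ℕ) : WithBot ℕ) := by
    rw [degree_pow, two_nsmul, two_mul]
    push_cast
    exact add_le_add hJd hJd
  have h2 : (2 : (ZMod 2)[X]) = 0 := CharTwo.two_eq_zero
  -- In characteristic 2 the square of `R` is `X ^ (2 * (t + s)) - P ^ 2 * J ^ 2`, so `J ^ 2 * P` is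
  -- the Newton update. The further terms come from cutting `P` down to `P'` and from rounding the
  -- quotient. The factor `X ^ (a + t)` clears denominators and is cancelled in the degree bound.
  have key : X ^ (a + t) * (X ^ (t + 2 * s) - P * Q)
      = X ^ a * (R * R) + P * (J ^ 2 * P'' + X ^ b * L) := by
    have e1 : X ^ (a + t) * Q = J ^ 2 * (X ^ a * P - P'') - X ^ b * L := by
      have e3 : (X : (ZMod 2)[X]) ^ (a + t) = X ^ b * X ^ (2 * s) := by rw [hab, pow_add]
      rw [e3, h]
      linear_combination X ^ b * hdiv
    have e2 : (X : (ZMod 2)[X]) ^ (a + t) * X ^ (t + 2 * s) = X ^ a * (X ^ (t + s) * X ^ (t + s)) := by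
      rw [← pow_add, ← pow_add, ← pow_add]
      congr 1
      omega
    rw [mul_sub, e2, hR]
    linear_combination -P * e1 + (X ^ a * P * J * X ^ (t + s) - X ^ a * P ^ 2 * J ^ 2) * h2
  refine (eq_approxInv hP (degree_lt_of_X_pow_mul (a := a + t) ?_)).symm
  rw [key]
  refine (degree_add_le _ _).trans_lt (max_lt ?_ ?_)
  · have := degree_X_pow_mul_lt (a := a) (degree_mul_lt_of_le hRd.le hRd)
    rwa [← add_assoc] at this
  · have e4 : a + t + t = t + (b + 2 * s) := by omega
    rw [e4]
    refine degree_mul_lt_of_le hPd ((degree_add_le _ _).trans_lt (max_lt ?_ ?_))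
    · rw [add_comm b]
      exact degree_mul_lt_of_le hJ2 h''
    · exact degree_X_pow_mul_lt hLd

/-- Division with the help of the approximate inverse. -/
lemma modByMonic_eq_sub_mul (hP : P.Monic) {T : ℕ} (hT : P.natDegree ≤ T) {F : (ZMod 2)[X]}
    (hF : F.degree < ((P.natDegree + P.natDegree : ℕ) : WithBot ℕ)) :
    F %ₘ P = F - P * ((F /ₘ X ^ P.natDegree * approxInv P T) /ₘ X ^ T) := by
  set t := P.natDegree with ht
  set J := approxInv P T with hJ
  set R := X ^ (t + T) - P * J with hR
  set A := F /ₘ X ^ t with hA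
  set B := F %ₘ X ^ t with hB
  set q := (A * J) /ₘ X ^ T with hq
  set L := (A * J) %ₘ X ^ T with hL
  have hRd : R.degree < (t : WithBot ℕ) := degree_approxInv_rem hP T
  have hLd : L.degree < (T : WithBot ℕ) := by
    have := degree_modByMonic_lt (A * J) (monic_X_pow (R := ZMod 2) T)
    rwa [degree_X_pow] at this
  have hBd : B.degree < (t : WithBot ℕ) := by
    have := degree_modByMonic_lt F (monic_X_pow (R := ZMod 2) t)
    rwa [degree_X_pow] at this
  have h1 : L + X ^ T * q = A * J := modByMonic_add_div _ _
  have h2 : B + X ^ t * A = F := modByMonic_add_div _ _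
  have hAd : A.degree < (t : WithBot ℕ) := by
    refine degree_lt_of_X_pow_mul (a := t) ?_
    rw [← sub_eq_of_eq_add' h2.symm]
    refine (degree_sub_le _ _).trans_lt (max_lt hF (hBd.trans_le ?_))
    exact_mod_cast Nat.le_add_left t t
  have hPd : P.degree ≤ (t : WithBot ℕ) := degree_le_natDegree
  have hAT : A.degree ≤ (T : WithBot ℕ) := hAd.le.trans (by exact_mod_cast hT)
  -- Multiplied by `X ^ (T + t)`, the candidate remainder consists of the low part of `F`, the error
  -- `R` of the inverse and the rounding `L` of the quotient; each contribution has degree below `T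
  -- + t + t`.
  have key : X ^ (T + t) * (F - P * q) = X ^ (T + t) * B + X ^ t * (A * R + P * L) := by
    rw [hR, ← h2, pow_add, pow_add]
    linear_combination -P * X ^ t * h1
  refine (div_modByMonic_unique q (F - P * q) hP ⟨by ring, ?_⟩).2
  rw [degree_eq_natDegree hP.ne_zero]
  refine degree_lt_of_X_pow_mul (a := T + t) ?_
  rw [key]
  refine (degree_add_le _ _).trans_lt (max_lt (degree_X_pow_mul_lt hBd) ?_)
  rw [show T + t + t = t + (T + t) by ring]
  refine degree_X_pow_mul_lt ((degree_add_le _ _).trans_lt (max_lt ?_ ?_))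
  · exact degree_mul_lt_of_le hAT hRd
  · rw [add_comm T]
    exact degree_mul_lt_of_le hPd hLd

end Reduction

/-! ### Field multiplication on the word RAM -/

section FieldMultiplication

open Finset Function WordExpr
open Polynomial hiding eval_add eval_mul eval_sub

variable {w : ℕ} {s : RamState}

lemma MulEnv.lt {n : ℕ} (h : MulEnv w n s) : n < 2 ^ w := by
  refine lt_of_le_of_lt ?_ h.2.lt
  have h1 : n ≤ n ^ 20 := Nat.le_self_pow (by norm_num) n
  have h2 : n ^ 20 ≤ (n ^ 20) ^ 3 := Nat.le_self_pow (by norm_num) _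
  omega

/-- Sequential composition, with the budgets measured in units of `U` steps. -/
lemma Runs.chain {c₁ c₂ : Program} {Q Q' : RamState → Prop} {U a c : ℕ} (hU : 1 ≤ U)
    (hac : a + 1 ≤ c) (h : Runs w c₁ s (a * U) Q')
    (h' : ∀ s', Frame c₁ s s' → Q' s' → Runs w c₂ s' ((c - a - 1) * U) Q) :
    Runs w (c₁.seq c₂) s (c * U) Q := by
  refine (Runs.then_ h h').budget ?_
  obtain ⟨b, rfl⟩ := Nat.exists_eq_add_of_le hac
  rw [show a + 1 + b - a - 1 = b by omega]
  ring_nf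
  omega

lemma Runs.fillPoly {dst rb n U : ℕ} {e : WordExpr} {f : (ZMod 2)[X]} (hrb : s.reg rb = n)
    (hrb20 : rb ≠ 20) (hn : n < 2 ^ w) (hread : dst ∉ e.arrs) (hU : 1 ≤ U) (hnU : n ≤ 2 * U)
    (hcost : e.cost ≤ 20)
    (hv : ∀ i < n, e.eval w ⟨update s.reg 20 i, s.mem⟩ = (f.coeff i).val) :
    Runs w (_root_.fill dst rb e) s (80 * U) fun s' => HoldsPoly (s'.mem dst) n f := by
  refine (Runs.fill hrb hrb20 hn hread fun s' _ _ h _ i hi => (h i hi).trans (hv i hi)).budget ?_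
  calc n * (e.cost + 12) + 10 ≤ 2 * U * (20 + 12) + 10 := by gcongr
    _ ≤ 80 * U := by omega

/-- The data needed for multiplications in the field `𝔽₂[X] / (P)`. -/
structure FieldEnv (w κ : ℕ) (P : (ZMod 2)[X]) (s : RamState) : Prop where
  r4 : s.reg 4 = P.natDegree
  r5 : s.reg 5 = 2 ^ κ
  r11 : s.reg 11 = 2 * 2 ^ κ
  mul : MulEnv w (4 * 2 ^ κ) s
  m0 : ∀ i, s.mem 0 i = (P.coeff i).val
  m13 : HoldsPoly (s.mem 13) (2 * 2 ^ κ) (approxInv P (2 ^ κ))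

lemma MulEnv.of_frame {n : ℕ} {c : Program} {s' : RamState} (h : MulEnv w n s) (hf : Frame c s s')
    (hr : ∀ r ∈ [6, 7, 8, 9, 10], r ∉ c.regs) (ha : ∀ a ∈ [11, 12], a ∉ c.arrs) : MulEnv w n s' :=
  ⟨h.1, h.2.of_frame hf hr (ha _ (by simp)) (ha _ (by simp))⟩

lemma FieldEnv.of_frame {κ : ℕ} {P : (ZMod 2)[X]} {c : Program} {s' : RamState}
    (h : FieldEnv w κ P s) (hf : Frame c s s')
    (hr : ∀ r ∈ [4, 5, 6, 7, 8, 9, 10, 11], r ∉ c.regs) (ha : ∀ a ∈ [0, 11, 12, 13], a ∉ c.arrs) :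
    FieldEnv w κ P s' :=
  ⟨by rw [hf.reg _ (hr _ (by simp)), h.r4], by rw [hf.reg _ (hr _ (by simp)), h.r5],
    by rw [hf.reg _ (hr _ (by simp)), h.r11],
    h.mul.of_frame hf (fun r h => hr r (by simp at h ⊢; omega)) fun a h => ha a (by simp at h ⊢; omega),
    by rw [hf.mem _ (ha _ (by simp))]; exact h.m0, by rw [hf.mem _ (ha _ (by simp))]; exact h.m13⟩

/-- The product in the field of the elements in the arrays `4` and `5` is written to array `4`. -/
def fieldMulP : Program :=
  .seq mulP
  (.seq (fill 14 11 (cell 6 (reg 20)))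
  (.seq (fill 4 11 (cell 6 (reg 20 + reg 4)))
  (.seq (fill 5 11 (cell 13 (reg 20)))
  (.seq mulP
  (.seq (fill 4 11 (cell 6 (reg 20 + reg 5)))
  (.seq (fill 5 11 (cell 0 (reg 20)))
  (.seq mulP (fill 4 11 (bxor (cell 14 (reg 20)) (cell 6 (reg 20)))))))))))

lemma HoldsPoly.mono {a : ℕ → ℕ} {m n : ℕ} {f : (ZMod 2)[X]} (h : HoldsPoly a n f) (hm : m ≤ n) :
    HoldsPoly a m f := fun i hi => h i (hi.trans_le hm)

/-- Three polynomial products: `f * g`, its upper part times the approximate inverse of `P`, which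
gives the quotient, and the quotient times `P`. -/
lemma Runs.fieldMulP {κ : ℕ} {P f g : (ZMod 2)[X]} (hP : P.Monic) (ht0 : 0 < P.natDegree)
    (ht : P.natDegree ≤ 2 ^ κ) (hs : FieldEnv w κ P s)
    (hf : HoldsPoly (s.mem 4) (2 * 2 ^ κ) f) (hfd : f.natDegree < P.natDegree)
    (hg : HoldsPoly (s.mem 5) (2 * 2 ^ κ) g) (hgd : g.natDegree < P.natDegree) :
    Runs w fieldMulP s (48500 * (2 ^ κ * (κ + 1)))
      fun s' => HoldsPoly (s'.mem 4) (2 * 2 ^ κ) ((f * g) %ₘ P) := by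
  set U := 2 ^ κ * (κ + 1) with hU
  have hU1 : 1 ≤ U := Nat.succ_le_of_lt (by positivity)
  have hnU : 2 * 2 ^ κ ≤ 2 * U := Nat.mul_le_mul_left _ (Nat.le_mul_of_pos_right _ (by omega))
  have hlt := hs.mul.lt
  set t := P.natDegree with ht'
  set T := 2 ^ κ with hT
  have hTT : 2 ^ (κ + 1) = 2 * T := pow_succ' 2 κ
  set J := approxInv P T with hJ
  -- `J` has `T + 1` coefficients, one too many for arrays of length `T`; the factors are therefore
  -- stored with length `2 * T`.
  have hJd : J.natDegree = T := natDegree_approxInv hP T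
  set F := f * g with hF
  have hFd : F.natDegree < 2 * t := (natDegree_mul_le).trans_lt (by omega)
  set A := F /ₘ X ^ t with hA
  have hAd : A.natDegree < t := by
    rw [hA, natDegree_divByMonic _ (monic_X_pow t), natDegree_X_pow]
    omega
  set q := (A * J) /ₘ X ^ T with hq
  have hqd : q.natDegree < t := by
    rw [hq, natDegree_divByMonic _ (monic_X_pow T), natDegree_X_pow]
    have : (A * J).natDegree ≤ A.natDegree + J.natDegree := natDegree_mul_le
    omega
  have hFr : F %ₘ P = F - P * q := by
    refine modByMonic_eq_sub_mul hP ht ?_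
    refine degree_le_natDegree.trans_lt ?_
    rw [← two_mul]
    exact_mod_cast hFd
  have hmul : ∀ {s p r}, FieldEnv w κ P s → HoldsPoly (s.mem 4) (2 * T) p →
      HoldsPoly (s.mem 5) (2 * T) r → p.natDegree < 2 * T → r.natDegree < 2 * T →
      Runs w _root_.mulP s (16000 * U) fun s' => HoldsPoly (s'.mem 6) (4 * T) (p * r) := by
    intro s p r hs hp hr hpd hrd
    refine ((Runs.mulP (κ := κ + 1) hs.mul (by rw [hs.r11, hTT]) (by omega) (by rwa [hTT])
      (by rwa [hTT]) (by rwa [hTT]) (by rwa [hTT])).budget ?_).mono fun s' _ h => h.mono ?_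
    · have : 2 ^ (κ + 1) * (κ + 1 + 1) ≤ 4 * U := by
        rw [hTT, hU]
        nlinarith [Nat.zero_le (T * κ)]
      omega
    · omega
  refine Runs.chain hU1 (by norm_num) (hmul hs hf hg (by omega) (by omega)) fun s1 hf1 h1 => ?_
  replace hs := hs.of_frame hf1 (by decide) (by decide)
  refine Runs.chain hU1 (by norm_num) (Runs.fillPoly (f := F) hs.r11 (by decide) (by omega)
    (by decide) hU1 hnU (by decide) ?_) fun s2 hf2 h2 => ?_
  · intro i hi
    simpa using h1 i (by omega)
  replace hs := hs.of_frame hf2 (by decide) (by decide)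
  rw [← hf2.mem 6 (by decide)] at h1
  refine Runs.chain hU1 (by norm_num) (Runs.fillPoly (f := A) hs.r11 (by decide) (by omega)
    (by decide) hU1 hnU (by decide) ?_) fun s3 hf3 h3 => ?_
  · intro i hi
    have : (i + t) % 2 ^ w = i + t := Nat.mod_eq_of_lt (by omega)
    simp only [eval_cell, WordExpr.eval_add, eval_reg, update_self,
      update_of_ne (show (4 : ℕ) ≠ 20 by norm_num), hs.r4]
    rw [this, hA, coeff_divByMonic_X_pow, h1 _ (by omega)]
  replace hs := hs.of_frame hf3 (by decide) (by decide)
  rw [← hf3.mem 14 (by decide)] at h2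
  refine Runs.chain hU1 (by norm_num) (Runs.fillPoly (f := J) hs.r11 (by decide) (by omega)
    (by decide) hU1 hnU (by decide) ?_) fun s4 hf4 h4 => ?_
  · intro i hi
    simpa using hs.m13 i hi
  replace hs := hs.of_frame hf4 (by decide) (by decide)
  rw [← hf4.mem 14 (by decide)] at h2
  rw [← hf4.mem 4 (by decide)] at h3
  refine Runs.chain hU1 (by norm_num) (hmul hs h3 h4 (by omega) (by omega)) fun s5 hf5 h5 => ?_
  replace hs := hs.of_frame hf5 (by decide) (by decide)
  rw [← hf5.mem 14 (by decide)] at h2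
  refine Runs.chain hU1 (by norm_num) (Runs.fillPoly (f := q) hs.r11 (by decide) (by omega)
    (by decide) hU1 hnU (by decide) ?_) fun s6 hf6 h6 => ?_
  · intro i hi
    have : (i + T) % 2 ^ w = i + T := Nat.mod_eq_of_lt (by omega)
    simp only [eval_cell, WordExpr.eval_add, eval_reg, update_self,
      update_of_ne (show (5 : ℕ) ≠ 20 by norm_num), hs.r5]
    rw [this, hq, coeff_divByMonic_X_pow, h5 _ (by omega)]
  replace hs := hs.of_frame hf6 (by decide) (by decide)
  rw [← hf6.mem 14 (by decide)] at h2
  refine Runs.chain hU1 (by norm_num) (Runs.fillPoly (f := P) hs.r11 (by decide) (by omega)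
    (by decide) hU1 hnU (by decide) ?_) fun s7 hf7 h7 => ?_
  · intro i hi
    simpa using hs.m0 i
  replace hs := hs.of_frame hf7 (by decide) (by decide)
  rw [← hf7.mem 14 (by decide)] at h2
  rw [← hf7.mem 4 (by decide)] at h6
  refine Runs.chain hU1 (by norm_num) (hmul hs h6 h7 (by omega) (by omega)) fun s8 hf8 h8 => ?_
  replace hs := hs.of_frame hf8 (by decide) (by decide)
  rw [← hf8.mem 14 (by decide)] at h2
  refine (Runs.fillPoly (f := F %ₘ P) hs.r11 (by decide) (by omega)
    (by decide) hU1 hnU (by decide) ?_).budget (Nat.mul_le_mul_right _ (by norm_num))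
  intro i hi
  have hxor : ∀ a b : ZMod 2, a.val ^^^ b.val = (a - b).val := by decide
  simp only [eval_bxor, eval_cell, eval_reg, update_self]
  rw [h2 i hi, h8 i (by omega), hxor, hFr, mul_comm P, coeff_sub]
  exact Nat.mod_eq_of_lt ((ZMod.val_lt _).trans_le (by omega))

end FieldMultiplication

/-! ### The approximate inverse of the modulus -/

section ApproximateInverse

open Finset Function WordExpr
open Polynomial hiding eval_add eval_mul eval_sub

variable {w : ℕ} {s : RamState}

/-- One round of the Newton iteration: the precision, which is in register `14`, is doubled. -/
def newtonStepP : Program :=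
  .seq (.setReg 17 (reg 14 + reg 14))
  (.seq (.setReg 11 (reg 17 + reg 17))
  (.seq (fill 4 11 ((const 1 - reg 20 % const 2) * cell 13 (reg 20 / const 2)))
  (.seq (fill 5 11 (less (reg 17) (reg 20 + reg 4 + const 1) * cell 0 (reg 20 + reg 4 - reg 17)))
  (.seq mulP
  (.seq (fill 13 11 (cell 6 (reg 20 + reg 17))) (.setReg 14 (reg 17)))))))

/-- The approximate inverse of the modulus is written to array `13`. -/
def newtonP : Program :=
  .seq (.setReg 14 (const 1))
  (.seq (.setReg 17 (reg 5 + reg 5))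
  (.seq (fill 13 17 (less (reg 20) (const 1) * cell 0 (reg 4 - const 1)
    + less (const 0) (reg 20) * less (reg 20) (const 2)))
  (.seq (.whileNonzero (less (reg 14) (reg 5)) newtonStepP) (.setReg 11 (reg 5 + reg 5)))))

/-- The input of the Newton iteration. -/
structure NewtonEnv (w κ : ℕ) (P : (ZMod 2)[X]) (s : RamState) : Prop where
  r4 : s.reg 4 = P.natDegree
  r5 : s.reg 5 = 2 ^ κ
  mul : MulEnv w (4 * 2 ^ κ) s
  m0 : ∀ i, s.mem 0 i = (P.coeff i).val

lemma NewtonEnv.of_frame {κ : ℕ} {P : (ZMod 2)[X]} {c : Program} {s' : RamState}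
    (h : NewtonEnv w κ P s) (hf : Frame c s s')
    (hr : ∀ r ∈ [4, 5, 6, 7, 8, 9, 10], r ∉ c.regs) (ha : ∀ a ∈ [0, 11, 12], a ∉ c.arrs) :
    NewtonEnv w κ P s' :=
  ⟨by rw [hf.reg _ (hr _ (by simp)), h.r4], by rw [hf.reg _ (hr _ (by simp)), h.r5],
    h.mul.of_frame hf (fun r h => hr r (by simp at h ⊢; omega)) fun a h => ha a (by simp at h ⊢; omega),
    by rw [hf.mem _ (ha _ (by simp))]; exact h.m0⟩

/-- The precision and the approximate inverse after `j` rounds. -/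
def NewtonInv (P : (ZMod 2)[X]) (j : ℕ) (s : RamState) : Prop :=
  s.reg 14 = 2 ^ j ∧ HoldsPoly (s.mem 13) (2 * 2 ^ j) (approxInv P (2 ^ j))

/-- Squaring is the Frobenius map, which only spreads the coefficients, so the square in the Newton
step needs no multiplication. -/
lemma coeff_sq (f : (ZMod 2)[X]) (i : ℕ) :
    (f ^ 2).coeff i = if i % 2 = 0 then f.coeff (i / 2) else 0 := by
  rw [← ZMod.expand_card, coeff_expand two_pos]
  simp only [Nat.dvd_iff_mod_eq_zero]

/-- Only the leading coefficients of `P` enter, so the cost is proportional to the current precision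
`2 ^ j`, up to a logarithm. -/
lemma Runs.newtonStepP {κ j : ℕ} {P : (ZMod 2)[X]} (hP : P.Monic) (ht : P.natDegree ≤ 2 ^ κ)
    (hj : j < κ) (hs : NewtonEnv w κ P s) (hI : NewtonInv P j s) :
    Runs w newtonStepP s (16300 * (2 ^ j * (κ + 2))) (NewtonInv P (j + 1)) := by
  obtain ⟨h14, h13⟩ := hI
  set U := 2 ^ j * (κ + 2) with hU
  have h1j : 1 ≤ 2 ^ j := Nat.one_le_two_pow
  have hjκ : 2 * 2 ^ j ≤ 2 ^ κ := by
    rw [← pow_succ']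
    exact Nat.pow_le_pow_right two_pos hj
  have hU2 : 2 * 2 ^ j ≤ U := by
    rw [hU, mul_comm]
    exact Nat.mul_le_mul_left _ (by omega)
  have hU1 : 1 ≤ U := by omega
  have hlt := hs.mul.lt
  set t := P.natDegree with ht'
  set m := 2 ^ j with hm
  set J := approxInv P m with hJ
  have hJd : J.natDegree = m := natDegree_approxInv hP m
  have hJ2 : (J ^ 2).natDegree < 4 * m := by
    rw [natDegree_pow, hJd]
    omega
  -- Truncated subtraction makes at least one of `a`, `b` zero: `P` is shifted up if it is shorter
  -- than the precision and cut down if it is longer.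
  set a := 2 * m - t with ha
  set b := t - 2 * m with hb
  set P' := (X ^ a * P) /ₘ X ^ b with hP'
  have hP'd : P'.natDegree < 4 * m := by
    rw [hP', natDegree_divByMonic _ (monic_X_pow b), natDegree_X_pow,
      natDegree_mul (pow_ne_zero _ X_ne_zero) hP.ne_zero, natDegree_X_pow]
    omega
  have hnewton : approxInv P (2 * m) = (J ^ 2 * P') /ₘ X ^ (2 * m) := by
    refine approxInv_two_mul hP (a := a) (b := b) (P'' := (X ^ a * P) %ₘ X ^ b) (by omega) ?_ ?_
    · rw [add_comm]
      exact (modByMonic_add_div _ _).symm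
    · have := degree_modByMonic_lt (X ^ a * P) (monic_X_pow (R := ZMod 2) b)
      rwa [degree_X_pow] at this
  have h2w : 2 < 2 ^ w := by omega
  refine Runs.chain (a := 4) (Q' := fun s' => s'.reg 17 = 2 * m) hU1 (by norm_num)
    ((Runs.setReg (2 * m) ?_ (by simp)).budget (Nat.mul_le_mul_left 4 hU1)) fun s1 hf1 h17 => ?_
  · rw [WordExpr.eval_add, eval_reg, h14, ← two_mul]
    exact Nat.mod_eq_of_lt (by omega)
  replace hs := hs.of_frame hf1 (by decide) (by decide)
  rw [← hf1.mem 13 (by decide)] at h13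
  refine Runs.chain (a := 4) (Q' := fun s' => s'.reg 11 = 4 * m) hU1 (by norm_num)
    ((Runs.setReg (4 * m) ?_ (by simp)).budget (Nat.mul_le_mul_left 4 hU1)) fun s2 hf2 h11 => ?_
  · rw [WordExpr.eval_add, eval_reg, h17, ← two_mul, ← mul_assoc]
    exact Nat.mod_eq_of_lt (by omega)
  replace hs := hs.of_frame hf2 (by decide) (by decide)
  rw [← hf2.mem 13 (by decide)] at h13
  rw [← hf2.reg 17 (by decide)] at h17
  refine Runs.chain hU1 (by norm_num) (Runs.fillPoly (f := J ^ 2) h11 (by decide) (by omega)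
    (by decide) hU1 (by omega) (by decide) ?_) fun s3 hf3 h3 => ?_
  · intro i hi
    simp only [WordExpr.eval_mul, WordExpr.eval_sub, eval_mod, eval_div, eval_cell, eval_reg,
      eval_const, update_self]
    rw [Nat.mod_eq_of_lt h2w, Nat.mod_eq_of_lt (a := 1) (by omega),
      Nat.mod_eq_of_lt (a := i / 2) (by omega), Nat.mod_eq_of_lt (a := i % 2) (by omega),
      h13 _ (by omega), coeff_sq, Nat.mod_eq_of_lt (a := 1 - i % 2) (by omega)]
    have hval : (J.coeff (i / 2)).val < 2 ^ w := (ZMod.val_lt _).trans h2w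
    rcases Nat.mod_two_eq_zero_or_one i with h | h
    · simp [h, Nat.mod_eq_of_lt hval]
    · simp [h]
  replace hs := hs.of_frame hf3 (by decide) (by decide)
  rw [← hf3.reg 17 (by decide)] at h17
  rw [← hf3.reg 11 (by decide)] at h11
  refine Runs.chain hU1 (by norm_num) (Runs.fillPoly (f := P') h11 (by decide) (by omega)
    (by decide) hU1 (by omega) (by decide) ?_) fun s4 hf4 h4 => ?_
  · intro i hi
    simp only [WordExpr.eval_mul, WordExpr.eval_sub, WordExpr.eval_add, eval_less, eval_cell, eval_reg,
      eval_const, update_self, update_of_ne (show (17 : ℕ) ≠ 20 by norm_num),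
      update_of_ne (show (4 : ℕ) ≠ 20 by norm_num), h17, hs.r4, hs.m0]
    rw [Nat.mod_eq_of_lt (a := 1) (by omega), Nat.mod_eq_of_lt (a := i + t) (by omega),
      Nat.mod_eq_of_lt (a := i + t + 1) (by omega), Nat.mod_eq_of_lt (a := i + t - 2 * m) (by omega),
      hP', coeff_divByMonic_X_pow, coeff_X_pow_mul']
    have hval : (P.coeff (i + t - 2 * m)).val < 2 ^ w := (ZMod.val_lt _).trans h2w
    by_cases h : 2 * m ≤ i + t
    · rw [if_pos (by omega), if_pos (by omega), Nat.mod_eq_of_lt (a := 1) (by omega), one_mul,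
        Nat.mod_eq_of_lt hval]
      congr 2
      omega
    · rw [if_neg (by omega), if_neg (by omega)]
      simp
  replace hs := hs.of_frame hf4 (by decide) (by decide)
  rw [← hf4.reg 17 (by decide)] at h17
  rw [← hf4.reg 11 (by decide)] at h11
  rw [← hf4.mem 4 (by decide)] at h3
  have h4m : 2 ^ (j + 2) = 4 * m := by
    rw [hm]
    ring
  refine Runs.chain hU1 (a := 16000) (by norm_num) ((Runs.mulP (κ := j + 2) hs.mul (by rw [h11, h4m])
    (by omega) (by rwa [h4m]) (by rwa [h4m]) (by rwa [h4m]) (by rwa [h4m])).budget ?_)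
    fun s5 hf5 h5 => ?_
  · rw [h4m, hU]
    have : m * (j + 2 + 1) ≤ m * (κ + 2) := Nat.mul_le_mul_left _ (by omega)
    nlinarith
  rw [← hf5.reg 17 (by decide)] at h17
  rw [← hf5.reg 11 (by decide)] at h11
  refine Runs.chain hU1 (by norm_num) (Runs.fillPoly (f := approxInv P (2 * m)) h11 (by decide)
    (by omega) (by decide) hU1 (by omega) (by decide) ?_) fun s6 hf6 h6 => ?_
  · intro i hi
    have : (i + 2 * m) % 2 ^ w = i + 2 * m := Nat.mod_eq_of_lt (by omega)
    simp only [eval_cell, WordExpr.eval_add, eval_reg, update_self,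
      update_of_ne (show (17 : ℕ) ≠ 20 by norm_num), h17]
    rw [this, hnewton, coeff_divByMonic_X_pow, h5 _ (by omega)]
  rw [← hf6.reg 17 (by decide)] at h17
  have h2m : 2 ^ (j + 1) = 2 * m := pow_succ' 2 j
  refine (Runs.setReg (2 * m) (by simp [h17]) ⟨by simp [h2m], ?_⟩).budget ?_
  · simp only [cost_reg]
    omega
  · rw [h2m]
    exact h6.mono (by omega)

lemma sum_two_pow_lt (k : ℕ) : ∑ i ∈ range k, 2 ^ i < 2 ^ k := by
  induction k with
  | zero => simp
  | succ k ih =>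
    rw [sum_range_succ, pow_succ]
    omega

lemma Runs.newtonP {κ : ℕ} {P : (ZMod 2)[X]} (hP : P.Monic) (ht0 : 0 < P.natDegree)
    (ht : P.natDegree ≤ 2 ^ κ) (hs : NewtonEnv w κ P s) :
    Runs w newtonP s (33000 * (2 ^ κ * (κ + 1))) (FieldEnv w κ P) := by
  set U := 2 ^ κ * (κ + 1) with hU
  have h1κ : 1 ≤ 2 ^ κ := Nat.one_le_two_pow
  have hU1 : 1 ≤ U := Nat.succ_le_of_lt (by positivity)
  have hnU : 2 ^ κ ≤ U := Nat.le_mul_of_pos_right _ (by omega)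
  have hlt := hs.mul.lt
  have h2w : 2 < 2 ^ w := by omega
  refine Runs.chain (a := 2) (Q' := fun s' => s'.reg 14 = 1) hU1 (by norm_num)
    ((Runs.setReg 1 ?_ (by simp)).budget (Nat.mul_le_mul_left 2 hU1)) fun s1 hf1 h14 => ?_
  · rw [eval_const]
    exact Nat.mod_eq_of_lt (by omega)
  replace hs := hs.of_frame hf1 (by decide) (by decide)
  refine Runs.chain (a := 4) (Q' := fun s' => s'.reg 17 = 2 * 2 ^ κ) hU1 (by norm_num)
    ((Runs.setReg (2 * 2 ^ κ) ?_ (by simp)).budget (Nat.mul_le_mul_left 4 hU1)) fun s2 hf2 h17 => ?_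
  · rw [WordExpr.eval_add, eval_reg, hs.r5, ← two_mul]
    exact Nat.mod_eq_of_lt (by omega)
  replace hs := hs.of_frame hf2 (by decide) (by decide)
  rw [← hf2.reg 14 (by decide)] at h14
  refine Runs.chain hU1 (by norm_num) (Runs.fillPoly (f := approxInv P 1) h17 (by decide) (by omega)
    (by decide) hU1 (by omega) (by decide) ?_) fun s3 hf3 h3 => ?_
  · intro i hi
    simp only [WordExpr.eval_mul, WordExpr.eval_sub, WordExpr.eval_add, eval_less, eval_cell, eval_reg,
      eval_const, update_self, update_of_ne (show (4 : ℕ) ≠ 20 by norm_num), hs.r4, hs.m0]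
    rw [Nat.mod_eq_of_lt h2w, Nat.mod_eq_of_lt (a := 1) (by omega), Nat.zero_mod,
      Nat.mod_eq_of_lt (a := P.natDegree - 1) (by omega), approxInv_one hP ht0, coeff_add, coeff_X,
      coeff_C]
    have hval : (P.coeff (P.natDegree - 1)).val < 2 ^ w := (ZMod.val_lt _).trans h2w
    have h1w : 1 % 2 ^ w = 1 := Nat.mod_eq_of_lt (by omega)
    match i with
    | 0 => simp [h1w, Nat.mod_eq_of_lt hval]
    | 1 => simp [h1w]; rfl
    | i + 2 => simp
  replace hs := hs.of_frame hf3 (by decide) (by decide)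
  rw [← hf3.reg 14 (by decide)] at h14
  refine Runs.chain (Q' := fun s' => NewtonInv P κ s') hU1 (a := 32800) (by norm_num)
    ((Runs.whileNonzero κ (fun j => 16300 * (2 ^ j * (κ + 2))) (NewtonInv P)
      ⟨by simpa using h14, by simpa using h3.mono (by omega)⟩ ?_ ?_).budget ?_) fun s4 hf4 h4 => ?_
  · intro j hj s' hf hI
    replace hs := hs.of_frame hf (by decide) (by decide)
    have hlt' : 2 ^ j < 2 ^ κ := Nat.pow_lt_pow_right (by norm_num) hj
    exact ⟨by simp [hI.1, hs.r5, hlt', Nat.mod_eq_of_lt (show 1 < 2 ^ w by omega)],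
      Runs.newtonStepP hP ht hj hs hI⟩
  · intro s' hf hI
    replace hs := hs.of_frame hf (by decide) (by decide)
    simp [hI.1, hs.r5]
  -- The costs of the rounds form a geometric series, so the iteration costs no more than a constant
  -- number of full multiplications.
  · have h5 := sum_two_pow_lt κ
    have h6 : ∑ j ∈ range κ, (16300 * (2 ^ j * (κ + 2)) + 4)
        = 16300 * (κ + 2) * (∑ j ∈ range κ, 2 ^ j) + κ * 4 := by
      rw [sum_add_distrib, sum_const, card_range, smul_eq_mul, mul_sum]
      congr 1
      exact sum_congr rfl fun j _ => by ring
    have h7 : κ < 2 ^ κ := Nat.lt_two_pow_self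
    have h8 : 16300 * (κ + 2) * (∑ j ∈ range κ, 2 ^ j) ≤ 16300 * (κ + 2) * 2 ^ κ :=
      Nat.mul_le_mul_left _ h5.le
    have h9 : (κ + 2) * 2 ^ κ ≤ 2 * U := by
      rw [hU]
      nlinarith [Nat.zero_le (κ * 2 ^ κ)]
    simp only [cost_less, cost_reg]
    change ∑ j ∈ range κ, (16300 * (2 ^ j * (κ + 2)) + 4) + 4 ≤ _
    rw [h6]
    nlinarith
  replace hs := hs.of_frame hf4 (by decide) (by decide)
  refine (Runs.setReg (2 * 2 ^ κ) ?_ ⟨?_, ?_, by simp, ⟨hs.mul.1, ?_⟩, hs.m0, h4.2⟩).budget ?_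
  · rw [WordExpr.eval_add, eval_reg, hs.r5, ← two_mul]
    exact Nat.mod_eq_of_lt (by omega)
  · simp only [cost_reg, cost_add]
    omega
  · simp [hs.r4]
  · simp [hs.r5]
  · exact hs.mul.2.congr (fun r _ h => by simp [show r ≠ 11 by omega]) rfl rfl

end ApproximateInverse

/-! ### The extractor on the word RAM -/

section Extraction

open Finset Function WordExpr
open Polynomial hiding eval_add eval_mul eval_sub

variable {w : ℕ} {s : RamState}

/-- The sum of the first `2 ^ (l + 1)` powers is `1 + z ^ (2 ^ l)` times the sum of the first `2 ^
l`, and in characteristic 2 this factor is `(1 + z) ^ (2 ^ l)`. Thus `l` squarings replace `2 ^ l`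
terms. -/
lemma sum_pow_eq_prod {R : Type*} [CommSemiring R] [CharP R 2] (z : R) (l : ℕ) :
    ∑ i ∈ range (2 ^ l), z ^ i = ∏ j ∈ range l, (1 + z) ^ 2 ^ j := by
  have : Fact (Nat.Prime 2) := ⟨Nat.prime_two⟩
  induction l with
  | zero => simp
  | succ l ih =>
    rw [prod_range_succ, ← ih, add_pow_char_pow, one_pow, pow_succ, mul_two, sum_range_add]
    simp only [pow_add]
    rw [← mul_sum]
    ring

lemma modByMonic_congr {P f g : (ZMod 2)[X]} (hP : P.Monic)
    (h : AdjoinRoot.mk P f = AdjoinRoot.mk P g) : f %ₘ P = g %ₘ P := by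
  rw [← AdjoinRoot.modByMonicHom_mk hP, h, AdjoinRoot.modByMonicHom_mk]

lemma mk_modByMonic {P : (ZMod 2)[X]} (hP : P.Monic) (f : (ZMod 2)[X]) :
    AdjoinRoot.mk P (f %ₘ P) = AdjoinRoot.mk P f := by
  rw [← AdjoinRoot.modByMonicHom_mk hP, AdjoinRoot.mk_leftInverse hP]

/-- The polynomial whose coefficients are the given bits. -/
noncomputable def bitsPoly {n : ℕ} (b : Bits n) : (ZMod 2)[X] :=
  ∑ i : Fin n, C (b i) * X ^ (i : ℕ)

lemma bitArray_eq {n : ℕ} (b : Bits n) (i : ℕ) : bitArray b i = ((bitsPoly b).coeff i).val := by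
  rw [bitsPoly, coeff_sum_bits, bitArray]
  split_ifs <;> rfl

lemma natDegree_bitsPoly_lt {n t : ℕ} (b : Bits n) (ht : 0 < t) (hn : n ≤ t) :
    (bitsPoly b).natDegree < t := by
  by_cases h : bitsPoly b = 0
  · simpa [h]
  · rw [natDegree_lt_iff_degree_lt h]
    exact (degree_sum_bits_lt b).trans_le (by exact_mod_cast hn)

/-- The base `u` matters only modulo `P`; the program uses 1 plus the reduced product. -/
lemma razExtractor_apply {P : (ZMod 2)[X]} (hP : P.Monic) {n₁ n₂ m l : ℕ} (hm : m ≤ n₁ / 2)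
    (x : Bits n₁) (y : Bits n₂) (i : Fin m) {u : (ZMod 2)[X]}
    (hu : AdjoinRoot.mk P u = AdjoinRoot.mk P (1 + bitsPoly y * bitsPoly (firstHalf x))) :
    razExtractor hP (ofBits P) (2 ^ l) hm x y i
      = ((bitsPoly (secondHalf x) * ∏ j ∈ range l, u ^ 2 ^ j) %ₘ P).coeff i := by
  have h : (bitsPoly (secondHalf x) * ∏ j ∈ range l, u ^ 2 ^ j) %ₘ P
      = (bitsPoly (secondHalf x) *
        ∑ j ∈ range (2 ^ l), (bitsPoly y * bitsPoly (firstHalf x)) ^ j) %ₘ P := by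
    refine modByMonic_congr hP ?_
    rw [sum_pow_eq_prod]
    simp only [map_mul, map_prod, map_pow, hu]
  rw [h, ← AdjoinRoot.modByMonicHom_mk hP]
  simp only [map_mul, map_sum, map_pow]
  rfl

/-- The accumulator in array `16` is multiplied by the power in array `15`, which is squared. -/
def powerStepP : Program :=
  .seq (fill 4 11 (cell 16 (reg 20)))
  (.seq (fill 5 11 (cell 15 (reg 20)))
  (.seq fieldMulP
  (.seq (fill 16 11 (cell 4 (reg 20)))
  (.seq (fill 4 11 (cell 15 (reg 20)))
  (.seq (fill 5 11 (cell 15 (reg 20)))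
  (.seq fieldMulP
  (.seq (fill 15 11 (cell 4 (reg 20))) (.setReg 18 (reg 18 - const 1)))))))))

/-- The program that computes the extractor. -/
def extractP : Program :=
  .seq setupP
  (.seq newtonP
  (.seq (fill 4 11 (less (reg 20) (reg 4) * cell 1 (reg 20)))
  (.seq (fill 5 11 (cell 2 (reg 20)))
  (.seq fieldMulP
  (.seq (fill 15 11 (bxor (cell 4 (reg 20)) (less (reg 20) (const 1))))
  (.seq (fill 16 11 (less (reg 20) (reg 4) * cell 1 (reg 20 + reg 4)))
  (.seq (.setReg 18 (reg 2))
  (.seq (.whileNonzero (reg 18) powerStepP) (fill 3 3 (cell 16 (reg 20)))))))))))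

/-- The contents of the registers and arrays after `j` rounds of the main loop. -/
def PowerInv (P u v : (ZMod 2)[X]) (κ l j : ℕ) (s : RamState) : Prop :=
  s.reg 18 = l - j ∧
    HoldsPoly (s.mem 16) (2 * 2 ^ κ) ((v * ∏ i ∈ range j, u ^ 2 ^ i) %ₘ P) ∧
    HoldsPoly (s.mem 15) (2 * 2 ^ κ) (u ^ 2 ^ j %ₘ P)

lemma Runs.powerStepP {κ l j U : ℕ} {P u v : (ZMod 2)[X]} (hP : P.Monic) (ht0 : 0 < P.natDegree)
    (ht : P.natDegree ≤ 2 ^ κ) (hl : l < 2 ^ w) (hj : j < l) (hs : FieldEnv w κ P s)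
    (hU : U = 2 ^ κ * (κ + 1)) (hI : PowerInv P u v κ l j s) :
    Runs w powerStepP s (98000 * U) (PowerInv P u v κ l (j + 1)) := by
  obtain ⟨h18, h16, h15⟩ := hI
  have h1κ : 1 ≤ 2 ^ κ := Nat.one_le_two_pow
  have hU1 : 1 ≤ U := by rw [hU]; exact Nat.succ_le_of_lt (by positivity)
  have hnU : 2 ^ κ ≤ U := by rw [hU]; exact Nat.le_mul_of_pos_right _ (by omega)
  have hlt := hs.mul.lt
  have hdeg : ∀ f : (ZMod 2)[X], (f %ₘ P).natDegree < P.natDegree := fun f =>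
    natDegree_modByMonic_lt f hP fun h => by simp [h] at ht0
  set A := (v * ∏ i ∈ range j, u ^ 2 ^ i) %ₘ P with hA
  set B := u ^ 2 ^ j %ₘ P with hB
  have hmul : ∀ {s : RamState} {f g : (ZMod 2)[X]}, FieldEnv w κ P s →
      HoldsPoly (s.mem 4) (2 * 2 ^ κ) f → HoldsPoly (s.mem 5) (2 * 2 ^ κ) g →
      f.natDegree < P.natDegree → g.natDegree < P.natDegree →
      Runs w _root_.fieldMulP s (48500 * U)
        fun s' => HoldsPoly (s'.mem 4) (2 * 2 ^ κ) ((f * g) %ₘ P) := by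
    intro s f g hs hf hg hfd hgd
    rw [hU]
    exact Runs.fieldMulP hP ht0 ht hs hf hfd hg hgd
  refine Runs.chain hU1 (by norm_num) (Runs.fillPoly (f := A) hs.r11 (by decide) (by omega)
    (by decide) hU1 (by omega) (by decide) ?_) fun s1 hf1 h4 => ?_
  · intro i hi
    simpa using h16 i hi
  replace hs := hs.of_frame hf1 (by decide) (by decide)
  rw [← hf1.mem 15 (by decide)] at h15
  rw [← hf1.reg 18 (by decide)] at h18
  refine Runs.chain hU1 (by norm_num) (Runs.fillPoly (f := B) hs.r11 (by decide) (by omega)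
    (by decide) hU1 (by omega) (by decide) ?_) fun s2 hf2 h5 => ?_
  · intro i hi
    simpa using h15 i hi
  replace hs := hs.of_frame hf2 (by decide) (by decide)
  rw [← hf2.mem 15 (by decide)] at h15
  rw [← hf2.mem 4 (by decide)] at h4
  rw [← hf2.reg 18 (by decide)] at h18
  refine Runs.chain hU1 (by norm_num) (hmul hs h4 h5 (hdeg _) (hdeg _)) fun s3 hf3 h4 => ?_
  replace hs := hs.of_frame hf3 (by decide) (by decide)
  rw [← hf3.mem 15 (by decide)] at h15
  rw [← hf3.reg 18 (by decide)] at h18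
  refine Runs.chain hU1 (by norm_num) (Runs.fillPoly (f := (A * B) %ₘ P) hs.r11 (by decide)
    (by omega) (by decide) hU1 (by omega) (by decide) ?_) fun s4 hf4 h16 => ?_
  · intro i hi
    simpa using h4 i hi
  replace hs := hs.of_frame hf4 (by decide) (by decide)
  rw [← hf4.mem 15 (by decide)] at h15
  rw [← hf4.reg 18 (by decide)] at h18
  refine Runs.chain hU1 (by norm_num) (Runs.fillPoly (f := B) hs.r11 (by decide) (by omega)
    (by decide) hU1 (by omega) (by decide) ?_) fun s5 hf5 h4 => ?_
  · intro i hi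
    simpa using h15 i hi
  replace hs := hs.of_frame hf5 (by decide) (by decide)
  rw [← hf5.mem 15 (by decide)] at h15
  rw [← hf5.mem 16 (by decide)] at h16
  rw [← hf5.reg 18 (by decide)] at h18
  refine Runs.chain hU1 (by norm_num) (Runs.fillPoly (f := B) hs.r11 (by decide) (by omega)
    (by decide) hU1 (by omega) (by decide) ?_) fun s6 hf6 h5 => ?_
  · intro i hi
    simpa using h15 i hi
  replace hs := hs.of_frame hf6 (by decide) (by decide)
  rw [← hf6.mem 4 (by decide)] at h4
  rw [← hf6.mem 16 (by decide)] at h16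
  rw [← hf6.reg 18 (by decide)] at h18
  refine Runs.chain hU1 (by norm_num) (hmul hs h4 h5 (hdeg _) (hdeg _)) fun s7 hf7 h4 => ?_
  replace hs := hs.of_frame hf7 (by decide) (by decide)
  rw [← hf7.mem 16 (by decide)] at h16
  rw [← hf7.reg 18 (by decide)] at h18
  refine Runs.chain hU1 (by norm_num) (Runs.fillPoly (f := (B * B) %ₘ P) hs.r11 (by decide)
    (by omega) (by decide) hU1 (by omega) (by decide) ?_) fun s8 hf8 h15 => ?_
  · intro i hi
    simpa using h4 i hi
  rw [← hf8.mem 16 (by decide)] at h16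
  rw [← hf8.reg 18 (by decide)] at h18
  have hAB : (A * B) %ₘ P = (v * ∏ i ∈ range (j + 1), u ^ 2 ^ i) %ₘ P := by
    refine modByMonic_congr hP ?_
    rw [map_mul, hA, hB, mk_modByMonic hP, mk_modByMonic hP, ← map_mul, prod_range_succ, mul_assoc]
  have hBB : (B * B) %ₘ P = u ^ 2 ^ (j + 1) %ₘ P := by
    refine modByMonic_congr hP ?_
    rw [map_mul, hB, mk_modByMonic hP, ← map_mul, ← pow_add, pow_succ, mul_two]
  rw [hAB] at h16
  rw [hBB] at h15
  refine (Runs.setReg (l - (j + 1)) ?_ ⟨by simp, h16, h15⟩).budget ?_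
  · rw [WordExpr.eval_sub, eval_reg, eval_const, h18, Nat.mod_eq_of_lt (a := 1) (by omega)]
    exact Nat.mod_eq_of_lt (by omega)
  · simp only [cost_reg, cost_sub, cost_const]
    omega

lemma Runs.extractP {κ l m t n₁ n₂ : ℕ} {P : (ZMod 2)[X]} (hP : P.Monic) (hdeg : P.natDegree = t)
    (ht0 : 0 < t) (hn₁ : n₁ = 2 * t) (hn₂ : n₂ ≤ t) (ht : t ≤ 2 ^ κ) (hκ : ∀ i < κ, 2 ^ i < t)
    (hw : 60 * (κ + 2) + 1 < w) (hl0 : 0 < l) (hl : l < 2 ^ w) (hm : m ≤ n₁ / 2)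
    (x : Bits n₁) (y : Bits n₂) :
    Runs w extractP (inputState P l m x y) (190000 * (l * (2 ^ κ * (κ + 1)))) fun s' =>
      ∀ i : Fin m, s'.mem 3 i = (razExtractor hP (ofBits P) (2 ^ l) hm x y i).val := by
  set U := 2 ^ κ * (κ + 1) with hU
  set V := l * U with hV
  have h1κ : 1 ≤ 2 ^ κ := Nat.one_le_two_pow
  have hUV : U ≤ V := Nat.le_mul_of_pos_left _ hl0
  have hU1 : 1 ≤ U := by rw [hU]; exact Nat.succ_le_of_lt (by positivity)
  have hnU : 2 ^ κ ≤ U := by rw [hU]; exact Nat.le_mul_of_pos_right _ (by omega)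
  have hV1 : 1 ≤ V := hU1.trans hUV
  have hhalf : n₁ / 2 = t := by omega
  set α := bitsPoly y with hα
  set β := bitsPoly (firstHalf x) with hβ
  set ν := bitsPoly (secondHalf x) with hν
  have hαd : α.natDegree < P.natDegree := natDegree_bitsPoly_lt _ (by omega) (by omega)
  have hβd : β.natDegree < P.natDegree := natDegree_bitsPoly_lt _ (by omega) (by omega)
  have hνd : ν.natDegree < P.natDegree := natDegree_bitsPoly_lt _ (by omega) (by omega)
  set u := 1 + (β * α) %ₘ P with hu
  have hmku : AdjoinRoot.mk P u = AdjoinRoot.mk P (1 + α * β) := by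
    rw [hu, map_add, mk_modByMonic hP, map_add, mul_comm]
  have hud : u.natDegree < P.natDegree := by
    refine (natDegree_add_le _ _).trans_lt (max_lt (by simp; omega) ?_)
    exact natDegree_modByMonic_lt _ hP fun h => by simp [h] at hdeg; omega
  refine Runs.chain hV1 (by norm_num) ((Runs.setupP (t := t) (κ := κ) hn₁ hw ht hκ).budget
    (Nat.mul_le_mul_left 1500 hUV)) fun s1 hf1 ⟨h4, h5, hM⟩ => ?_
  have hlt := hM.lt
  have hN : NewtonEnv w κ P s1 := ⟨by rw [h4, hdeg], h5, hM, by
    intro i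
    rw [hf1.mem 0 (by decide)]
    rfl⟩
  have h1 : s1.mem 1 = bitArray x := hf1.mem 1 (by decide)
  have h2 : s1.mem 2 = bitArray y := hf1.mem 2 (by decide)
  have hr2 : s1.reg 2 = l := hf1.reg 2 (by decide)
  have hr3 : s1.reg 3 = m := hf1.reg 3 (by decide)
  refine Runs.chain hV1 (by norm_num) ((Runs.newtonP hP (by omega) (by omega) hN).budget
    (Nat.mul_le_mul_left 33000 hUV)) fun s2 hf2 hs => ?_
  rw [← hf2.mem 1 (by decide)] at h1
  rw [← hf2.mem 2 (by decide)] at h2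
  rw [← hf2.reg 2 (by decide)] at hr2
  rw [← hf2.reg 3 (by decide)] at hr3
  refine Runs.chain hV1 (by norm_num) (Runs.fillPoly (f := β) hs.r11 (by decide) (by omega)
    (by decide) hV1 (by omega) (by decide) ?_) fun s3 hf3 hm4 => ?_
  · intro i hi
    simp only [WordExpr.eval_mul, eval_less, eval_cell, eval_reg, update_self,
      update_of_ne (show (4 : ℕ) ≠ 20 by norm_num), hs.r4, hdeg, h1]
    rw [hβ, ← bitArray_eq, bitArray, bitArray]
    have hx : ∀ b : ZMod 2, b.val % 2 ^ w = b.val := fun b =>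
      Nat.mod_eq_of_lt ((ZMod.val_lt b).trans_le (by omega))
    by_cases h : i < t
    · simp [h, show i < n₁ by omega, hhalf, firstHalf, hx,
        Nat.mod_eq_of_lt (show 1 < 2 ^ w by omega)]
    · simp [h, hhalf]
  replace hs := hs.of_frame hf3 (by decide) (by decide)
  rw [← hf3.mem 1 (by decide)] at h1
  rw [← hf3.mem 2 (by decide)] at h2
  rw [← hf3.reg 2 (by decide)] at hr2
  rw [← hf3.reg 3 (by decide)] at hr3
  refine Runs.chain hV1 (by norm_num) (Runs.fillPoly (f := α) hs.r11 (by decide) (by omega)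
    (by decide) hV1 (by omega) (by decide) ?_) fun s4 hf4 hm5 => ?_
  · intro i hi
    simp [h2, bitArray_eq, hα]
  replace hs := hs.of_frame hf4 (by decide) (by decide)
  rw [← hf4.mem 1 (by decide)] at h1
  rw [← hf4.mem 4 (by decide)] at hm4
  rw [← hf4.reg 2 (by decide)] at hr2
  rw [← hf4.reg 3 (by decide)] at hr3
  refine Runs.chain hV1 (by norm_num) ((Runs.fieldMulP hP (by omega) (by omega) hs hm4 hβd hm5
    hαd).budget (Nat.mul_le_mul_left 48500 hUV)) fun s5 hf5 hm4 => ?_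
  replace hs := hs.of_frame hf5 (by decide) (by decide)
  rw [← hf5.mem 1 (by decide)] at h1
  rw [← hf5.reg 2 (by decide)] at hr2
  rw [← hf5.reg 3 (by decide)] at hr3
  refine Runs.chain hV1 (by norm_num) (Runs.fillPoly (f := u) hs.r11 (by decide) (by omega)
    (by decide) hV1 (by omega) (by decide) ?_) fun s6 hf6 h15 => ?_
  · intro i hi
    have hxor : ∀ a b : ZMod 2, a.val ^^^ b.val = (b + a).val := by decide
    have hone : (if i < 1 then 1 else 0) % 2 ^ w = ((1 : (ZMod 2)[X]).coeff i).val := by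
      rw [coeff_one]
      rcases Nat.eq_zero_or_pos i with rfl | h
      · simp [Nat.mod_eq_of_lt (show 1 < 2 ^ w by omega)]
        rfl
      · simp [show i ≠ 0 by omega, show ¬ i < 1 by omega]
    simp only [eval_bxor, eval_less, eval_cell, eval_reg, eval_const, update_self]
    rw [Nat.mod_eq_of_lt (a := 1) (by omega), hone, hm4 i hi, hxor, hu, coeff_add]
    exact Nat.mod_eq_of_lt ((ZMod.val_lt _).trans_le (by omega))
  replace hs := hs.of_frame hf6 (by decide) (by decide)
  rw [← hf6.mem 1 (by decide)] at h1
  rw [← hf6.reg 2 (by decide)] at hr2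
  rw [← hf6.reg 3 (by decide)] at hr3
  refine Runs.chain hV1 (by norm_num) (Runs.fillPoly (f := ν) hs.r11 (by decide) (by omega)
    (by decide) hV1 (by omega) (by decide) ?_) fun s7 hf7 h16 => ?_
  · intro i hi
    simp only [WordExpr.eval_mul, WordExpr.eval_add, eval_less, eval_cell, eval_reg, update_self,
      update_of_ne (show (4 : ℕ) ≠ 20 by norm_num), hs.r4, hdeg, h1]
    rw [hν, ← bitArray_eq, bitArray, bitArray, Nat.mod_eq_of_lt (a := i + t) (by omega)]
    have hx : ∀ b : ZMod 2, b.val % 2 ^ w = b.val := fun b =>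
      Nat.mod_eq_of_lt ((ZMod.val_lt b).trans_le (by omega))
    by_cases h : i < t
    · simp [h, show i + t < n₁ by omega, hhalf, secondHalf, hx, add_comm t,
        Nat.mod_eq_of_lt (show 1 < 2 ^ w by omega)]
    · simp [h, hhalf]
  replace hs := hs.of_frame hf7 (by decide) (by decide)
  rw [← hf7.mem 15 (by decide)] at h15
  rw [← hf7.reg 2 (by decide)] at hr2
  rw [← hf7.reg 3 (by decide)] at hr3
  refine Runs.chain (a := 2) (Q' := fun s' => s'.reg 18 = l) hV1 (by norm_num)
    ((Runs.setReg l (by simp [hr2]) (by simp)).budget (Nat.mul_le_mul_left 2 hV1))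
    fun s8 hf8 h18 => ?_
  replace hs := hs.of_frame hf8 (by decide) (by decide)
  rw [← hf8.mem 15 (by decide)] at h15
  rw [← hf8.mem 16 (by decide)] at h16
  rw [← hf8.reg 3 (by decide)] at hr3
  refine Runs.chain (a := 98004) (Q' := PowerInv P u ν κ l l) hV1 (by norm_num)
    ((Runs.whileNonzero l (fun _ => 98000 * U) (PowerInv P u ν κ l) ⟨by simpa using h18, ?_, ?_⟩
      ?_ ?_).budget ?_) fun s9 hf9 ⟨_, h16, _⟩ => ?_
  · rw [range_zero, prod_empty, mul_one, (modByMonic_eq_self_iff hP).2 (degree_lt_degree hνd)]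
    exact h16
  · rw [pow_zero, pow_one, (modByMonic_eq_self_iff hP).2 (degree_lt_degree hud)]
    exact h15
  · intro j hj s' hf hI
    exact ⟨by rw [eval_reg, hI.1]; omega, Runs.powerStepP hP (by omega) (by omega) hl hj
      (hs.of_frame hf (by decide) (by decide)) hU hI⟩
  · intro s' _ hI
    simp [hI.1]
  · simp only [sum_const, card_range, smul_eq_mul, cost_reg]
    have : l * (98000 * U + 1 + 1) ≤ l * (98002 * U) := Nat.mul_le_mul_left _ (by omega)
    have h' : l * (98002 * U) = 98002 * V := by rw [hV]; ring
    omega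
  rw [← hf9.reg 3 (by decide)] at hr3
  refine (Runs.fillPoly (U := V) (f := (ν * ∏ i ∈ range l, u ^ 2 ^ i) %ₘ P) hr3 (by decide)
    (by omega) (by decide) hV1 (by omega) (by decide) ?_).budget
    (Nat.mul_le_mul_right _ (by norm_num)) |>.mono fun s' _ h i => ?_
  · intro i hi
    simpa using h16 i (by omega)
  · rw [h i i.2, razExtractor_apply hP hm x y i hmku]

end Extraction

/-- With `κ` the rounded-up logarithm of `n₁ / 2`, one has `2 ^ κ ≤ n₁` and `κ + 1 ≤ 2 * log n₁`,
which converts the budget and doubles its constant. -/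
lemma computesWithin_extractP {n₁ n₂ : ℕ} (hn₁ : 0 < n₁) (heven : Even n₁) (hn₂ : n₂ ≤ n₁ / 2)
    {P : Polynomial (ZMod 2)} (hP : P.Monic) (hdeg : P.natDegree = n₁ / 2) {m l : ℕ}
    (hl0 : 0 < l) (hm : m ≤ n₁ / 2) (hl : (l : ℝ) ≤ n₂ + Real.logb 2 ((n₁ : ℝ) / 2)) {w : ℕ}
    (hw : n₁ ^ 200 ≤ 2 ^ w) (x : Bits n₁) (y : Bits n₂) :
    ComputesWithin w extractP (inputState P l m x y)
      (380000 * (n₁ * Real.logb 2 n₁ * Real.logb 2 ((2 : ℝ) ^ l)))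
      (razExtractor hP (ofBits P) (2 ^ l) hm x y) := by
  obtain ⟨t, rfl⟩ := heven.two_dvd
  have ht0 : 0 < t := by omega
  have hhalf : 2 * t / 2 = t := by omega
  set κ := Nat.clog 2 t with hκ
  have hκt : ∀ i < κ, 2 ^ i < t := fun i hi => Nat.pow_lt_of_lt_clog hi
  have htκ : t ≤ 2 ^ κ := Nat.le_pow_clog (by norm_num) t
  have hκn : 2 ^ κ ≤ 2 * t := by
    rcases Nat.eq_zero_or_pos κ with h | h
    · rw [h]
      omega
    · have := hκt (κ - 1) (by omega)
      have h2 : 2 ^ κ = 2 ^ (κ - 1) * 2 := by rw [← pow_succ, Nat.sub_add_cancel h]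
      omega
  -- The modulus needs `60 * (κ + 2) + 1 < 60 * κ + 140` bits. The exponent 200 is `60 + 140`, from
  -- `2 ^ κ ≤ n₁` and `2 ≤ n₁`.
  have hκw : 60 * (κ + 2) + 1 < w := by
    have h : 2 ^ (60 * κ + 140) ≤ 2 ^ w := by
      calc 2 ^ (60 * κ + 140) = (2 ^ κ) ^ 60 * 2 ^ 140 := by rw [pow_add, mul_comm 60, pow_mul]
        _ ≤ (2 * t) ^ 60 * (2 * t) ^ 140 := by gcongr; omega
        _ = (2 * t) ^ 200 := by rw [← pow_add]
        _ ≤ 2 ^ w := hw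
    have := (Nat.pow_le_pow_iff_right (by norm_num : 1 < 2)).1 h
    omega
  -- Both `n₂` and `log t` are at most `t`, so `l` fits in a word.
  have hlt : l ≤ 2 * t := by
    have h1 : Real.logb 2 (((2 * t : ℕ) : ℝ) / 2) ≤ t := by
      have h2 : (((2 * t : ℕ) : ℝ) / 2) = t := by push_cast; ring
      rw [h2, Real.logb_le_iff_le_rpow (by norm_num) (by exact_mod_cast ht0), Real.rpow_natCast]
      exact_mod_cast Nat.lt_two_pow_self.le
    have h3 : (n₂ : ℝ) ≤ t := by exact_mod_cast hn₂.trans hhalf.le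
    have h4 : (l : ℝ) ≤ (2 * t : ℕ) := by push_cast; linarith
    exact_mod_cast h4
  have hlw : l < 2 ^ w := by
    have := Nat.pow_lt_pow_right (a := 2 * t) (m := 1) (n := 200) (by omega) (by norm_num)
    rw [pow_one] at this
    exact (hlt.trans_lt this).trans_le hw
  obtain ⟨T, s', h1, h2, h3⟩ := Runs.extractP (t := t) hP (hdeg.trans hhalf) ht0 rfl
    (hn₂.trans hhalf.le) htκ hκt hκw hl0 hlw hm x y
  refine ⟨T, s', h1, ?_, h3⟩
  have hlog : ∀ j : ℕ, 2 ^ j ≤ 2 * t → (j : ℝ) ≤ Real.logb 2 (2 * t : ℕ) := by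
    intro j hj
    rw [Real.le_logb_iff_rpow_le (by norm_num) (by exact_mod_cast hn₁), Real.rpow_natCast]
    exact_mod_cast hj
  have hκ1 : (κ : ℝ) + 1 ≤ 2 * Real.logb 2 (2 * t : ℕ) := by
    have := hlog κ hκn
    have := hlog 1 (by omega)
    push_cast at *
    linarith
  have hll : Real.logb 2 ((2 : ℝ) ^ l) = l := by
    rw [← Real.rpow_natCast, Real.logb_rpow (by norm_num) (by norm_num)]
  rw [hll]
  calc (T : ℝ) ≤ (190000 * (l * (2 ^ κ * (κ + 1))) : ℕ) := by exact_mod_cast h2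
    _ = 190000 * (l * ((2 ^ κ : ℕ) * ((κ : ℝ) + 1))) := by push_cast; ring
    _ ≤ 190000 * (l * ((2 * t : ℕ) * (2 * Real.logb 2 (2 * t : ℕ)))) := by
      have : ((2 ^ κ : ℕ) : ℝ) ≤ (2 * t : ℕ) := by exact_mod_cast hκn
      gcongr
    _ = 380000 * ((2 * t : ℕ) * Real.logb 2 (2 * t : ℕ) * l) := by ring

theorem lemma5 :
    (∀ (n₁ n₂ : ℕ), 0 < n₁ → 0 < n₂ → Even n₁ → n₂ ≤ n₁ / 2 →
      -- the field with `2 ^ (n₁ / 2)` elements, and the elements that label the blocks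
      ∀ (P : Polynomial (ZMod 2)) (hP : P.Monic), Irreducible P → P.natDegree = n₁ / 2 →
      ∀ a : Bits n₂ → AdjoinRoot P, Function.Injective a →
      ∀ (k₁ k₂ m l p : ℕ) (γ ζ : ℝ), 0 < k₁ → 0 < k₂ → 0 < m → 0 < l → 0 < p → 0 < γ →
      ∀ (hm : m ≤ n₁ / 2), (l : ℝ) ≤ n₂ + Real.logb 2 ((n₁ : ℝ) / 2) →
      (p : ℝ) ≤ (2 : ℝ) ^ l / m → Even p →
      ζ = (2 : ℝ) ^ ((l : ℝ) - (n₁ : ℝ) / 2) →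
      (2 : ℝ) ^ (((n₁ : ℝ) - k₁) / p) *
        ((2 * ζ) ^ (1 / (p : ℝ)) + p * (2 : ℝ) ^ (-(k₂ : ℝ) / 2)) ≤ γ →
      -- (i)
      IsBiasedGenerator (2 ^ l) (2 * ζ)
        (bitGenerator hP a (2 ^ l) : Bits n₁ → Bits n₂ × Fin (n₁ / 2) → ZMod 2) ∧
      -- (ii)
      IsTwoSourceExtractor (k₁ : ℝ) (k₂ : ℝ) ((2 : ℝ) ^ ((m : ℝ) / 2) * γ)
        (razExtractor hP a (2 ^ l) hm) ∧
      IsStrongTwoSourceExtractor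
        ((k₁ : ℝ) + (m : ℝ) / 2 + 2 + Real.logb 2 (1 / γ))
        ((k₂ : ℝ) + (m : ℝ) / 2 + 2 + Real.logb 2 (1 / γ))
        (γ * (2 : ℝ) ^ ((m : ℝ) / 2 + 1))
        (razExtractor hP a (2 ^ l) hm)) ∧
    -- (iii): one program and one constant for all parameters, on words of at least
    -- `c * log n₁` bits
    (∃ (prog : Program) (c : ℕ) (C : ℝ),
      ∀ (n₁ n₂ : ℕ), 0 < n₁ → 0 < n₂ → Even n₁ → n₂ ≤ n₁ / 2 →
      ∀ (P : Polynomial (ZMod 2)) (hP : P.Monic), Irreducible P → P.natDegree = n₁ / 2 →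
      ∀ (m l : ℕ), 0 < m → 0 < l →
      ∀ (hm : m ≤ n₁ / 2), (l : ℝ) ≤ n₂ + Real.logb 2 ((n₁ : ℝ) / 2) →
      ∀ w : ℕ, n₁ ^ c ≤ 2 ^ w →
      ∀ (x : Bits n₁) (y : Bits n₂),
        ComputesWithin w prog (inputState P l m x y)
          (C * (n₁ * Real.logb 2 n₁ * Real.logb 2 ((2 : ℝ) ^ l)))
          (razExtractor hP (ofBits P) (2 ^ l) hm x y)) := by
  refine ⟨?_, extractP, 200, 380000, ?_⟩
  · intro n₁ n₂ h₁ _ heven _ P hP hirr hdeg a ha k₁ k₂ m l p γ ζ _ _ hm0 _ hp0 hγ0 hm hl hpl hpe hζ hγ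
    exact bias_and_extraction h₁ heven hP hirr hdeg a ha hm0 hp0 hγ0 hm hl hpl hpe hζ hγ
  · intro n₁ n₂ h₁ _ heven hn₂ P hP _ hdeg m l _ hl0 hm hl w hw x y
    exact computesWithin_extractP h₁ heven hn₂ hP hdeg hl0 hm hl hw x y
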